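/- Conventions. For a field $K$ of characteristic $0$, a branched cover (or mere cover) of $\mathbb{P}^1_K$ is a finite, generically étale morphism $X_K\to\mathbb{P}^1_K$ where $X_K$ is a connected, normal, complete curve over $K$; it is Galois if the extension of function fields $\kappa(X_K)/\kappa(\mathbb{P}^1_K)$ is Galois. For a finite group $G$, a $G$-Galois branched cover is a Galois branched cover together with an isomorphism of $\mathrm{Gal}(\kappa(X_K)/\kappa(\mathbb{P}^1_K))$ with $G$. Two mere covers of $\mathbb{P}^1_K$ are isomorphic if there is an isomorphism of the covering curves over $\mathbb{P}^1_K$; two $G$-Galois branched covers are isomorphic if this isomorphism can be chosen compatible with the identifications of the Galois groups with $G$. Let $X\to\mathbb{P}^1_{\bar{\mathbb{Q}}}$ be a $G$-Galois branched cover and $K\subseteq\bar{\mathbb{Q}}$ a subfield. A $K$-model is a branched cover $X_K\to\mathbb{P}^1_K$ whose base change to $\bar{\mathbb{Q}}$ is isomorphic to $X\to\mathbb{P}^1_{\bar{\mathbb{Q}}}$ as a mere cover. $K$ is a field of definition as a mere cover (the cover descends to $K$ as a mere cover) if there is a $K$-model, and a field of definition as a $G$-Galois branched cover if there is a $K$-model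 that is Galois. The field of moduli as a mere cover (resp. as a $G$-Galois branched cover) is the subfield of $\bar{\mathbb{Q}}$ fixed by all $\sigma\in\mathrm{Gal}(\bar{\mathbb{Q}}/\mathbb{Q})$ such that the twist of the cover by $\sigma$ is isomorphic to the cover as a mere cover (resp. as a $G$-Galois branched cover). Statement. Let $G$ be a finite group and $X\to\mathbb{P}^1_{\bar{\mathbb{Q}}}$ a $G$-Galois branched cover. Let $F$ be its field of moduli as a mere cover and $M$ its field of moduli as a $G$-Galois branched cover. Then: (1) A number field $L\subset\bar{\mathbb{Q}}$ is a field of definition as a mere cover if and only if $F\subseteq L$. In this case there is a field of definition $E\supseteq L$ as a $G$-Galois branched cover that is finite Galois over $L$ with $\mathrm{Gal}(E/L)$ isomorphic to a subgroup of $\mathrm{Aut}(G)$. In particular, $M$ is a number field to which the cover descends as a mere cover, and there is a field of definition as a $G$-Galois branched cover that is finite Galois over $M$ with Galois group isomorphic to a subgroup of $\mathrm{Aut}(G)$. (2) If the cover descends as a mere cover to a number field $L\subset\bar{\mathbb{Q}}$, then there is a subgroup $H\le\mathrm{Aut}(G)$ such that $G\rtimes H$ (with the natural action of $H$ on $G$)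 is the Galois group of a finite Galois extension of $L$. (3) $F\subseteq M$, and $M/F$ is Galois with Galois group isomorphic to a subquotient of $\mathrm{Aut}(G)$, i.e. to $H/N$ for some $H\le\mathrm{Aut}(G)$ and $N\trianglelefteq H$. -/

import Mathlib

open CategoryTheory AlgebraicGeometry

noncomputable section

/-- The field `ℚ̄` of algebraic numbers. -/
abbrev Qbar : Type := AlgebraicClosure ℚ

/-! ### The projective line -/

attribute [local instance] MvPolynomial.gradedAlgebra

/-- The projective line `ℙ¹_K = Proj K[X₀, X₁]` over a field `K`. -/
def P1 (K : Type) [Field K] : Scheme.{0} :=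
  Proj (MvPolynomial.homogeneousSubmodule (Fin 2) K)

/-- A ring homomorphism `φ : K → E` induces a homomorphism of graded rings
`K[X₀, X₁] → E[X₀, X₁]` fixing the variables. -/
def P1.gradedMap {K E : Type} [Field K] [Field E] (φ : K →+* E) :
    GradedRingHom (MvPolynomial.homogeneousSubmodule (Fin 2) K)
      (MvPolynomial.homogeneousSubmodule (Fin 2) E) where
  toRingHom := MvPolynomial.map φ
  map_mem hx := MvPolynomial.IsHomogeneous.map hx φ

theorem P1.irrelevant_le {K E : Type} [Field K] [Field E] (φ : K →+* E) :
    HomogeneousIdeal.irrelevant (MvPolynomial.homogeneousSubmodule (Fin 2) E) ≤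
      (HomogeneousIdeal.irrelevant (MvPolynomial.homogeneousSubmodule (Fin 2) K)).map
        (P1.gradedMap φ) := by
  rw [HomogeneousIdeal.irrelevant_le]
  intro i hi x hx
  have hx' : x.IsHomogeneous i := hx
  have hX : ∀ j : Fin 2, (MvPolynomial.X j : MvPolynomial (Fin 2) E) ∈
      ((HomogeneousIdeal.irrelevant (MvPolynomial.homogeneousSubmodule (Fin 2) K)).map
        (P1.gradedMap φ)).toIdeal := by
    intro j
    have h1 : (MvPolynomial.X j : MvPolynomial (Fin 2) K) ∈
        (HomogeneousIdeal.irrelevant (MvPolynomial.homogeneousSubmodule (Fin 2) K)).toIdeal :=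
      HomogeneousIdeal.mem_irrelevant_of_mem _ one_pos (MvPolynomial.isHomogeneous_X K j)
    have h2 := Ideal.mem_map_of_mem (P1.gradedMap φ) h1
    have h3 : P1.gradedMap φ (MvPolynomial.X j) = MvPolynomial.X j := MvPolynomial.map_X φ j
    rw [h3] at h2
    exact h2
  change x ∈ ((HomogeneousIdeal.irrelevant (MvPolynomial.homogeneousSubmodule (Fin 2) K)).map
        (P1.gradedMap φ)).toIdeal
  rw [MvPolynomial.as_sum x]
  refine Ideal.sum_mem _ fun d hd => ?_
  have hdeg := hx' (MvPolynomial.mem_support_iff.mp hd)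
  have hd0 : d ≠ 0 := by
    rintro rfl
    simp at hdeg
    omega
  obtain ⟨j, hj⟩ := Finsupp.ne_iff.mp hd0
  have hdvd : (MvPolynomial.X j : MvPolynomial (Fin 2) E) ∣
      MvPolynomial.monomial d (MvPolynomial.coeff d x) := by
    rw [MvPolynomial.X_dvd_monomial]
    exact Or.inr hj
  exact Ideal.mem_of_dvd _ hdvd (hX j)

/-- The morphism `ℙ¹_E ⟶ ℙ¹_K` induced by `φ : K → E`. For an inclusion of fields it is the
projection of the base change; for an automorphism `φ` of `K` it is the automorphism of the scheme
`ℙ¹_K` which acts on constants through `φ` and fixes the coordinate. -/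
def P1.map {K E : Type} [Field K] [Field E] (φ : K →+* E) : P1 E ⟶ P1 K :=
  Proj.map (P1.gradedMap φ) (P1.irrelevant_le φ)

theorem P1.map_id (K : Type) [Field K] : P1.map (RingHom.id K) = 𝟙 (P1 K) := by
  have h : P1.gradedMap (RingHom.id K) =
      GradedRingHom.id (MvPolynomial.homogeneousSubmodule (Fin 2) K) := by
    apply DFunLike.ext
    intro x
    exact MvPolynomial.map_id x
  unfold P1.map
  have := Proj.map_id (𝒜 := MvPolynomial.homogeneousSubmodule (Fin 2) K)
  simp only [h]
  exact this

theorem P1.map_comp {K E F : Type} [Field K] [Field E] [Field F] (φ : K →+* E) (ψ : E →+* F) :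
    P1.map (ψ.comp φ) = P1.map ψ ≫ P1.map φ := by
  have h : P1.gradedMap (ψ.comp φ) = (P1.gradedMap ψ).comp (P1.gradedMap φ) := by
    apply DFunLike.ext
    intro x
    exact (MvPolynomial.map_map φ ψ x).symm
  unfold P1.map
  simp only [h]
  exact Proj.map_comp _ _ _ _

instance P1.isIso_map {K E : Type} [Field K] [Field E] (σ : K ≃+* E) :
    IsIso (P1.map (σ : K →+* E)) := by
  refine ⟨P1.map (σ.symm : E →+* K), ?_, ?_⟩
  · rw [← P1.map_comp, ← P1.map_id]
    congr 1
    ext x; simp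
  · rw [← P1.map_comp, ← P1.map_id]
    congr 1
    ext x; simp

instance P1.isIntegral (K : Type) [Field K] : IsIntegral (P1 K) := by
  have : IsReduced (P1 K) := by
    refine @IsReduced.of_openCover _
      (Proj.affineOpenCover (MvPolynomial.homogeneousSubmodule (Fin 2) K)).openCover fun i => ?_
    have : _root_.IsReduced (HomogeneousLocalization.Away
        (MvPolynomial.homogeneousSubmodule (Fin 2) K) (i.2 : MvPolynomial (Fin 2) K)) :=
      isReduced_of_injective
        (algebraMap (HomogeneousLocalization.Away
          (MvPolynomial.homogeneousSubmodule (Fin 2) K) (i.2 : MvPolynomial (Fin 2) K))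
          (Localization.Away (i.2 : MvPolynomial (Fin 2) K)))
        (HomogeneousLocalization.val_injective _)
    exact inferInstanceAs (IsReduced (Spec (CommRingCat.of (HomogeneousLocalization.Away
        (MvPolynomial.homogeneousSubmodule (Fin 2) K) (i.2 : MvPolynomial (Fin 2) K)))))
  have : IrreducibleSpace (P1 K) := by
    let 𝒜 := MvPolynomial.homogeneousSubmodule (Fin 2) K
    let p : ProjectiveSpectrum 𝒜 :=
      { asHomogeneousIdeal := ⊥
        isPrime := Ideal.isPrime_bot
        not_irrelevant_le := by
          intro h
          have h1 : (MvPolynomial.X 0 : MvPolynomial (Fin 2) K) ∈ HomogeneousIdeal.irrelevant 𝒜 :=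
            HomogeneousIdeal.mem_irrelevant_of_mem _ one_pos (MvPolynomial.isHomogeneous_X K 0)
          have h2 : (MvPolynomial.X 0 : MvPolynomial (Fin 2) K) = 0 := h h1
          exact MvPolynomial.X_ne_zero 0 h2 }
    have hp : closure ({p} : Set (ProjectiveSpectrum 𝒜)) = Set.univ := by
      rw [Set.eq_univ_iff_forall]
      intro y
      rw [← ProjectiveSpectrum.le_iff_mem_closure]
      exact (bot_le : (⊥ : HomogeneousIdeal 𝒜) ≤ y.asHomogeneousIdeal)
    have hirr : IsIrreducible (Set.univ : Set (ProjectiveSpectrum 𝒜)) :=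
      hp ▸ isIrreducible_singleton.closure
    exact (irreducibleSpace_def (X := ProjectiveSpectrum 𝒜)).mpr hirr
  exact isIntegral_of_irreducibleSpace_of_isReduced _

/-! ### Function fields -/

section FunctionField

variable {X Y Z : Scheme.{0}} [IrreducibleSpace X] [IrreducibleSpace Y] [IrreducibleSpace Z]

theorem genericPoint_map_specializes (f : X ⟶ Y) [IsDominant f] :
    f (genericPoint X) ⤳ genericPoint Y := by
  have h := (genericPoint_spec X).image f.continuous
  rw [Set.image_univ, f.denseRange.closure_range] at h
  exact h.specializes trivial

/-- The homomorphism `f^* : κ(Y) → κ(X)` of function fields induced by a dominant morphism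
`f : X ⟶ Y` of integral schemes. -/
def functionFieldMap (f : X ⟶ Y) [IsDominant f] : Y.functionField ⟶ X.functionField :=
  Y.presheaf.stalkSpecializes (genericPoint_map_specializes f) ≫ f.stalkMap (genericPoint X)

theorem functionFieldMap_comp (f : X ⟶ Y) (g : Y ⟶ Z) [IsDominant f] [IsDominant g] :
    functionFieldMap (f ≫ g) = functionFieldMap g ≫ functionFieldMap f := by
  unfold functionFieldMap
  rw [Scheme.Hom.stalkMap_comp, Category.assoc,
    ← Scheme.Hom.stalkSpecializes_stalkMap_assoc g _ _ (genericPoint_map_specializes f),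
    TopCat.Presheaf.stalkSpecializes_comp_assoc]
  rfl

theorem functionFieldMap_id : functionFieldMap (𝟙 X) = 𝟙 X.functionField := by
  unfold functionFieldMap
  simp

instance isIso_functionFieldMap (f : X ⟶ Y) [IsIso f] : IsIso (functionFieldMap f) := by
  refine ⟨functionFieldMap (inv f), ?_, ?_⟩
  · rw [← functionFieldMap_comp, ← functionFieldMap_id]
    congr 1
    simp
  · rw [← functionFieldMap_comp, ← functionFieldMap_id]
    congr 1
    simp

end FunctionField

/-! ### Branched covers of the projective line -/

/-- A branched cover of `ℙ¹_K` by a connected, normal, complete curve over `K`: a finite,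
generically étale morphism `X ⟶ ℙ¹_K`, where `X` is an integral normal scheme (a connected normal
noetherian scheme is the same thing as an integral normal noetherian one). The structure morphism
of `X` over `K` is the composite `X ⟶ ℙ¹_K ⟶ Spec K`. As `X` is finite over `ℙ¹_K` and dominates
it, `X` is automatically noetherian, proper over `K` and of dimension one. (Dominance is implied by
generic étaleness; it is recorded in order to have the map of function fields at hand.) -/
structure BranchedCover (K : Type) [Field K] where
  X : Scheme.{0}
  hom : X ⟶ P1 K
  isIntegral : IsIntegral X
  normal : ∀ x : X, IsIntegrallyClosed (X.presheaf.stalk x)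
  isFinite : IsFinite hom
  isDominant : IsDominant hom
  genericallyEtale : ∃ U : X.Opens, Dense (U : Set X) ∧ Etale (U.ι ≫ hom)

namespace BranchedCover

variable {K : Type} [Field K]

instance (C : BranchedCover K) : IsIntegral C.X := C.isIntegral

instance (C : BranchedCover K) : IsDominant C.hom := C.isDominant

/-- The function field `κ(X)` of a cover `X ⟶ ℙ¹_K`. -/
def FunctionField (C : BranchedCover K) : Type := C.X.functionField

instance (C : BranchedCover K) : Field C.FunctionField :=
  inferInstanceAs (Field C.X.functionField)

/-- `κ(X)` as an extension of `κ(ℙ¹_K)`, through the pullback of rational functions. -/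
instance (C : BranchedCover K) : Algebra (P1 K).functionField C.FunctionField :=
  RingHom.toAlgebra (functionFieldMap C.hom).hom

/-- The cover is Galois: the extension `κ(X) / κ(ℙ¹_K)` is Galois. -/
def IsGaloisCover (C : BranchedCover K) : Prop :=
  IsGalois (P1 K).functionField C.FunctionField

/-- The homomorphism `κ(X') → κ(X)` induced by an isomorphism `η : X ≅ X'`. -/
def pullbackFunction {C C' : BranchedCover K} (η : C.X ≅ C'.X) :
    C'.FunctionField →+* C.FunctionField :=
  (functionFieldMap η.hom).hom

/-- Isomorphism of mere covers: an isomorphism `η : X ≅ X'` over `ℙ¹_K`. -/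
def IsIsomorphic (C C' : BranchedCover K) : Prop :=
  ∃ η : C.X ≅ C'.X, η.hom ≫ C'.hom = C.hom

/-- The twist of the cover `X ⟶ ℙ¹_K` by an automorphism `σ` of `K`, i.e. the cover obtained by
applying `σ` to the coefficients: the base change of `X` along `Spec K ≅ Spec K`. Since the base
change is along an isomorphism, this is the same scheme `X`, with the morphism to `ℙ¹_K` composed
with the inverse of the automorphism `P1.map σ` of `ℙ¹_K`. -/
def twist (C : BranchedCover K) (σ : K ≃+* K) : BranchedCover K where
  X := C.X
  hom := C.hom ≫ P1.map (σ.symm : K →+* K)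
  isIntegral := C.isIntegral
  normal := C.normal
  isFinite := by
    have := C.isFinite
    infer_instance
  isDominant := inferInstance
  genericallyEtale := by
    obtain ⟨U, hU, h⟩ := C.genericallyEtale
    refine ⟨U, hU, ?_⟩
    rw [← Category.assoc]
    infer_instance

/-- The function field of the twist is the function field of the cover, as a field. -/
def twistEquiv (C : BranchedCover K) (σ : K ≃+* K) :
    C.FunctionField ≃+* (C.twist σ).FunctionField :=
  RingEquiv.refl C.FunctionField

/-- The automorphism of `κ(ℙ¹_K)` by which the algebra structures of `κ(X)` and of the function
field of the twist differ. -/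
def baseEquiv (σ : K ≃+* K) : (P1 K).functionField ≃+* (P1 K).functionField :=
  (asIso (functionFieldMap (P1.map (σ : K →+* K)))).commRingCatIsoToRingEquiv

theorem twistEquiv_algebraMap (C : BranchedCover K) (σ : K ≃+* K) (z : (P1 K).functionField) :
    C.twistEquiv σ (algebraMap _ C.FunctionField z) =
      algebraMap _ (C.twist σ).FunctionField (baseEquiv σ z) := by
  have h1 : P1.map (σ.symm : K →+* K) ≫ P1.map (σ : K →+* K) = 𝟙 _ := by
    rw [← P1.map_comp, ← P1.map_id]
    congr 1
    ext x; simp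
  have h2 : functionFieldMap (P1.map (σ : K →+* K)) ≫
      functionFieldMap (C.hom ≫ P1.map (σ.symm : K →+* K)) = functionFieldMap C.hom := by
    rw [← functionFieldMap_comp]
    congr 1
    rw [Category.assoc, h1, Category.comp_id]
  exact (congrArg (fun φ => φ.hom z) h2).symm

theorem twist_isGaloisCover (C : BranchedCover K) (σ : K ≃+* K) (h : C.IsGaloisCover) :
    (C.twist σ).IsGaloisCover := by
  have : IsGalois (P1 K).functionField C.FunctionField := h
  refine IsGalois.of_equiv_equiv (f := baseEquiv σ) (g := C.twistEquiv σ) ?_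
  ext z
  exact (C.twistEquiv_algebraMap σ z).symm

/-- A `K`-model of a cover over an extension field `E` of `K`: a cover `D` of `ℙ¹_K` together
with an isomorphism of `C` with the base change of `D` to `E`, i.e. a cartesian square
```
C.X  ⟶  D.X
 |       |
ℙ¹_E ⟶ ℙ¹_K
```
-/
def IsModel {E : Type} [Field E] [Algebra K E] (D : BranchedCover K) (C : BranchedCover E) :
    Prop :=
  ∃ p : C.X ⟶ D.X, IsPullback p C.hom D.hom (P1.map (algebraMap K E))

end BranchedCover

/-- A `G`-Galois branched cover of `ℙ¹` over `ℚ̄`: a Galois branched cover together with an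
isomorphism of `Gal(κ(X) / κ(ℙ¹))` with `G`. -/
structure GaloisCover (G : Type*) [Group G] extends BranchedCover Qbar where
  isGaloisCover : toBranchedCover.IsGaloisCover
  galEquiv : (toBranchedCover.FunctionField ≃ₐ[(P1 Qbar).functionField]
    toBranchedCover.FunctionField) ≃* G

namespace GaloisCover

variable {G : Type*} [Group G]

/-- Isomorphism of `G`-Galois branched covers: an isomorphism of mere covers which is compatible
with the given identifications of the Galois groups with `G`. -/
def IsIsomorphic (C C' : GaloisCover G) : Prop :=
  ∃ η : C.X ≅ C'.X, η.hom ≫ C'.hom = C.hom ∧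
    ∀ (g : G) (z : C'.FunctionField),
      BranchedCover.pullbackFunction η (C'.galEquiv.symm g z) =
        C.galEquiv.symm g (BranchedCover.pullbackFunction η z)

/-- Transport of automorphisms of `κ(X)` over `κ(ℙ¹)` to the twist; the underlying map of fields
is unchanged. -/
def twistGal (C : BranchedCover Qbar) (σ : Qbar ≃+* Qbar) :
    (C.FunctionField ≃ₐ[(P1 Qbar).functionField] C.FunctionField) ≃*
      ((C.twist σ).FunctionField ≃ₐ[(P1 Qbar).functionField] (C.twist σ).FunctionField) where
  toFun θ := AlgEquiv.ofRingEquiv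
    (f := ((C.twistEquiv σ).symm.trans θ.toRingEquiv).trans (C.twistEquiv σ)) (by
      intro z
      obtain ⟨w, rfl⟩ := (BranchedCover.baseEquiv σ).surjective z
      rw [← C.twistEquiv_algebraMap]
      simp)
  invFun θ := AlgEquiv.ofRingEquiv
    (f := ((C.twistEquiv σ).trans θ.toRingEquiv).trans (C.twistEquiv σ).symm) (by
      intro z
      rw [RingEquiv.trans_apply, RingEquiv.trans_apply, RingEquiv.symm_apply_eq,
        C.twistEquiv_algebraMap]
      exact θ.commutes _)
  left_inv θ := by ext z; rfl
  right_inv θ := by ext z; rfl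
  map_mul' θ θ' := by ext z; rfl

/-- The twist of a `G`-Galois branched cover by an automorphism `σ` of `ℚ̄`: the twisted cover,
with the same action of `G` on the function field. -/
def twist (C : GaloisCover G) (σ : Qbar ≃ₐ[ℚ] Qbar) : GaloisCover G where
  toBranchedCover := C.toBranchedCover.twist (σ : Qbar ≃+* Qbar)
  isGaloisCover := C.toBranchedCover.twist_isGaloisCover _ C.isGaloisCover
  galEquiv := (twistGal C.toBranchedCover (σ : Qbar ≃+* Qbar)).symm.trans C.galEquiv

/-- The subfield of `ℚ̄` fixed by a set of automorphisms. -/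
def fixedSubfield (S : Set (Qbar ≃ₐ[ℚ] Qbar)) : IntermediateField ℚ Qbar where
  carrier := {x | ∀ σ ∈ S, σ x = x}
  mul_mem' ha hb σ hσ := by rw [map_mul, ha σ hσ, hb σ hσ]
  add_mem' ha hb σ hσ := by rw [map_add, ha σ hσ, hb σ hσ]
  algebraMap_mem' r σ _ := σ.commutes r
  inv_mem' a ha σ hσ := by rw [map_inv₀, ha σ hσ]

/-- The field of moduli of the cover as a mere cover (relative to `ℚ`). -/
def mereFieldOfModuli (C : GaloisCover G) : IntermediateField ℚ Qbar :=
  fixedSubfield {σ | (C.twist σ).toBranchedCover.IsIsomorphic C.toBranchedCover}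

/-- The field of moduli of the cover as a `G`-Galois branched cover (relative to `ℚ`). -/
def fieldOfModuli (C : GaloisCover G) : IntermediateField ℚ Qbar :=
  fixedSubfield {σ | (C.twist σ).IsIsomorphic C}

/-- `K ⊆ ℚ̄` is a field of definition of the cover as a mere cover: it has a `K`-model, i.e. it
descends to `K`. -/
def IsMereFieldOfDefinition (C : GaloisCover G) (K : Type) [Field K] [Algebra K Qbar] : Prop :=
  ∃ D : BranchedCover K, D.IsModel C.toBranchedCover

/-- `K ⊆ ℚ̄` is a field of definition of the cover as a `G`-Galois branched cover: it has a
`K`-model that is Galois. -/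
def IsFieldOfDefinition (C : GaloisCover G) (K : Type) [Field K] [Algebra K Qbar] : Prop :=
  ∃ D : BranchedCover K, D.IsModel C.toBranchedCover ∧ D.IsGaloisCover

end GaloisCover

end

/-! Write `Φ` for the function field of the cover, a Galois extension of `ℚ̄(t)` with group `G`.
Everything rests on lifting automorphisms of `ℚ̄` to `Φ`. An automorphism `σ` acts on `ℚ̄(t)` by
fixing `t`. Since a normal curve that is finite over the line is the normalization of the line in
its function field, the twist by `σ` is isomorphic to the cover exactly when this action extends to
`Φ` (`BranchedCover.isIsomorphic_twist_iff`). It is isomorphic as a `G`-cover exactly when some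
extension commutes with `G` (`GaloisCover.isIsomorphic_twist_iff`).

The extensions can be chosen compatibly (`exists_semilinear_action`). Fix a rational value `a` of
`t` over which `G` acts freely, and a point `π` above it. Lifts of `σ` permute the points above `a`,
because `a` is rational. As `G` acts simply transitively on these points, each liftable `σ` has
exactly one lift compatible with `π`. By uniqueness these lifts form a group action. The liftable
automorphisms form an open subgroup, since `σ` lifts as soon as it fixes the coefficients of the
minimal polynomial of a primitive element. So this subgroup is the whole Galois group of `ℚ̄` over
the mere field of moduli `F`, and `F` is a number field. Each function has an open stabilizer, so
for `F ⊆ L` Galois descent turns the action of `Gal(ℚ̄/L)` on `Φ` into an `L`-model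
(`BranchedCover.exists_isModel`). Conversely, a model over `L` makes the cover isomorphic to all its
twists over `L`.

Conjugation by the lifts gives a homomorphism `c : Gal(ℚ̄/L) → Aut(G)` with open kernel. Over the
fixed field `E` of `ker c` the action commutes with `G`, so the model there is Galois, and
`Gal(E/L)` is the range of `c`. This gives (1). For (3), take `L = F`: the twist by `σ` is
isomorphic to the `G`-cover exactly when `c σ` is inner, so `M` is the fixed field of `c⁻¹(Inn G)`
and `Gal(M/F)` is a quotient of the range of `c`.

For (2), `G ⋊ Gal(ℚ̄/L)` acts on `Φ`. On the subfield fixed by `ker c` it acts through the finite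
group `G ⋊ range c`, with fixed field `L(t)`. Hilbert's irreducibility theorem then specializes `t`
to an integer while keeping the group (`exists_isGalois_of_fixed`).

The irreducibility theorem is itself proved by a `p`-adic interpolation argument
(`exists_int_forall_evalEval_ne_zero`). Suppose one of finitely many curves `f(t, z) = 0` had an
integral point above every integer of a long stretch of a residue class modulo `p`. By pigeonhole
many of these points share the curve, `t` modulo `p ^ s`, and `z` modulo `p`. On such a class `z`
agrees with a polynomial in `t` modulo a high power of `p`, so its divided differences are highly
divisible by `p`. They are also small at all infinite places, hence zero. The points therefore lie
on the graph of a polynomial of bounded degree, and a curve without a polynomial section meets such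
graphs in boundedly many points. -/

/-! ### Divided differences at integer nodes -/

section DividedDifference

open Polynomial Finset

/-- The product of the differences of the node `l` with the other nodes in `s`. -/
def nodeDiff (s : Finset ℤ) (l : ℤ) : ℤ := ∏ j ∈ s.erase l, (l - j)

/-- The divided difference of `z` at the nodes `s`, multiplied by `∏ l ∈ s, nodeDiff s l`. -/
def dividedDifferenceNum {R : Type*} [CommRing R] (s : Finset ℤ) (z : ℤ → R) : R :=
  ∑ i ∈ s, z i * ∏ l ∈ s.erase i, (nodeDiff s l : R)

theorem nodeDiff_ne_zero {s : Finset ℤ} {l : ℤ} : nodeDiff s l ≠ 0 := by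
  refine Finset.prod_ne_zero_iff.mpr fun j hj => ?_
  have := Finset.ne_of_mem_erase hj
  omega

/-- In Lagrange's formula the top coefficient of an interpolant is the sum of `P(i) / nodeDiff s i`.
Multiplying by all the `nodeDiff s l` clears the denominators, which lets divided differences be
studied by divisibility in a ring. -/
theorem coeff_mul_prod_nodeDiff {L : Type*} [Field L] [CharZero L] {s : Finset ℤ} {P : L[X]}
    (hP : P.degree < #s) :
    P.coeff (#s - 1) * ∏ l ∈ s, (nodeDiff s l : L) =
      dividedDifferenceNum s fun i => P.eval (i : L) := by
  rw [Lagrange.coeff_eq_sum (v := fun i : ℤ => (i : L)) (s := s)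
    (fun _ _ _ _ h => Int.cast_injective h) hP, Finset.sum_mul, dividedDifferenceNum]
  refine Finset.sum_congr rfl fun i hi => ?_
  rw [← Finset.mul_prod_erase s _ hi]
  have h : ((nodeDiff s i : ℤ) : L) = ∏ j ∈ s.erase i, ((i : L) - j) := by
    simp [nodeDiff]
  have h0 : ((nodeDiff s i : ℤ) : L) ≠ 0 := Int.cast_ne_zero.mpr nodeDiff_ne_zero
  rw [← h]
  field_simp

theorem map_dividedDifferenceNum {R S : Type*} [CommRing R] [CommRing S] (φ : R →+* S)
    (s : Finset ℤ) (z : ℤ → R) :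
    φ (dividedDifferenceNum s z) = dividedDifferenceNum s fun i => φ (z i) := by
  simp [dividedDifferenceNum]

/-- Reduce `ψ` modulo the monic polynomial that vanishes on the nodes. The remainder still has
coefficients in `R`, takes the same values at the nodes, and its top coefficient is the divided
difference; so the quotient lies in `R`. -/
theorem prod_nodeDiff_dvd {R : Type*} [CommRing R] [IsDomain R] [CharZero R] (s : Finset ℤ)
    (ψ : R[X]) :
    (∏ l ∈ s, (nodeDiff s l : R)) ∣ dividedDifferenceNum s fun i => ψ.eval (i : R) := by
  let L := FractionRing R
  have hinj : Function.Injective (algebraMap R L) := IsFractionRing.injective R L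
  have : CharZero L := charZero_of_injective_algebraMap hinj
  let w : R[X] := Lagrange.nodal s (fun i : ℤ => (i : R))
  have hw : w.Monic := Lagrange.nodal_monic
  let r : R[X] := ψ %ₘ w
  have hr : ∀ i ∈ s, r.eval (i : R) = ψ.eval (i : R) := by
    intro i hi
    have h1 : w.eval (i : R) = 0 := Lagrange.eval_nodal_at_node hi
    have h2 := congrArg (eval (i : R)) (modByMonic_add_div ψ w)
    simpa [h1] using h2
  refine ⟨r.coeff (#s - 1), hinj ?_⟩
  have hdeg : (r.map (algebraMap R L)).degree < #s := by
    rw [degree_map_eq_of_injective hinj]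
    calc r.degree < w.degree := degree_modByMonic_lt _ hw
      _ = #s := Lagrange.degree_nodal
  rw [map_dividedDifferenceNum]
  have := coeff_mul_prod_nodeDiff hdeg
  rw [map_mul, mul_comm, map_prod]
  simp only [map_intCast]
  rw [coeff_map] at this
  rw [this]
  refine Finset.sum_congr rfl fun i hi => ?_
  dsimp only
  rw [← hr i hi]
  rw [eval_intCast_map]

theorem pow_dvd_nodeDiff {q : ℤ} {s : Finset ℤ} (hq : ∀ i ∈ s, ∀ j ∈ s, q ∣ i - j) {l : ℤ}
    (hl : l ∈ s) : q ^ (#s - 1) ∣ nodeDiff s l := by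
  rw [← Finset.card_erase_of_mem hl, nodeDiff, ← Finset.prod_const]
  exact Finset.prod_dvd_prod_of_dvd _ _ fun j hj => hq l hl j (Finset.mem_of_mem_erase hj)

/-- For the values of `ψ` itself, the product of the `#s` numbers `nodeDiff s l` divides the
numerator, and each is a product of `#s - 1` multiples of `q`. Changing the values by multiples of
the same power of `q` changes nothing modulo that power. -/
theorem pow_dvd_dividedDifferenceNum {R : Type*} [CommRing R] [IsDomain R] [CharZero R]
    {q : ℤ} {s : Finset ℤ} (hq : ∀ i ∈ s, ∀ j ∈ s, q ∣ i - j) {z : ℤ → R} {ψ : R[X]}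
    (hψ : ∀ i ∈ s, (q : R) ^ ((#s - 1) * #s) ∣ z i - ψ.eval (i : R)) :
    (q : R) ^ ((#s - 1) * #s) ∣ dividedDifferenceNum s z := by
  have h1 : (q : R) ^ ((#s - 1) * #s) ∣ dividedDifferenceNum s fun i => ψ.eval (i : R) := by
    refine dvd_trans ?_ (prod_nodeDiff_dvd s ψ)
    rw [pow_mul, ← Finset.prod_const]
    refine Finset.prod_dvd_prod_of_dvd _ _ fun l hl => ?_
    have := map_dvd (Int.castRingHom R) (pow_dvd_nodeDiff hq hl)
    simpa using this
  have h2 : dividedDifferenceNum s z - (dividedDifferenceNum s fun i => ψ.eval (i : R)) =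
      ∑ i ∈ s, (z i - ψ.eval (i : R)) * ∏ l ∈ s.erase i, (nodeDiff s l : R) := by
    simp [dividedDifferenceNum, sub_mul]
  have h3 : (q : R) ^ ((#s - 1) * #s) ∣
      dividedDifferenceNum s z - (dividedDifferenceNum s fun i => ψ.eval (i : R)) := by
    rw [h2]
    exact Finset.dvd_sum fun i hi => Dvd.dvd.mul_right (hψ i hi) _
  exact (dvd_sub_left h1).mp h3

/-- If all divided differences of order `k` of `z` vanish, then `z` is interpolated by a polynomial
of degree less than `k`. -/
theorem exists_interpolation {L : Type*} [Field L] [CharZero L] {T : Finset ℤ} {k : ℕ}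
    (z : ℤ → L) (h : ∀ s ⊆ T, #s = k + 1 → dividedDifferenceNum s z = 0) :
    ∃ P : L[X], P.degree < k ∧ ∀ i ∈ T, P.eval (i : L) = z i := by
  have hinj : ∀ s : Finset ℤ, Set.InjOn (fun i : ℤ => (i : L)) s :=
    fun _ _ _ _ _ h => Int.cast_injective h
  rcases le_or_gt #T k with hk | hk
  · exact ⟨Lagrange.interpolate T (fun i : ℤ => (i : L)) z,
      (Lagrange.degree_interpolate_lt _ (hinj _)).trans_le (by exact_mod_cast hk),
      fun i hi => Lagrange.eval_interpolate_at_node _ (hinj _) hi⟩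
  · obtain ⟨s₀, hs₀, hcard⟩ := Finset.exists_subset_card_eq hk.le
    refine ⟨Lagrange.interpolate s₀ (fun i : ℤ => (i : L)) z,
      (Lagrange.degree_interpolate_lt _ (hinj _)).trans_eq (by rw [hcard]), fun i hi => ?_⟩
    by_cases his : i ∈ s₀
    · exact Lagrange.eval_interpolate_at_node _ (hinj _) his
    -- Interpolate at one further node. The coefficient of degree `k` is the divided difference up
    -- to a nonzero factor, so it vanishes and the new interpolant coincides with the one through
    -- `s₀`.
    set s := insert i s₀ with hs
    have hsc : #s = k + 1 := by rw [hs, Finset.card_insert_of_notMem his, hcard]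
    set Q := Lagrange.interpolate s (fun i : ℤ => (i : L)) z with hQ
    have hQe : ∀ j ∈ s, Q.eval (j : L) = z j := fun j hj =>
      Lagrange.eval_interpolate_at_node _ (hinj _) hj
    have hQd : Q.degree < #s := Lagrange.degree_interpolate_lt _ (hinj _)
    have h0 : dividedDifferenceNum s z = 0 :=
      h s (Finset.insert_subset hi hs₀) hsc
    have h1 := coeff_mul_prod_nodeDiff hQd
    have h2 : (dividedDifferenceNum s fun i => Q.eval (i : L)) = dividedDifferenceNum s z :=
      Finset.sum_congr rfl fun j hj => by dsimp only; rw [hQe j hj]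
    rw [h2, h0] at h1
    have h3 : Q.coeff k = 0 := by
      rcases mul_eq_zero.mp h1 with h | h
      · rwa [hsc] at h
      · rw [Finset.prod_eq_zero_iff] at h
        obtain ⟨l, -, hl⟩ := h
        exact absurd (Int.cast_eq_zero.mp hl) nodeDiff_ne_zero
    have h4 : Q.degree < k := by
      rw [degree_lt_iff_coeff_zero]
      intro m hm
      rcases hm.eq_or_lt with rfl | hm
      · exact h3
      · exact coeff_eq_zero_of_degree_lt (hQd.trans_le (by rw [hsc]; exact_mod_cast hm))
    have h5 : Q = Lagrange.interpolate s₀ (fun i : ℤ => (i : L)) z :=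
      Lagrange.eq_interpolate_of_eval_eq _ (hinj _) (by rwa [hcard])
        fun j hj => hQe j (Finset.mem_insert_of_mem hj)
    rw [← h5]
    exact hQe i (Finset.mem_insert_self _ _)

end DividedDifference

/-! ### Taylor expansion along a simple branch -/

section Branch

open Polynomial Bivariate

theorem eval_eval_eq_evalEval {R : Type*} [CommRing R] (f : R[X][Y]) (ψ : R[X]) (a : R) :
    (f.eval ψ).eval a = f.evalEval a (ψ.eval a) := by
  rw [← map_evalRingHom_eval, Polynomial.eval_map, ← coe_evalRingHom, Polynomial.eval, hom_eval₂,
    RingHom.comp_id]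

/-- Near a point where the derivative in the second variable is invertible modulo `π`, the
solutions of `f(a, z) = 0` are given modulo every power of `π` by a polynomial in `a`. -/
theorem exists_branch_polynomial {R : Type*} [CommRing R] {π : R} {f : R[X][Y]} {a₁ z₁ u : R}
    (hu : π ∣ 1 - u * (derivative f).evalEval a₁ z₁) (M : ℕ) :
    ∃ ψ : R[X], ∀ a z : R, π ∣ a - a₁ → π ∣ z - z₁ → f.evalEval a z = 0 →
      π ^ M ∣ z - ψ.eval a := by
  -- Starting from exponent `1` makes the constant `z₁` the base case and keeps `z - ψ(a)` divisible
  -- by `π` throughout.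
  suffices H : ∀ M : ℕ, ∃ ψ : R[X], ∀ a z : R, π ∣ a - a₁ → π ∣ z - z₁ → f.evalEval a z = 0 →
      π ^ (M + 1) ∣ z - ψ.eval a by
    obtain ⟨ψ, hψ⟩ := H M
    exact ⟨ψ, fun a z h1 h2 h3 => (pow_dvd_pow π M.le_succ).trans (hψ a z h1 h2 h3)⟩
  clear M
  intro M
  induction M with
  | zero => exact ⟨C z₁, fun a z _ h _ => by simpa using h⟩
  | succ M ih =>
    obtain ⟨ψ, hψ⟩ := ih
    -- A Newton step with the inverse of the derivative frozen at `u`. The error is multiplied by a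
    -- factor divisible by `π`, so each step gains one power of `π`.
    refine ⟨ψ - C u * f.eval ψ, fun a z h1 h2 h3 => ?_⟩
    have hw := hψ a z h1 h2 h3
    set w := ψ.eval a with hwdef
    let g : R[X] := f.map (evalRingHom a)
    have hg : ∀ y, g.eval y = f.evalEval a y := fun y => by
      simp only [g]; rw [map_evalRingHom_eval]
    have hg' : ∀ y, (derivative g).eval y = (derivative f).evalEval a y := fun y => by
      simp only [g]; rw [derivative_map, map_evalRingHom_eval]
    have e1 : (f.eval ψ).eval a = g.eval w := by
      rw [hg, eval_eval_eq_evalEval]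
    obtain ⟨k, hk⟩ := binomExpansion g z (w - z)
    have hgz : g.eval z = 0 := by rw [hg, h3]
    rw [add_sub_cancel, hgz, zero_add, hg'] at hk
    have h4 : π ∣ 1 - u * (derivative f).evalEval a z := by
      have h5 : π ∣ (derivative f).evalEval a z - (derivative f).evalEval a₁ z₁ := by
        have : (Ideal.Quotient.mk (Ideal.span {π})) ((derivative f).evalEval a z) =
            (Ideal.Quotient.mk (Ideal.span {π})) ((derivative f).evalEval a₁ z₁) := by
          rw [← map_mapRingHom_evalEval, ← map_mapRingHom_evalEval]
          congr 1 <;> rw [Ideal.Quotient.eq, Ideal.mem_span_singleton] <;> assumption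
        rwa [Ideal.Quotient.eq, Ideal.mem_span_singleton] at this
      have := dvd_sub hu (h5.mul_left u)
      convert this using 1
      ring
    have h6 : z - (ψ - C u * f.eval ψ).eval a =
        (z - w) * ((1 - u * (derivative f).evalEval a z) + u * k * (z - w)) := by
      rw [eval_sub, eval_mul, eval_C, e1, hk]
      ring
    rw [h6, pow_succ]
    refine mul_dvd_mul hw (dvd_add h4 (Dvd.dvd.mul_left ?_ _))
    exact (dvd_pow_self π M.succ_ne_zero).trans hw

end Branch

/-! ### Sparsity of integral points on curves over number fields -/

section IntegralPoints

open Polynomial Bivariate NumberField Finset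

theorem infinitePlace_intCast {L : Type*} [Field L] (w : InfinitePlace L) (a : ℤ) : w (a : L) = |(a : ℝ)| := by
  rw [← InfinitePlace.norm_embedding_eq, map_intCast, Complex.norm_intCast]

theorem infinitePlace_sum_le {L : Type*} [Field L] (w : InfinitePlace L) {α : Type*} (s : Finset α) (g : α → L) :
    w (∑ i ∈ s, g i) ≤ ∑ i ∈ s, w (g i) := by
  simp_rw [← InfinitePlace.norm_embedding_eq, map_sum]
  exact norm_sum_le _ _

theorem abs_nodeDiff_le {s : Finset ℤ} {N : ℝ} (hN : ∀ i ∈ s, ∀ j ∈ s, |((i - j : ℤ) : ℝ)| ≤ N)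
    {l : ℤ} (hl : l ∈ s) : |(nodeDiff s l : ℝ)| ≤ N ^ (#s - 1) := by
  rw [nodeDiff, Int.cast_prod, Finset.abs_prod, ← Finset.card_erase_of_mem hl, ← Finset.prod_const]
  exact Finset.prod_le_prod (fun _ _ => abs_nonneg _) fun j hj =>
    hN l hl j (Finset.mem_of_mem_erase hj)

/-- The numerator has `#s` summands, each a value times `#s - 1` node products, and each of these is
a product of `#s - 1` differences of size at most `N`. -/
theorem infinitePlace_dividedDifferenceNum_le {L : Type*} [Field L] (w : InfinitePlace L) {s : Finset ℤ} {N Z : ℝ}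
    (hN : ∀ i ∈ s, ∀ j ∈ s, |((i - j : ℤ) : ℝ)| ≤ N) {z : ℤ → 𝓞 L}
    (hz : ∀ i ∈ s, w (z i : L) ≤ Z) :
    w ((dividedDifferenceNum s z : 𝓞 L) : L) ≤ #s * (Z * (N ^ (#s - 1)) ^ (#s - 1)) := by
  have h : ((dividedDifferenceNum s z : 𝓞 L) : L) =
      ∑ i ∈ s, (z i : L) * ∏ l ∈ s.erase i, (nodeDiff s l : L) := by
    simp [dividedDifferenceNum]
  rw [h, ← nsmul_eq_mul, ← Finset.sum_const]
  refine (infinitePlace_sum_le w _ _).trans (Finset.sum_le_sum fun i hi => ?_)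
  rw [map_mul, map_prod]
  have hZ : 0 ≤ Z := (apply_nonneg w _).trans (hz i hi)
  refine mul_le_mul (hz i hi) ?_ (Finset.prod_nonneg fun _ _ => apply_nonneg _ _) hZ
  rw [← Finset.card_erase_of_mem hi, ← Finset.prod_const]
  refine Finset.prod_le_prod (fun _ _ => apply_nonneg _ _) fun l hl => ?_
  rw [infinitePlace_intCast, Finset.card_erase_of_mem hi]
  exact abs_nodeDiff_le hN (Finset.mem_of_mem_erase hl)

variable {L : Type*} [Field L] [NumberField L]

/-- An algebraic integer divisible by a positive integer `Q` all of whose absolute values are less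
than `Q` vanishes. -/
theorem eq_zero_of_dvd_of_infinitePlace_lt {x : 𝓞 L} {Q : ℕ} (hQ : (Q : 𝓞 L) ∣ x)
    (hx : ∀ w : InfinitePlace L, w (x : L) < Q) : x = 0 := by
  obtain ⟨y, rfl⟩ := hQ
  by_contra hne
  have hy : y ≠ 0 := right_ne_zero_of_mul hne
  obtain ⟨w⟩ : Nonempty (InfinitePlace L) := inferInstance
  have h : ∀ w : InfinitePlace L, w (y : L) < 1 := by
    intro w
    have h1 := hx w
    have h2 : w (((Q : 𝓞 L) * y : 𝓞 L) : L) = Q * w (y : L) := by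
      have := infinitePlace_intCast w (Q : ℤ)
      push_cast at this
      push_cast
      rw [map_mul, this, abs_of_nonneg (Nat.cast_nonneg _)]
    rw [h2] at h1
    have hQ0 : (0 : ℝ) < Q := by
      by_contra h0
      have : (Q : ℝ) = 0 := le_antisymm (not_lt.mp h0) (Nat.cast_nonneg _)
      simp [this] at h1
    nlinarith
  -- The quotient by `Q` would be a nonzero algebraic integer with all absolute values below `1`,
  -- contradicting that its norm is a nonzero integer.
  exact absurd (InfinitePlace.one_le_of_lt_one (w := w) hy fun z _ => h z) (not_le.mpr (h w))

theorem exists_bound_eval (c : (𝓞 L)[X]) : ∃ (B : ℝ) (D : ℕ), 0 ≤ B ∧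
    ∀ (w : InfinitePlace L) (a : ℤ), w ((c.eval (a : 𝓞 L) : 𝓞 L) : L) ≤ B * (1 + |(a : ℝ)|) ^ D := by
  -- Summing over all infinite places gives one constant that serves for every place.
  refine ⟨∑ w : InfinitePlace L, ∑ i ∈ range (c.natDegree + 1), w ((c.coeff i : 𝓞 L) : L),
    c.natDegree, by positivity, fun w a => ?_⟩
  have h1 : w ((c.eval (a : 𝓞 L) : 𝓞 L) : L) ≤
      (∑ i ∈ range (c.natDegree + 1), w ((c.coeff i : 𝓞 L) : L)) *
        (1 + |(a : ℝ)|) ^ c.natDegree := by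
    rw [eval_eq_sum_range, Finset.sum_mul]
    push_cast
    refine (infinitePlace_sum_le w _ _).trans (Finset.sum_le_sum fun i hi => ?_)
    have ha : w ((a : 𝓞 L) : L) = |(a : ℝ)| := by
      rw [← infinitePlace_intCast w a]
      simp
    rw [map_mul, map_pow, ha]
    gcongr
    calc |(a : ℝ)| ^ i ≤ (1 + |(a : ℝ)|) ^ i := by gcongr; linarith
      _ ≤ _ := pow_le_pow_right₀ (by linarith [abs_nonneg (a : ℝ)])
        (Nat.lt_succ_iff.mp (mem_range.mp hi))
  refine h1.trans ?_
  gcongr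
  exact Finset.single_le_sum (f := fun w : InfinitePlace L =>
    ∑ i ∈ range (c.natDegree + 1), w ((c.coeff i : 𝓞 L) : L))
    (fun w _ => by positivity) (Finset.mem_univ w)

/-- The absolute values of the solutions `z` of a monic equation `f(a, z) = 0` grow at most
polynomially in `a`. -/
theorem exists_bound_root (f : (𝓞 L)[X][Y]) (hf : f.Monic) : ∃ (B : ℝ) (D : ℕ), 0 ≤ B ∧
    ∀ (w : InfinitePlace L) (a : ℤ) (z : 𝓞 L), f.evalEval (a : 𝓞 L) z = 0 →
      w (z : L) ≤ B * (1 + |(a : ℝ)|) ^ D := by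
  choose B D hB0 hB using fun j => exists_bound_eval (f.coeff j)
  refine ⟨1 + ∑ j ∈ range f.natDegree, B j, ∑ j ∈ range f.natDegree, D j,
    add_nonneg zero_le_one (Finset.sum_nonneg fun _ _ => hB0 _), fun w a z hz => ?_⟩
  have ha : (1 : ℝ) ≤ 1 + |(a : ℝ)| := by linarith [abs_nonneg (a : ℝ)]
  have hS : ∑ j ∈ range f.natDegree, w (((f.coeff j).eval (a : 𝓞 L) : 𝓞 L) : L) ≤
      (∑ j ∈ range f.natDegree, B j) * (1 + |(a : ℝ)|) ^ ∑ j ∈ range f.natDegree, D j := by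
    rw [Finset.sum_mul]
    refine Finset.sum_le_sum fun j hj => (hB j w a).trans ?_
    gcongr
    · exact hB0 j
    · exact Finset.single_le_sum (f := D) (fun _ _ => Nat.zero_le _) hj
  have h1 : (1 : ℝ) ≤ (1 + |(a : ℝ)|) ^ ∑ j ∈ range f.natDegree, D j := one_le_pow₀ ha
  rcases le_or_gt (w (z : L)) 1 with hz1 | hz1
  · have : 0 ≤ ∑ j ∈ range f.natDegree, B j := Finset.sum_nonneg fun _ _ => hB0 _
    nlinarith
  have hn : f.natDegree ≠ 0 := by
    intro h0
    rw [hf.natDegree_eq_zero.mp h0] at hz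
    simp at hz
  obtain ⟨n, hn⟩ := Nat.exists_eq_succ_of_ne_zero hn
  -- Cauchy's bound: when `w z > 1`, isolate the leading power and divide by the power of exponent
  -- one less; `w z` is then at most the sum of the absolute values of the coefficients.
  have h2 : (z : L) ^ f.natDegree = -∑ j ∈ range f.natDegree,
      (((f.coeff j).eval (a : 𝓞 L) : 𝓞 L) : L) * (z : L) ^ j := by
    have h3 : f.evalEval (a : 𝓞 L) z =
        ∑ j ∈ range (f.natDegree + 1), (f.coeff j).eval (a : 𝓞 L) * z ^ j := by
      rw [evalEval, Polynomial.eval_eq_sum_range (p := f), eval_finsetSum]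
      simp
    rw [h3, Finset.sum_range_succ, hf.coeff_natDegree] at hz
    have h4 := congrArg (algebraMap (𝓞 L) L) hz
    rw [map_add, map_sum] at h4
    simp only [map_mul, map_pow, map_zero, eval_one, one_mul] at h4
    linear_combination h4
  have h5 : w (z : L) ^ f.natDegree ≤
      (∑ j ∈ range f.natDegree, w (((f.coeff j).eval (a : 𝓞 L) : 𝓞 L) : L)) * w (z : L) ^ n := by
    have hneg : ∀ x : L, w (-x) = w x := fun x => by
      rw [← InfinitePlace.norm_embedding_eq, ← InfinitePlace.norm_embedding_eq, map_neg, norm_neg]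
    rw [← map_pow, h2, hneg, Finset.sum_mul]
    refine (infinitePlace_sum_le w _ _).trans (Finset.sum_le_sum fun i hi => ?_)
    rw [map_mul, map_pow]
    gcongr
    · exact hz1.le
    · have := mem_range.mp hi
      omega
  rw [hn, pow_succ, mul_comm] at h5
  have h6 := le_of_mul_le_mul_right h5 (pow_pos (zero_lt_one.trans hz1) n)
  rw [← hn] at h6
  nlinarith [h6.trans hS]

/-- The number of points of a curve `f = 0` lying on a graph `z = P(a)`, `deg P < k`, that is not
contained in the curve, is bounded. -/
theorem exists_card_le_of_interpolation (f : (𝓞 L)[X][Y])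
    (hroot : ∀ P : L[X], (f.map (mapRingHom (algebraMap (𝓞 L) L))).eval P ≠ 0) (k : ℕ) :
    ∃ B : ℕ, ∀ (T : Finset ℤ) (z : ℤ → 𝓞 L) (P : L[X]),
      (∀ a ∈ T, f.evalEval (a : 𝓞 L) (z a) = 0) → P.degree < k →
      (∀ a ∈ T, P.eval (a : L) = z a) → #T ≤ B := by
  set F := f.map (mapRingHom (algebraMap (𝓞 L) L)) with hF
  refine ⟨∑ j ∈ range (F.natDegree + 1), ((F.coeff j).natDegree + j * k),
    fun T z P hz hP hPz => ?_⟩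
  -- The abscissae of the points are roots of the nonzero polynomial `F(t, P(t))`, whose degree is
  -- bounded in terms of `F` and `k` alone.
  have hdeg : (F.eval P).natDegree ≤
      ∑ j ∈ range (F.natDegree + 1), ((F.coeff j).natDegree + j * k) := by
    rw [eval_eq_sum_range]
    refine natDegree_sum_le_of_forall_le _ _ fun j hj => ?_
    refine natDegree_mul_le.trans (le_trans ?_ (Finset.single_le_sum
      (f := fun j => (F.coeff j).natDegree + j * k) (fun _ _ => Nat.zero_le _) hj))
    gcongr
    refine natDegree_pow_le.trans (Nat.mul_le_mul_left _ ?_)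
    exact natDegree_le_of_degree_le hP.le
  refine le_trans ?_ hdeg
  refine le_trans ?_ (card_roots' (F.eval P))
  classical
  rw [← Finset.card_image_of_injective T (f := fun a : ℤ => (a : L)) Int.cast_injective]
  refine le_trans (Finset.card_le_card (t := (F.eval P).roots.toFinset) fun x hx => ?_)
    (Multiset.toFinset_card_le _)
  obtain ⟨a, ha, rfl⟩ := Finset.mem_image.mp hx
  rw [Multiset.mem_toFinset, mem_roots (hroot P), IsRoot.def]
  have h1 : (F.eval P).eval (a : L) = F.evalEval (a : L) (z a : L) := by
    rw [← hPz a ha, eval_eval_eq_evalEval]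
  rw [h1, hF]
  have h2 := map_mapRingHom_evalEval (algebraMap (𝓞 L) L) (p := f) (a : 𝓞 L) (z a)
  rw [map_intCast] at h2
  rw [h2, hz a ha, map_zero]

/-- An algebraic integer divides its norm, so it is invertible modulo any prime larger than the
absolute value of the norm. -/
theorem exists_mul_eq_one_mod_prime {e : 𝓞 L} (he : e ≠ 0) :
    ∃ p : ℕ, p.Prime ∧ ∃ e' : 𝓞 L, (p : 𝓞 L) ∣ 1 - e' * e := by
  have hn : Algebra.norm ℤ e ≠ 0 := Algebra.norm_ne_zero_iff.mpr he
  obtain ⟨p, hp, hprime⟩ := Nat.exists_infinite_primes ((Algebra.norm ℤ e).natAbs + 1)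
  refine ⟨p, hprime, ?_⟩
  have hcop : IsCoprime (Algebra.norm ℤ e) (p : ℤ) := by
    rw [isCoprime_comm, Prime.coprime_iff_not_dvd (Nat.prime_iff_prime_int.mp hprime)]
    intro h
    have := Nat.le_of_dvd (Int.natAbs_pos.mpr hn) (Int.natCast_dvd.mp h)
    omega
  obtain ⟨x, y, hxy⟩ := hcop
  obtain ⟨c, hc⟩ : e ∣ algebraMap ℤ (𝓞 L) (Algebra.norm ℤ e) := by
    have h := Ideal.absNorm_mem (Ideal.span {e})
    rw [Ideal.absNorm_span_singleton, Ideal.mem_span_singleton] at h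
    rw [algebraMap_int_eq, eq_intCast]
    rcases Int.natAbs_eq (Algebra.norm ℤ e) with h' | h' <;> rw [h']
    · simpa using h
    · simpa using h
  refine ⟨x * c, y, ?_⟩
  have h1 := congrArg (algebraMap ℤ (𝓞 L)) hxy
  rw [map_add, map_mul, map_mul, hc] at h1
  simp only [algebraMap_int_eq, eq_intCast, Int.cast_natCast, map_one] at h1
  linear_combination -h1

end IntegralPoints

section IntegralPoints

open Polynomial Bivariate NumberField Finset

variable {L : Type*} [Field L] [NumberField L]

/-- A class of integral points of `f = 0` in a residue class modulo `p ^ s`, contained in an interval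
which is not much longer than `p ^ s`, lies on the graph of a polynomial. -/
theorem exists_interpolation_of_class {f : (𝓞 L)[X][Y]} {u v : (𝓞 L)[X][Y]} {δ : (𝓞 L)[X]}
    (hδ : u * f + v * derivative f = C δ) {p s k : ℕ} {N Z : ℝ}
    (hlt : (k + 1) * (Z * (N ^ k) ^ k) < (p : ℝ) ^ (s * (k * (k + 1)))) (hs : 0 < s)
    {T : Finset ℤ} {z : ℤ → 𝓞 L}
    (hf : ∀ a ∈ T, f.evalEval (a : 𝓞 L) (z a) = 0)
    (hdvd : ∀ a ∈ T, ∀ b ∈ T, (p : ℤ) ^ s ∣ a - b)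
    (hz : ∀ a ∈ T, ∀ b ∈ T, (p : 𝓞 L) ∣ z a - z b)
    (hunit : ∀ a ∈ T, ∃ e : 𝓞 L, (p : 𝓞 L) ∣ 1 - e * δ.eval (a : 𝓞 L))
    (hN : ∀ a ∈ T, ∀ b ∈ T, |((a - b : ℤ) : ℝ)| ≤ N)
    (hZ : ∀ a ∈ T, ∀ w : InfinitePlace L, w (z a : L) ≤ Z) :
    ∃ P : L[X], P.degree < k ∧ ∀ a ∈ T, P.eval (a : L) = z a := by
  refine exists_interpolation (fun a => (z a : L)) fun t ht hcard => ?_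
  obtain ⟨a₁, ha₁⟩ : t.Nonempty := Finset.card_pos.mp (by omega)
  have ha₁T := ht ha₁
  obtain ⟨e, he⟩ := hunit a₁ ha₁T
  -- On the curve the relation `hδ` reduces to `v · f' = δ`. As `δ(a₁)` is invertible modulo `p`, so
  -- is the derivative, and the branch polynomial exists.
  have h1 : v.evalEval (a₁ : 𝓞 L) (z a₁) * (derivative f).evalEval (a₁ : 𝓞 L) (z a₁) =
      δ.eval (a₁ : 𝓞 L) := by
    have := congrArg (evalEval (a₁ : 𝓞 L) (z a₁)) hδ
    simpa [evalEval_add, evalEval_mul, evalEval_C, hf a₁ ha₁T] using this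
  obtain ⟨ψ, hψ⟩ := exists_branch_polynomial (f := f) (a₁ := (a₁ : 𝓞 L)) (z₁ := z a₁)
    (u := e * v.evalEval (a₁ : 𝓞 L) (z a₁)) (π := (p : 𝓞 L)) (by rwa [mul_assoc, h1])
    (s * (k * (k + 1)))
  have hp : ∀ a ∈ T, (p : 𝓞 L) ∣ (a : 𝓞 L) - (a₁ : 𝓞 L) := fun a ha => by
    have := map_dvd (Int.castRingHom (𝓞 L)) ((dvd_pow_self (p : ℤ) hs.ne').trans
      (hdvd a ha a₁ ha₁T))
    simpa using this
  -- The nodes agree modulo `q = p ^ s` and the values agree with those of `ψ` modulo `q ^ (k * (k +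
  -- 1))`. With `k + 1` nodes this is exactly the divisibility that contradicts the size bound `hlt`
  -- unless the divided difference is zero.
  have h2 : (((p ^ s : ℕ) : ℤ) : 𝓞 L) ^ ((#t - 1) * #t) ∣ dividedDifferenceNum t z := by
    refine pow_dvd_dividedDifferenceNum (ψ := ψ) (fun i hi j hj => ?_) fun i hi => ?_
    · exact_mod_cast hdvd i (ht hi) j (ht hj)
    · have := hψ i (z i) (hp i (ht hi)) (hz i (ht hi) a₁ ha₁T) (hf i (ht hi))
      rw [hcard, Nat.add_sub_cancel]
      push_cast
      rwa [← pow_mul]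
  have h3 : dividedDifferenceNum t z = 0 := by
    refine eq_zero_of_dvd_of_infinitePlace_lt (Q := p ^ (s * (k * (k + 1)))) ?_ fun w => ?_
    · rw [hcard, Nat.add_sub_cancel] at h2
      push_cast at h2 ⊢
      rwa [← pow_mul] at h2
    · refine (infinitePlace_dividedDifferenceNum_le w (N := N) (Z := Z)
        (fun i hi j hj => hN i (ht hi) j (ht hj)) fun i hi => hZ i (ht hi) w).trans_lt ?_
      rw [hcard, Nat.add_sub_cancel]
      push_cast
      exact hlt
  have h4 := congrArg (algebraMap (𝓞 L) L) h3
  rwa [map_dividedDifferenceNum, map_zero] at h4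

/-- Hilbert's irreducibility theorem in the form: finitely many polynomials `f i (t, z)`, monic and
separable in `z`, without a root in `L[t]`, have no root in `L` after a suitable integral
specialization of `t`. -/
theorem exists_int_forall_evalEval_ne_zero {ι : Type*} [Finite ι] (f u v : ι → (𝓞 L)[X][Y])
    (hmonic : ∀ i, (f i).Monic) (δ : ι → (𝓞 L)[X]) (hδ0 : ∀ i, δ i ≠ 0)
    (hδ : ∀ i, u i * f i + v i * derivative (f i) = C (δ i))
    (hroot : ∀ i, ∀ P : L[X], ((f i).map (mapRingHom (algebraMap (𝓞 L) L))).eval P ≠ 0)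
    (d : (𝓞 L)[X]) (hd : d ≠ 0) :
    ∃ a : ℤ, d.eval (a : 𝓞 L) ≠ 0 ∧ ∀ i z, (f i).evalEval (a : 𝓞 L) z ≠ 0 := by
  cases nonempty_fintype ι
  by_contra! hcon
  set η : (𝓞 L)[X] := d * ∏ i, δ i with hη
  have hη0 : η ≠ 0 := mul_ne_zero hd (Finset.prod_ne_zero_iff.mpr fun i _ => hδ0 i)
  obtain ⟨a₀, ha₀⟩ : ∃ a₀ : ℤ, η.eval (a₀ : 𝓞 L) ≠ 0 := by
    by_contra! h
    refine hη0 (Polynomial.eq_zero_of_infinite_isRoot η ?_)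
    refine (Set.infinite_range_of_injective (Int.cast_injective (α := 𝓞 L))).mono ?_
    rintro _ ⟨a, rfl⟩
    exact h a
  obtain ⟨p, hp, e', he'⟩ := exists_mul_eq_one_mod_prime ha₀
  -- Restricting to `a ≡ a₀` modulo `p` keeps `d(a)` and all the `δ i (a)` invertible modulo `p`; in
  -- particular `d(a)` cannot vanish.
  have hunit : ∀ a : ℤ, (p : ℤ) ∣ a - a₀ → (p : 𝓞 L) ∣ 1 - e' * η.eval (a : 𝓞 L) := by
    intro a ha
    have h1 : (p : 𝓞 L) ∣ (a : 𝓞 L) - a₀ := by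
      have := map_dvd (Int.castRingHom (𝓞 L)) ha
      simpa using this
    have h2 := dvd_sub he' ((h1.trans (sub_dvd_eval_sub (a : 𝓞 L) a₀ η)).mul_left e')
    convert h2 using 1
    ring
  have hp1 : ¬ (p : 𝓞 L) ∣ 1 := fun h => by
    refine one_ne_zero (eq_zero_of_dvd_of_infinitePlace_lt h fun w => ?_)
    have : w ((1 : 𝓞 L) : L) = 1 := map_one w
    rw [this]
    exact_mod_cast hp.one_lt
  have hbad : ∀ b : ℤ, ∃ i z, (f i).evalEval ((a₀ + p * b : ℤ) : 𝓞 L) z = 0 := fun b => by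
    refine hcon _ fun h0 => hp1 ?_
    have := hunit (a₀ + p * b) ⟨b, by ring⟩
    rw [hη, eval_mul, h0, zero_mul, mul_zero, sub_zero] at this
    exact this
  choose i z hiz using hbad
  choose B D hB0 hB using fun j => exists_bound_root (f j) (hmonic j)
  set D' := ∑ j, D j with hD'
  set B' := 1 + ∑ j, B j with hB'
  have hB'1 : 1 ≤ B' := by
    have : 0 ≤ ∑ j, B j := Finset.sum_nonneg fun j _ => hB0 j
    linarith
  -- With this choice `k * (k + 1)` exceeds `D' + k * k` by one. So the `p`-power dividing a divided
  -- difference outgrows its absolute value as `s` grows with `m - s` fixed.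
  set k := D' + 1 with hk
  choose c hc using fun j => exists_card_le_of_interpolation (f j) (hroot j) k
  have hp0 : (p : 𝓞 L) ≠ 0 := fun h => hp.ne_zero (Nat.cast_eq_zero.mp h)
  have hfin : Finite (𝓞 L ⧸ Ideal.span {(p : 𝓞 L)}) := by
    have : Ideal.span {(p : 𝓞 L)} ≠ ⊥ := by simpa using hp0
    exact Ring.HasFiniteQuotients.finiteQuotient this
  have := Fintype.ofFinite (𝓞 L ⧸ Ideal.span {(p : 𝓞 L)})
  set κ := Fintype.card (𝓞 L ⧸ Ideal.span {(p : 𝓞 L)}) with hκ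
  -- The interval will be about `p ^ r` times as long as the modulus `p ^ s`. This `r` makes the
  -- pigeonhole classes larger than the bound on points of a curve on a graph.
  obtain ⟨r, hr⟩ : ∃ r : ℕ, Fintype.card ι * κ * (∑ j, c j) < p ^ r :=
    ⟨_, Nat.lt_pow_self hp.one_lt⟩
  set A : ℝ := 2 + |(a₀ : ℝ)| with hA
  have hA1 : 1 ≤ A := by linarith [abs_nonneg (a₀ : ℝ)]
  obtain ⟨l, hl⟩ : ∃ l : ℕ, (k + 1) * (B' * A ^ D') < (p : ℝ) ^ l :=
    pow_unbounded_of_one_lt _ (by exact_mod_cast hp.one_lt)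
  -- Large enough to absorb both the loss from the longer interval and the constants, which are
  -- below `p ^ l`; the inequality `hexp` holds with `r + 1` to spare.
  set s := r * (k * (k + 1)) + l + 1 with hs
  set m := s + r with hm
  have hpr : (1 : ℝ) ≤ p := by exact_mod_cast hp.one_lt.le
  have hlt : (k + 1) * (B' * (A * (p : ℝ) ^ m) ^ D' * (((p : ℝ) ^ m) ^ k) ^ k) <
      (p : ℝ) ^ (s * (k * (k + 1))) := by
    have hexp : l + m * D' + m * k * k ≤ s * (k * (k + 1)) := by
      rw [hm, hs, hk]
      ring_nf
      omega
    calc (k + 1) * (B' * (A * (p : ℝ) ^ m) ^ D' * (((p : ℝ) ^ m) ^ k) ^ k)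
        = ((k + 1) * (B' * A ^ D')) * (p : ℝ) ^ (m * D' + m * k * k) := by
          rw [mul_pow, pow_add _ (m * D'), ← pow_mul, ← pow_mul, ← pow_mul]
          ring
      _ < (p : ℝ) ^ l * (p : ℝ) ^ (m * D' + m * k * k) := by gcongr
      _ = (p : ℝ) ^ (l + m * D' + m * k * k) := by rw [← pow_add, add_assoc]
      _ ≤ _ := pow_le_pow_right₀ hpr hexp
  classical
  -- The class of `a₀ + p b` records which polynomial has a root, `b` modulo `p ^ (s - 1)` (that is,
  -- `a` modulo `p ^ s`), and the root modulo `p`. Some class contains more than `∑ j, c j` points.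
  let cls : ℕ → ι × ℕ × (𝓞 L ⧸ Ideal.span {(p : 𝓞 L)}) :=
    fun b => (i b, b % p ^ (s - 1), Ideal.Quotient.mk _ (z b))
  obtain ⟨⟨j, b₀, ζ⟩, -, hcard⟩ := Finset.exists_lt_card_fiber_of_mul_lt_card_of_maps_to
    (s := range (p ^ (m - 1))) (t := univ ×ˢ range (p ^ (s - 1)) ×ˢ univ) (n := ∑ j, c j)
    (f := cls)
    (fun b _ => by
      simp only [cls, Finset.mem_product, Finset.mem_univ, Finset.mem_range, true_and, and_true]
      exact Nat.mod_lt _ (pow_pos hp.pos _))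
    (by
      rw [Finset.card_product, Finset.card_product, Finset.card_range, Finset.card_range,
        Finset.card_univ, Finset.card_univ, show m - 1 = s - 1 + r by omega, pow_add]
      calc _ = p ^ (s - 1) * (Fintype.card ι * κ * (∑ j, c j)) := by ring
        _ < _ := Nat.mul_lt_mul_of_pos_left hr (pow_pos hp.pos _))
  set S := (range (p ^ (m - 1))).filter fun b => cls b = (j, b₀, ζ) with hS
  have hmem : ∀ b ∈ S, b < p ^ (m - 1) ∧ i b = j ∧ b % p ^ (s - 1) = b₀ ∧
      Ideal.Quotient.mk _ (z b) = ζ := fun b hb => by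
    rw [hS, Finset.mem_filter, Finset.mem_range] at hb
    simpa [cls] using hb
  let φ : ℕ → ℤ := fun b => a₀ + p * b
  have hp0' := hp.ne_zero
  have hp0'' : (p : ℤ) ≠ 0 := by exact_mod_cast hp.ne_zero
  have hφ : Function.Injective φ := fun b b' h => by simpa [φ, hp0'] using h
  let z' : ℤ → 𝓞 L := fun a => z ((a - a₀) / p)
  have hz' : ∀ b, z' (φ b) = z b := fun b => by
    simp only [z', φ, add_sub_cancel_left, Int.mul_ediv_cancel_left _ hp0'']
  have hmpow : (p : ℝ) ^ m = p * (p : ℝ) ^ (m - 1) := by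
    rw [← pow_succ', Nat.sub_add_cancel (by omega)]
  have hbR : ∀ b ∈ S, (p : ℝ) * b ≤ (p : ℝ) ^ m := fun b hb => by
    rw [hmpow]
    gcongr
    exact_mod_cast (hmem b hb).1.le
  obtain ⟨P, hP, hPz⟩ := exists_interpolation_of_class (hδ j) (p := p) (s := s) (k := k)
    (N := (p : ℝ) ^ m) (Z := B' * (A * (p : ℝ) ^ m) ^ D') hlt (by omega) (T := S.image φ) (z := z')
    (by
      simp only [Finset.forall_mem_image]
      intro b hb
      rw [hz', ← (hmem b hb).2.1]
      exact hiz b)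
    (by
      simp only [Finset.forall_mem_image]
      intro b hb b' hb'
      have h1 : b ≡ b' [MOD p ^ (s - 1)] := (hmem b hb).2.2.1.trans (hmem b' hb').2.2.1.symm
      have h2 := (Nat.modEq_iff_dvd.mp h1.symm)
      rw [← Nat.sub_add_cancel (show 1 ≤ s by omega), pow_succ']
      have h3 : φ b - φ b' = p * ((b : ℤ) - b') := by simp only [φ]; ring
      rw [h3]
      exact mul_dvd_mul_left _ (by exact_mod_cast h2))
    (by
      simp only [Finset.forall_mem_image]
      intro b hb b' hb'
      rw [hz', hz', ← Ideal.mem_span_singleton, ← Ideal.Quotient.eq]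
      exact (hmem b hb).2.2.2.trans (hmem b' hb').2.2.2.symm)
    (by
      simp only [Finset.forall_mem_image]
      intro b hb
      obtain ⟨g, hg⟩ : δ j ∣ η := (Finset.dvd_prod_of_mem δ (Finset.mem_univ j)).mul_left d
      refine ⟨e' * g.eval (φ b : 𝓞 L), ?_⟩
      have := hunit (φ b) ⟨b, by simp [φ]⟩
      rw [hg, eval_mul] at this
      convert this using 2
      ring)
    (by
      simp only [Finset.forall_mem_image]
      intro b hb b' hb'
      have h3 : ((φ b - φ b' : ℤ) : ℝ) = p * b - p * b' := by simp only [φ]; push_cast; ring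
      rw [h3, abs_le]
      have h4 : (0 : ℝ) ≤ p * b := by positivity
      have h5 : (0 : ℝ) ≤ p * b' := by positivity
      constructor <;> linarith [hbR b hb, hbR b' hb'])
    (by
      simp only [Finset.forall_mem_image]
      intro b hb w
      have h1 := hiz b
      rw [hz']
      refine (hB (i b) w _ _ h1).trans ?_
      have h2 : 1 + |((a₀ + p * b : ℤ) : ℝ)| ≤ A * (p : ℝ) ^ m := by
        have h6 : |((a₀ + p * b : ℤ) : ℝ)| ≤ |(a₀ : ℝ)| + p * b := by
          push_cast
          refine (abs_add_le _ _).trans ?_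
          rw [abs_of_nonneg (by positivity : (0 : ℝ) ≤ p * b)]
        have h7 : (1 : ℝ) ≤ (p : ℝ) ^ m := one_le_pow₀ hpr
        have h8 := hbR b hb
        have h9 := mul_le_mul_of_nonneg_left h7 (abs_nonneg (a₀ : ℝ))
        rw [hA]
        nlinarith
      have h10 : (1 : ℝ) ≤ 1 + |((a₀ + p * b : ℤ) : ℝ)| := by
        linarith [abs_nonneg ((a₀ + p * b : ℤ) : ℝ)]
      have h11 : D (i b) ≤ D' := Finset.single_le_sum (f := D) (fun _ _ => Nat.zero_le _)
        (Finset.mem_univ _)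
      have h12 : B (i b) ≤ B' := by
        have := Finset.single_le_sum (f := B) (fun j _ => hB0 j) (Finset.mem_univ (i b))
        linarith
      calc B (i b) * (1 + |((a₀ + p * b : ℤ) : ℝ)|) ^ D (i b)
          ≤ B' * (1 + |((a₀ + p * b : ℤ) : ℝ)|) ^ D' := by
            gcongr
        _ ≤ _ := by gcongr)
  -- All points of the class lie on one graph of degree below `k`, so there are at most `c j` of
  -- them, against the pigeonhole count.
  have hfin := hc j (S.image φ) z' P (by
      simp only [Finset.forall_mem_image]
      intro b hb
      rw [hz', ← (hmem b hb).2.1]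
      exact hiz b) hP hPz
  rw [Finset.card_image_of_injective _ hφ] at hfin
  have : c j ≤ ∑ j, c j := Finset.single_le_sum (fun _ _ => Nat.zero_le _) (Finset.mem_univ j)
  omega

end IntegralPoints

/-! ### Hilbert irreducibility for Galois extensions of `L(t)` -/

section Specialization

open Polynomial Bivariate NumberField nonZeroDivisors

attribute [local instance] Polynomial.algebra

/-- The minimal polynomial over an integrally closed domain of characteristic zero is separable:
it generates, together with its derivative, a nonzero constant. -/
theorem exists_mul_minpoly_add_mul_derivative {R B : Type*} [CommRing R] [IsDomain R]
    [IsIntegrallyClosed R] [CharZero R] [CommRing B] [IsDomain B] [Algebra R B] {w : B}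
    (hw : _root_.IsIntegral R w) :
    ∃ (u v : R[X]) (δ : R), δ ≠ 0 ∧
      u * minpoly R w + v * derivative (minpoly R w) = C δ := by
  set f := minpoly R w with hf
  let K := FractionRing R
  have hinj : Function.Injective (algebraMap R K) := IsFractionRing.injective R K
  have : CharZero K := charZero_of_injective_algebraMap hinj
  have hirr : Irreducible (f.map (algebraMap R K)) :=
    ((minpoly.monic hw).irreducible_iff_irreducible_map_fraction_map (K := K)).mp
      (minpoly.irreducible hw)
  have hsep : IsCoprime (f.map (algebraMap R K)) (derivative f |>.map (algebraMap R K)) := by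
    rw [← derivative_map]
    exact hirr.separable
  -- The minimal polynomial stays irreducible over the fraction field, hence separable in
  -- characteristic zero; its resultant with the derivative is the required constant.
  have hδ : resultant f (derivative f) ≠ 0 := by
    intro h0
    have h1 : resultant (f.map (algebraMap R K)) ((derivative f).map (algebraMap R K)) = 0 := by
      have := resultant_map_map (f := f) (g := derivative f) (m := f.natDegree)
        (n := (derivative f).natDegree) (algebraMap R K)
      rw [h0, map_zero] at this
      rwa [natDegree_map_eq_of_injective hinj, natDegree_map_eq_of_injective hinj]
    exact (resultant_eq_zero_iff.mp h1).2 hsep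
  obtain ⟨p, q, -, -, h⟩ := exists_mul_add_mul_eq_C_resultant f (derivative f) le_rfl le_rfl
    (Or.inl (minpoly.natDegree_pos hw).ne')
  exact ⟨p, q, _, hδ, by rw [mul_comm p, mul_comm q, h]⟩

variable {L : Type*} [Field L] [NumberField L]

/-- The minimal polynomial over `𝓞 L[t]` of an integral element outside `L[t]` has no root in
`L[t]`. -/
theorem eval_map_minpoly_ne_zero {B : Type*} [CommRing B] [IsDomain B] [Algebra L[X] B]
    [Algebra (𝓞 L)[X] B] [IsScalarTower (𝓞 L)[X] L[X] B] {w : B}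
    (hw : _root_.IsIntegral (𝓞 L)[X] w) (hw' : w ∉ Set.range (algebraMap L[X] B)) (P : L[X]) :
    ((minpoly (𝓞 L)[X] w).map (mapRingHom (algebraMap (𝓞 L) L))).eval P ≠ 0 := by
  intro hP
  have hPint : _root_.IsIntegral (𝓞 L)[X] P :=
    ⟨minpoly (𝓞 L)[X] w, minpoly.monic hw, by rwa [← Polynomial.eval_map]⟩
  -- A root in `L[t]` is integral over `𝓞 L[t]`, so its coefficients are integral. It then splits
  -- off a linear factor of the irreducible minimal polynomial, which forces `w` into `L[t]`.
  obtain ⟨P₀, rfl⟩ : ∃ P₀ : (𝓞 L)[X], P₀.map (algebraMap (𝓞 L) L) = P := by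
    rw [← mem_lifts, lifts_iff_coeff_lifts]
    intro n
    exact IsIntegrallyClosed.isIntegral_iff.mp (hPint.coeff n)
  have h1 : (minpoly (𝓞 L)[X] w).eval P₀ = 0 := by
    rw [map_mapRingHom_eval_map] at hP
    exact map_injective _ (FaithfulSMul.algebraMap_injective (𝓞 L) L) (by rw [hP, Polynomial.map_zero])
  have h2 : X - C P₀ ∣ minpoly (𝓞 L)[X] w := dvd_iff_isRoot.mpr h1
  have h3 := (irreducible_X_sub_C P₀).associated_of_dvd (minpoly.irreducible hw) h2
  have h4 := eq_of_monic_of_associated (monic_X_sub_C P₀) (minpoly.monic hw) h3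
  have h5 := minpoly.aeval (𝓞 L)[X] w
  rw [← h4, map_sub, aeval_X, aeval_C, sub_eq_zero] at h5
  exact hw' ⟨P₀.map (algebraMap (𝓞 L) L), by
    rw [h5, IsScalarTower.algebraMap_apply (𝓞 L)[X] L[X] B]; rfl⟩

/-- The form of Hilbert irreducibility used for Galois groups: at every point of `B` above a
well-chosen integer `a`, finitely many non-polynomial functions keep non-rational values. After
multiplying `b i` by a constant it is integral over `𝓞 L[t]`, and a value in `L` would give an
integral root of its minimal polynomial specialized at `a`. The condition on `β` costs only finitely
many `a`, since `β` divides a nonzero polynomial in `t`. -/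
theorem exists_int_specialization {B : Type*} [CommRing B] [IsDomain B] [Algebra L[X] B]
    [Algebra.IsIntegral L[X] B] [FaithfulSMul L[X] B] {ι : Type*} [Finite ι] (b : ι → B)
    (hb : ∀ i, b i ∉ Set.range (algebraMap L[X] B)) (β : B) (hβ : β ≠ 0) :
    ∃ a : ℤ, ∀ (κ : Type _) [Field κ] (φ : B →+* κ) (ψ : L →+* κ),
      (∀ q : L[X], φ (algebraMap L[X] B q) = ψ (q.eval (a : L))) →
      φ β ≠ 0 ∧ ∀ i c, φ (b i) ≠ ψ c := by
  let : Algebra (𝓞 L)[X] B :=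
    ((algebraMap L[X] B).comp (algebraMap (𝓞 L)[X] L[X])).toAlgebra
  have : IsScalarTower (𝓞 L)[X] L[X] B := .of_algebraMap_eq' rfl
  let M : Submonoid (𝓞 L)[X] := (𝓞 L)⁰.map (C : 𝓞 L →+* (𝓞 L)[X])
  have hloc : IsLocalization M L[X] := Polynomial.isLocalization (𝓞 L)⁰ L
  have hM : ∀ m : M, ∃ c : 𝓞 L, c ≠ 0 ∧ (m : (𝓞 L)[X]) = C c := by
    rintro ⟨_, c, hc, rfl⟩
    exact ⟨c, nonZeroDivisors.ne_zero hc, rfl⟩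
  have hw := fun i => IsIntegral.exists_multiple_integral_of_isLocalization (R := (𝓞 L)[X])
    (Rₘ := L[X]) M (b i) (Algebra.IsIntegral.isIntegral (R := L[X]) (b i))
  choose m hm using hw
  choose c hc0 hc using fun i => hM (m i)
  have hsm : ∀ i, (m i) • b i = algebraMap L[X] B (C (c i : L)) * b i := fun i => by
    rw [Submonoid.smul_def, hc, Algebra.smul_def, IsScalarTower.algebraMap_apply (𝓞 L)[X] L[X] B,
      algebraMap_def, coe_mapRingHom, map_C]
  have hcL : ∀ i, (c i : L) ≠ 0 := fun i => by simpa using hc0 i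
  set w : ι → B := fun i => (m i) • b i with hwdef
  have hwn : ∀ i, w i ∉ Set.range (algebraMap L[X] B) := by
    rintro i ⟨q, hq⟩
    refine hb i ⟨C (c i : L)⁻¹ * q, ?_⟩
    rw [map_mul, hq, hwdef]
    dsimp only
    rw [hsm, ← mul_assoc, ← map_mul, ← C_mul, inv_mul_cancel₀ (hcL i), C_1, map_one, one_mul]
  choose u v δ hδ0 hδ using fun i => exists_mul_minpoly_add_mul_derivative (hm i)
  obtain ⟨d, hd0, hdvd⟩ := (Algebra.IsIntegral.isIntegral (R := L[X]) β).isAlgebraic.exists_nonzero_dvd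
    (mem_nonZeroDivisors_of_ne_zero hβ)
  obtain ⟨⟨d₀, e⟩, hde⟩ := IsLocalization.surj M d
  obtain ⟨c', hc'0, hc'⟩ := hM e
  have hde' : d₀.map (algebraMap (𝓞 L) L) = d * C (c' : L) := by
    have : algebraMap (𝓞 L)[X] L[X] e = C (c' : L) := by
      rw [hc', algebraMap_def, coe_mapRingHom, map_C]
    rw [← this, hde]
    rfl
  have hd₀ : d₀ ≠ 0 := by
    rintro rfl
    rw [Polynomial.map_zero, eq_comm, mul_eq_zero] at hde'
    exact hde'.elim hd0 (by simpa using hc'0)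
  obtain ⟨a, had, ha⟩ := exists_int_forall_evalEval_ne_zero
    (fun i => minpoly (𝓞 L)[X] (w i)) u v (fun i => minpoly.monic (hm i)) δ hδ0 hδ
    (fun i => eval_map_minpoly_ne_zero (hm i) (hwn i)) d₀ hd₀
  refine ⟨a, fun κ _ φ ψ hφ => ⟨fun h0 => ?_, fun i z hz => ?_⟩⟩
  · obtain ⟨g, hg⟩ := hdvd
    have h1 : ψ (d.eval (a : L)) = 0 := by rw [← hφ, hg, map_mul, h0, zero_mul]
    have h2 : d.eval (a : L) = 0 := by rwa [map_eq_zero] at h1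
    have h3 := congrArg (Polynomial.eval (a : L)) hde'
    rw [eval_mul, h2, zero_mul, eval_intCast_map] at h3
    refine had ?_
    simpa using h3
  · have h0 : φ (w i) = ψ ((c i : L) * z) := by
      rw [hwdef]
      dsimp only
      rw [hsm, map_mul, hφ, hz, eval_C, map_mul]
    have hcomp : φ.comp (algebraMap (𝓞 L)[X] B) =
        ψ.comp ((algebraMap (𝓞 L) L).comp (evalRingHom (a : 𝓞 L))) := by
      ext q
      · simp only [RingHom.comp_apply]
        rw [IsScalarTower.algebraMap_apply (𝓞 L)[X] L[X] B, hφ]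
        simp
      · simp only [RingHom.comp_apply]
        rw [IsScalarTower.algebraMap_apply (𝓞 L)[X] L[X] B, hφ]
        simp
    have h1 : eval₂ ((algebraMap (𝓞 L) L).comp (evalRingHom (a : 𝓞 L))) ((c i : L) * z)
        (minpoly (𝓞 L)[X] (w i)) = 0 := by
      have h2 := congrArg φ (minpoly.aeval (𝓞 L)[X] (w i))
      rw [map_zero, aeval_def, hom_eval₂, hcomp, h0, ← hom_eval₂, map_eq_zero] at h2
      exact h2
    have h3 : _root_.IsIntegral (𝓞 L) ((c i : L) * z) := by
      refine ⟨(minpoly (𝓞 L)[X] (w i)).map (evalRingHom (a : 𝓞 L)), (minpoly.monic (hm i)).map _, ?_⟩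
      rwa [eval₂_map]
    obtain ⟨z₀, hz₀⟩ := IsIntegrallyClosed.isIntegral_iff.mp h3
    refine ha i z₀ ?_
    rw [← hz₀, ← hom_eval₂] at h1
    have h4 := (map_eq_zero_iff _ (FaithfulSMul.algebraMap_injective (𝓞 L) L)).mp h1
    rwa [eval₂_evalRingHom] at h4

end Specialization

/-! ### Galois groups under specialization of `t`. -/

section Specialization

open Polynomial Pointwise

/-- An element fixed by a proper subgroup of a finite group of automorphisms of a field which is not
fixed by the whole group. -/
theorem exists_fixed_of_ne_top {𝒢 Φ : Type*} [Group 𝒢] [Finite 𝒢] [Field Φ]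
    [MulSemiringAction 𝒢 Φ] [FaithfulSMul 𝒢 Φ] {U : Subgroup 𝒢} (hU : U ≠ ⊤) :
    ∃ x : Φ, (∀ g ∈ U, g • x = x) ∧ ∃ g : 𝒢, g • x ≠ x := by
  by_contra! h
  cases nonempty_fintype 𝒢
  have : Fintype U := Fintype.ofFinite U
  -- If there were no such element the two fixed fields would coincide, and by Artin's theorem the
  -- groups would have the same order.
  have hle : FixedPoints.subfield U Φ = FixedPoints.subfield 𝒢 Φ := by
    ext x
    exact ⟨fun hx g => h x (fun g hg => hx ⟨g, hg⟩) g, fun hx g => hx g⟩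
  have h1 := FixedPoints.finrank_eq_card U Φ
  have h2 := FixedPoints.finrank_eq_card 𝒢 Φ
  rw [hle, h2] at h1
  refine hU (Subgroup.eq_top_of_card_eq U ?_)
  rw [Nat.card_eq_fintype_card, Nat.card_eq_fintype_card, h1]

/-- Restriction of scalars along a surjective map of base fields does not change the group of
automorphisms. -/
def algEquivRestrictScalars {k l κ : Type*} [Field k] [Field l] [Field κ] [Algebra k l]
    [Algebra l κ] [Algebra k κ] [IsScalarTower k l κ]
    (h : Function.Surjective (algebraMap k l)) : (κ ≃ₐ[l] κ) ≃* (κ ≃ₐ[k] κ) where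
  toFun e := e.restrictScalars k
  invFun e := AlgEquiv.ofRingEquiv (f := (e : κ ≃+* κ)) fun x => by
    obtain ⟨y, rfl⟩ := h x
    rw [← IsScalarTower.algebraMap_apply]
    exact e.commutes y
  left_inv e := by ext; rfl
  right_inv e := by ext; rfl
  map_mul' e e' := by ext; rfl

variable {L : Type*} [Field L] [NumberField L]

attribute [local instance] Ideal.Quotient.field in
/-- A finite group of automorphisms of a domain `B` with ring of invariants `L[t]` is the Galois
group of an extension of `L`. -/
theorem exists_isGalois_of_isInvariant {B : Type*} [CommRing B] [IsDomain B] [Algebra L[X] B]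
    [FaithfulSMul L[X] B] {𝒢 : Type*} [Group 𝒢] [Finite 𝒢] [MulSemiringAction 𝒢 B]
    [FaithfulSMul 𝒢 B] [SMulCommClass 𝒢 L[X] B] [Algebra.IsInvariant L[X] B 𝒢]
    (hfix : ∀ U : Subgroup 𝒢, U ≠ ⊤ → ∃ b : B, (∀ g ∈ U, g • b = b) ∧ ∃ g : 𝒢, g • b ≠ b)
    (Ω : Type*) [Field Ω] [Algebra L Ω] [IsAlgClosed Ω] :
    ∃ N : IntermediateField L Ω, FiniteDimensional L N ∧ IsGalois L N ∧
      Nonempty ((N ≃ₐ[L] N) ≃* 𝒢) := by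
  classical
  have : Algebra.IsIntegral L[X] B := Algebra.IsInvariant.isIntegral L[X] B 𝒢
  cases nonempty_fintype 𝒢
  have hmove : ∀ g : 𝒢, g ≠ 1 → ∃ b : B, g • b ≠ b := fun g hg => by
    by_contra! h
    exact hg (FaithfulSMul.eq_of_smul_eq_smul (α := B) fun b => by rw [h b, one_smul])
  choose! y hy using hmove
  choose b hbU γ hγ using fun U : {U : Subgroup 𝒢 // U ≠ ⊤} => hfix U.1 U.2
  -- Two demands on `a`: for each proper subgroup a chosen invariant that is not a polynomial in `t`
  -- takes no value in `L`, which will exclude a proper decomposition group; and no `g • y g - y g`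
  -- with `g ≠ 1` vanishes above `a`, which will exclude inertia.
  obtain ⟨a, ha⟩ := exists_int_specialization (L := L) b (fun U => by
      rintro ⟨q, hq⟩
      refine hγ U ?_
      rw [← hq]
      exact smul_algebraMap (γ U) q)
    (∏ g ∈ Finset.univ.erase (1 : 𝒢), (g • y g - y g))
    (Finset.prod_ne_zero_iff.mpr fun g hg => sub_ne_zero.mpr (hy g (Finset.ne_of_mem_erase hg)))
  let p : Ideal L[X] := RingHom.ker (evalRingHom (a : L))
  have hsurj : Function.Surjective (evalRingHom (a : L)) := fun c => ⟨C c, by simp⟩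
  have hp : p.IsMaximal := RingHom.ker_isMaximal_of_surjective _ hsurj
  obtain ⟨P, hP, hPp⟩ := Ideal.exists_maximal_ideal_liesOver_of_isIntegral (S := B) p
  let ψ : L →+* B ⧸ P := (Ideal.Quotient.mk P).comp ((algebraMap L[X] B).comp C)
  have hmk : ∀ q : L[X], Ideal.Quotient.mk P (algebraMap L[X] B q) = ψ (q.eval (a : L)) := by
    intro q
    have h1 : q - C (q.eval (a : L)) ∈ p := by
      rw [RingHom.mem_ker]; simp
    have h2 : algebraMap L[X] B (q - C (q.eval (a : L))) ∈ P := by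
      rw [hPp.over, Ideal.mem_comap] at h1
      exact h1
    rw [← sub_eq_zero]
    rw [← Ideal.Quotient.eq_zero_iff_mem, map_sub, map_sub] at h2
    exact h2
  obtain ⟨hβ, hval⟩ := ha (B ⧸ P) (Ideal.Quotient.mk P) ψ hmk
  have hnormal : Normal (L[X] ⧸ p) (B ⧸ P) := Ideal.Quotient.normal 𝒢 p P
  let : Algebra L (B ⧸ P) := ψ.toAlgebra
  have htower : IsScalarTower L (L[X] ⧸ p) (B ⧸ P) := by
    refine ⟨fun c x z => ?_⟩
    obtain ⟨q, rfl⟩ := Ideal.Quotient.mk_surjective x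
    obtain ⟨w, rfl⟩ := Ideal.Quotient.mk_surjective z
    change Ideal.Quotient.mk P ((c • q) • w) =
      Ideal.Quotient.mk P (algebraMap L[X] B (C c)) * Ideal.Quotient.mk P (q • w)
    rw [← map_mul, ← Algebra.smul_def, smul_smul, ← C_mul']
  have hLsurj : Function.Surjective (algebraMap L (L[X] ⧸ p)) := by
    intro x
    obtain ⟨q, rfl⟩ := Ideal.Quotient.mk_surjective x
    refine ⟨q.eval (a : L), ?_⟩
    change Ideal.Quotient.mk p (C _) = _
    rw [Ideal.Quotient.eq, RingHom.mem_ker]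
    simp
  have : CharZero (L[X] ⧸ p) := charZero_of_injective_algebraMap (algebraMap L _).injective
  have hgal : IsGalois (L[X] ⧸ p) (B ⧸ P) := ⟨⟩
  have hfinite : FiniteDimensional (L[X] ⧸ p) (B ⧸ P) :=
    Ideal.Quotient.finite_of_isInvariant 𝒢 p P
  have hfl : FiniteDimensional L (L[X] ⧸ p) :=
    Module.Finite.of_surjective (Algebra.linearMap L (L[X] ⧸ p)) hLsurj
  have hfL : FiniteDimensional L (B ⧸ P) := FiniteDimensional.trans L (L[X] ⧸ p) (B ⧸ P)
  have hsh := Ideal.Quotient.stabilizerHom_surjective 𝒢 p P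
  -- The decomposition group maps onto the Galois group of the residue extension. If it were proper,
  -- its chosen invariant would reduce to a Galois-invariant element, that is, to an element of `L`.
  have htop : MulAction.stabilizer 𝒢 P = ⊤ := by
    by_contra hne
    have h1 : ∀ f : (B ⧸ P) ≃ₐ[L[X] ⧸ p] (B ⧸ P), f (Ideal.Quotient.mk P (b ⟨_, hne⟩)) =
        Ideal.Quotient.mk P (b ⟨_, hne⟩) := by
      intro f
      obtain ⟨g, rfl⟩ := hsh f
      rw [Ideal.Quotient.stabilizerHom_apply]
      congr 1
      exact hbU ⟨_, hne⟩ g g.2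
    obtain ⟨x, hx⟩ := (IsGalois.mem_bot_iff_fixed _).mpr h1
    obtain ⟨c, rfl⟩ := hLsurj x
    refine hval ⟨_, hne⟩ c ?_
    rw [← hx]
    rfl
  -- A nontrivial `g` in the inertia group would make the factor `g • y g - y g` vanish at `P`.
  have hinj : Function.Injective (Ideal.Quotient.stabilizerHom P p 𝒢) := by
    rw [injective_iff_map_eq_one]
    intro g hg
    by_contra hne
    have hg1 : (g : 𝒢) ≠ 1 := fun h => hne (Subtype.ext h)
    refine hβ ?_
    rw [map_prod]
    refine Finset.prod_eq_zero (Finset.mem_erase.mpr ⟨hg1, Finset.mem_univ _⟩) ?_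
    have := congrArg (fun f => f (Ideal.Quotient.mk P (y g))) hg
    simp only [Ideal.Quotient.stabilizerHom_apply, AlgEquiv.one_apply] at this
    rw [map_sub, sub_eq_zero]
    exact this
  let e₁ : MulAction.stabilizer 𝒢 P ≃* ((B ⧸ P) ≃ₐ[L[X] ⧸ p] (B ⧸ P)) :=
    MulEquiv.ofBijective _ ⟨hinj, hsh⟩
  let e₂ : MulAction.stabilizer 𝒢 P ≃* 𝒢 :=
    (MulEquiv.subgroupCongr htop).trans Subgroup.topEquiv
  have hgalL : IsGalois L (B ⧸ P) := by
    let e₃ : L ≃+* (L[X] ⧸ p) :=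
      RingEquiv.ofBijective (algebraMap L (L[X] ⧸ p)) ⟨(algebraMap L _).injective, hLsurj⟩
    refine IsGalois.of_equiv_equiv (F := L[X] ⧸ p) (E := B ⧸ P) (f := e₃.symm)
      (g := RingEquiv.refl _) ?_
    refine RingHom.ext fun x => ?_
    obtain ⟨y, rfl⟩ := e₃.surjective x
    simp only [RingHom.comp_apply, RingEquiv.coe_toRingHom, RingEquiv.symm_apply_apply]
    exact IsScalarTower.algebraMap_apply L (L[X] ⧸ p) (B ⧸ P) y
  let j : (B ⧸ P) →ₐ[L] Ω := IsAlgClosed.lift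
  let e := AlgEquiv.ofInjectiveField j
  refine ⟨j.fieldRange, LinearEquiv.finiteDimensional e.toLinearEquiv, IsGalois.of_algEquiv e,
    ⟨(AlgEquiv.autCongr e).symm.trans ((algEquivRestrictScalars hLsurj).symm.trans
      (e₁.symm.trans e₂))⟩⟩

/-- **Hilbert's irreducibility theorem** for Galois extensions: a finite group of automorphisms of a
field `Φ` with fixed field `L(t)` is the Galois group of an extension of the number field `L`. -/
theorem exists_isGalois_of_fixed {Φ : Type*} [Field Φ] [Algebra L[X] Φ]
    [FaithfulSMul L[X] Φ] {𝒢 : Type*} [Group 𝒢] [Finite 𝒢] [MulSemiringAction 𝒢 Φ]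
    [FaithfulSMul 𝒢 Φ] [SMulCommClass 𝒢 L[X] Φ]
    (hinv : ∀ x : Φ, (∀ g : 𝒢, g • x = x) → ∃ p q : L[X], q ≠ 0 ∧
      x * algebraMap L[X] Φ q = algebraMap L[X] Φ p)
    (Ω : Type*) [Field Ω] [Algebra L Ω] [IsAlgClosed Ω] :
    ∃ N : IntermediateField L Ω, FiniteDimensional L N ∧ IsGalois L N ∧
      Nonempty ((N ≃ₐ[L] N) ≃* 𝒢) := by
  let F := FixedPoints.subfield 𝒢 Φ
  let : Algebra L[X] F := ((algebraMap L[X] Φ).codRestrict F fun q g => smul_algebraMap g q).toAlgebra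
  have : IsScalarTower L[X] F Φ := .of_algebraMap_eq' rfl
  have : FaithfulSMul L[X] F := (faithfulSMul_iff_algebraMap_injective L[X] F).mpr fun q q' h =>
    FaithfulSMul.algebraMap_injective L[X] Φ (congrArg (algebraMap F Φ) h)
  have : IsFractionRing L[X] F := IsFractionRing.of_field L[X] F fun z => by
    obtain ⟨p, q, hq, h⟩ := hinv z z.2
    refine ⟨p, q, ?_⟩
    rw [eq_div_iff (by simpa using hq)]
    exact Subtype.ext h
  have halg : ∀ x : Φ, ∃ d : L[X], d ≠ 0 ∧
      _root_.IsIntegral L[X] (d • x) := fun x =>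
    ((IsFractionRing.isAlgebraic_iff L[X] F Φ).mpr
      (FixedPoints.isIntegral 𝒢 Φ x).isAlgebraic).exists_integral_multiple
  -- The group acts on the integral closure of `L[t]`. Its invariants there are integral elements of
  -- `L(t)`, hence lie in `L[t]`; and every element of `Φ` is a multiple of an element of `B` by an
  -- invariant, so nothing is lost.
  let B := integralClosure L[X] Φ
  have : FaithfulSMul 𝒢 B := ⟨fun {g h} H => FaithfulSMul.eq_of_smul_eq_smul (α := Φ) fun x => by
    obtain ⟨d, hd, hx⟩ := halg x
    have h1 := congrArg (algebraMap B Φ) (H ⟨d • x, hx⟩)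
    have h2 : g • (d • x) = h • (d • x) := h1
    rw [smul_comm, smul_comm h, Algebra.smul_def, Algebra.smul_def] at h2
    exact mul_left_cancel₀ (by simpa using hd) h2⟩
  have : Algebra.IsInvariant L[X] B 𝒢 := ⟨fun b hb => by
    let b' : F := ⟨b, fun g => congrArg (algebraMap B Φ) (hb g)⟩
    have h1 : _root_.IsIntegral L[X] b' :=
      (isIntegral_algebraMap_iff (algebraMap F Φ).injective).mp b.2
    obtain ⟨q, hq⟩ := IsIntegrallyClosed.isIntegral_iff.mp h1
    exact ⟨q, Subtype.ext (congrArg (algebraMap F Φ) hq)⟩⟩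
  refine exists_isGalois_of_isInvariant (B := B) (𝒢 := 𝒢) (fun U hU => ?_) Ω
  obtain ⟨x, hx, g, hg⟩ := exists_fixed_of_ne_top (Φ := Φ) hU
  obtain ⟨d, hd, hdx⟩ := halg x
  refine ⟨⟨d • x, hdx⟩, fun g hgU => Subtype.ext ?_, g, fun h => hg ?_⟩
  · change g • (d • x) = d • x
    rw [smul_comm, hx g hgU]
  · have h2 : g • (d • x) = d • x := congrArg (algebraMap B Φ) h
    rw [smul_comm, Algebra.smul_def, Algebra.smul_def] at h2
    exact mul_left_cancel₀ (by simpa using hd) h2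

end Specialization

/-! ### The standard affine charts of the projective line. -/

section Charts

open HomogeneousLocalization

attribute [local instance] MvPolynomial.gradedAlgebra

namespace P1

variable {K E : Type} [Field K] [Field E]

/-- The homogeneous coordinate ring of the projective line. -/
local notation "𝒮" => MvPolynomial.homogeneousSubmodule (Fin 2)

theorem X_mem (i : Fin 2) : (MvPolynomial.X i : MvPolynomial (Fin 2) K) ∈ 𝒮 K 1 :=
  MvPolynomial.isHomogeneous_X K i

/-- The fraction `X_k / X_i`. -/
noncomputable def coordinate (K : Type) [Field K] (i k : Fin 2) :
    Away (𝒮 K) (MvPolynomial.X i) :=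
  Away.mk (𝒮 K) (X_mem i) 1 (MvPolynomial.X k) (by simpa using X_mem k)

theorem val_coordinate_mul (i k : Fin 2) :
    (coordinate K i k).val * algebraMap (MvPolynomial (Fin 2) K) _ (MvPolynomial.X i) =
      algebraMap (MvPolynomial (Fin 2) K) _ (MvPolynomial.X k) := by
  rw [coordinate, Away.val_mk, Localization.mk_eq_mk']
  have := IsLocalization.mk'_spec (Localization.Away (MvPolynomial.X i : MvPolynomial (Fin 2) K))
    (MvPolynomial.X k)
    (⟨MvPolynomial.X i ^ 1, 1, rfl⟩ : Submonoid.powers (MvPolynomial.X i : MvPolynomial (Fin 2) K))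
  simp

theorem coordinate_self (i : Fin 2) : coordinate K i i = 1 := by
  ext
  rw [coordinate, Away.val_mk, val_one]
  simp only [pow_one]
  exact Localization.mk_self (⟨MvPolynomial.X i, _⟩ :
    Submonoid.powers (MvPolynomial.X i : MvPolynomial (Fin 2) K))

/-- The constant functions. -/
noncomputable def constant (K : Type) [Field K] (i : Fin 2) :
    K →+* Away (𝒮 K) (MvPolynomial.X i) :=
  (fromZeroRingHom (𝒮 K) _).comp ((MvPolynomial.C : K →+* MvPolynomial (Fin 2) K).codRestrict
    (SetLike.GradeZero.subring (𝒮 K)) fun c => MvPolynomial.isHomogeneous_C _ c)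

theorem val_constant (i : Fin 2) (c : K) :
    (constant K i c).val =
      algebraMap (MvPolynomial (Fin 2) K) _ (MvPolynomial.C c) :=
  Localization.mk_one_eq_algebraMap _

/-- Homogenization of polynomials. -/
noncomputable def homogenize (K : Type) [Field K] (i : Fin 2) :
    Polynomial K →+* Away (𝒮 K) (MvPolynomial.X i) :=
  Polynomial.eval₂RingHom (constant K i) (coordinate K i i.rev)

/-- Dehomogenization of polynomials. -/
noncomputable def dehomogenizeAux (K : Type) [Field K] (i : Fin 2) :
    MvPolynomial (Fin 2) K →+* Polynomial K :=
  MvPolynomial.eval₂Hom Polynomial.C fun k => if k = i then 1 else Polynomial.X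

theorem isUnit_dehomogenizeAux (i : Fin 2) :
    IsUnit (dehomogenizeAux K i (MvPolynomial.X i)) := by
  simp [dehomogenizeAux]

/-- Dehomogenization of fractions. -/
noncomputable def dehomogenize (K : Type) [Field K] (i : Fin 2) :
    Away (𝒮 K) (MvPolynomial.X i) →+* Polynomial K :=
  (IsLocalization.Away.lift (S := Localization.Away (MvPolynomial.X i : MvPolynomial (Fin 2) K))
    (MvPolynomial.X i) (isUnit_dehomogenizeAux i)).comp (algebraMap _ _)

theorem dehomogenize_homogenize (i : Fin 2) (p : Polynomial K) :
    dehomogenize K i (homogenize K i p) = p := by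
  have h : (dehomogenize K i).comp (homogenize K i) = RingHom.id _ := by
    refine Polynomial.ringHom_ext (fun c => ?_) ?_
    · simp only [homogenize, RingHom.comp_apply, Polynomial.coe_eval₂RingHom, Polynomial.eval₂_C,
        dehomogenize, RingHom.id_apply]
      change IsLocalization.Away.lift _ _ (constant K i c).val = _
      rw [val_constant, IsLocalization.Away.lift_eq]
      simp [dehomogenizeAux]
    · simp only [homogenize, RingHom.comp_apply, Polynomial.coe_eval₂RingHom, Polynomial.eval₂_X,
        dehomogenize, RingHom.id_apply]
      change IsLocalization.Away.lift _ _ (coordinate K i i.rev).val = _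
      have h1 := val_coordinate_mul (K := K) i i.rev
      have h2 := congrArg (IsLocalization.Away.lift
        (S := Localization.Away (MvPolynomial.X i : MvPolynomial (Fin 2) K))
        (MvPolynomial.X i : MvPolynomial (Fin 2) K) (isUnit_dehomogenizeAux i)) h1
      rw [map_mul, IsLocalization.Away.lift_eq, IsLocalization.Away.lift_eq] at h2
      have h3 : i.rev ≠ i := by fin_cases i <;> decide
      simpa [dehomogenizeAux, h3] using h2
  exact congrArg (fun f => f p) h

theorem homogenize_surjective (i : Fin 2) : Function.Surjective (homogenize K i) := by
  intro z
  obtain ⟨n, x, hx, rfl⟩ := Away.mk_surjective (𝒮 K) (X_mem i) z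
  refine ⟨dehomogenizeAux K i x, ?_⟩
  have hX : ∀ k, algebraMap _ (Localization.Away (MvPolynomial.X i : MvPolynomial (Fin 2) K))
      (MvPolynomial.X k : MvPolynomial (Fin 2) K) =
        algebraMap (MvPolynomial (Fin 2) K) _ (MvPolynomial.X i) * (coordinate K i k).val := by
    intro k
    rw [mul_comm, val_coordinate_mul]
  have hk : ∀ k, homogenize K i (if k = i then 1 else Polynomial.X) = coordinate K i k := by
    intro k
    split_ifs with h
    · rw [h, map_one, coordinate_self]
    · have : k = i.rev := by fin_cases i <;> fin_cases k <;> simp_all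
      simp [homogenize, this]
  -- Substitute `X_k = X_i · (X_k / X_i)` in a monomial of degree `n` and collect the factor `X_i ^
  -- n`.
  have hmono : ∀ (d : Fin 2 →₀ ℕ) (c : K), d.degree = n →
      algebraMap _ (Localization.Away (MvPolynomial.X i : MvPolynomial (Fin 2) K))
      (MvPolynomial.monomial d c : MvPolynomial (Fin 2) K) = algebraMap (MvPolynomial (Fin 2) K) _ (MvPolynomial.X i) ^ n *
        algebraMap (Away (𝒮 K) (MvPolynomial.X i)) _ (homogenize K i (dehomogenizeAux K i (MvPolynomial.monomial d c))) := by
    intro d c hd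
    rw [dehomogenizeAux, MvPolynomial.coe_eval₂Hom, MvPolynomial.eval₂_monomial,
      MvPolynomial.monomial_eq, Finsupp.prod_fintype _ _ (by simp),
      Finsupp.prod_fintype _ _ (by simp)]
    rw [map_mul, map_mul, map_mul, map_prod, map_prod, map_prod]
    have hX' : ∀ k, algebraMap (MvPolynomial (Fin 2) K)
        (Localization.Away (MvPolynomial.X i : MvPolynomial (Fin 2) K)) (MvPolynomial.X k ^ d k) =
        (algebraMap (MvPolynomial (Fin 2) K) _ (MvPolynomial.X i) * (coordinate K i k).val) ^ d k :=
      fun k => by rw [map_pow, hX]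
    simp only [hX', map_pow, hk]
    have h1 : homogenize K i (Polynomial.C c) = constant K i c := by simp [homogenize]
    rw [h1]
    change _ = _ * ((constant K i c).val * _)
    rw [val_constant]
    simp only [mul_pow, Finset.prod_mul_distrib]
    rw [Finset.prod_pow_eq_pow_sum, ← Finsupp.degree_eq_sum, hd]
    simp only [HomogeneousLocalization.algebraMap_apply]
    ring
  have hsum : algebraMap _ (Localization.Away (MvPolynomial.X i : MvPolynomial (Fin 2) K)) x =
      algebraMap (MvPolynomial (Fin 2) K) _ (MvPolynomial.X i) ^ n *
        algebraMap (Away (𝒮 K) (MvPolynomial.X i)) _ (homogenize K i (dehomogenizeAux K i x)) := by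
    rw [MvPolynomial.as_sum x]
    simp only [map_sum, Finset.mul_sum]
    refine Finset.sum_congr rfl fun d hd => hmono d _ ?_
    have h1 : x.IsHomogeneous n := by simpa using hx
    have := h1 (MvPolynomial.mem_support_iff.mp hd)
    rw [Finsupp.degree_eq_weight_one]
    exact this
  ext
  rw [Away.val_mk, Localization.mk_eq_mk', eq_comm, IsLocalization.mk'_eq_iff_eq_mul, hsum, mul_comm]
  simp [HomogeneousLocalization.algebraMap_apply]

/-- The image of `X_i` under the graded map is only propositionally `X_i`, and the rings of sections
depend on it. Taking a variable `s` with an equation allows substitution before comparing the two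
ring homomorphisms on constants and on `t`. -/
theorem awayToSection_homogenize_of_eq (φ : K →+* E) (i : Fin 2)
    {s : MvPolynomial (Fin 2) E} (hs : s = MvPolynomial.X i)
    (ψ : Polynomial K →+* Away (𝒮 E) s)
    (hC : ∀ c, (ψ (Polynomial.C c)).val = algebraMap (MvPolynomial (Fin 2) E) _ (MvPolynomial.C (φ c)))
    (hX : (ψ Polynomial.X).val * algebraMap (MvPolynomial (Fin 2) E) _ s = algebraMap (MvPolynomial (Fin 2) E) _ (MvPolynomial.X i.rev))
    (p : Polynomial K) :
    (P1 E).presheaf.map (homOfLE (congrArg (Proj.basicOpen (𝒮 E)) hs).ge).op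
      (Proj.awayToSection (𝒮 E) s (ψ p)) =
      Proj.awayToSection (𝒮 E) (MvPolynomial.X i) (homogenize E i (p.map φ)) := by
  subst hs
  have h : (homogenize E i).comp (Polynomial.mapRingHom φ) = ψ := by
    refine Polynomial.ringHom_ext (fun c => ?_) ?_
    · ext
      rw [hC, RingHom.comp_apply, Polynomial.coe_mapRingHom, Polynomial.map_C, homogenize,
        Polynomial.coe_eval₂RingHom, Polynomial.eval₂_C, val_constant]
    · ext
      refine (IsLocalization.Away.algebraMap_isUnit
        (S := Localization.Away (MvPolynomial.X i : MvPolynomial (Fin 2) E))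
        (MvPolynomial.X i : MvPolynomial (Fin 2) E)).mul_left_injective ?_
      dsimp only
      rw [hX, RingHom.comp_apply, Polynomial.coe_mapRingHom, Polynomial.map_X, homogenize,
        Polynomial.coe_eval₂RingHom, Polynomial.eval₂_X, val_coordinate_mul]
  rw [← h]
  exact congrArg (fun f => f.hom (Proj.awayToSection (𝒮 E) (MvPolynomial.X i)
    (homogenize E i (p.map φ)))) ((P1 E).presheaf.map_id (.op (Proj.basicOpen (𝒮 E) (MvPolynomial.X i))))

/-- The standard open subset `X_i ≠ 0` of the projective line. -/
noncomputable def standardOpen (K : Type) [Field K] (i : Fin 2) : (P1 K).Opens :=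
  Proj.basicOpen (𝒮 K) (MvPolynomial.X i)

theorem isAffineOpen_standardOpen (i : Fin 2) : IsAffineOpen (standardOpen K i) :=
  Proj.isAffineOpen_basicOpen (𝒮 K) (MvPolynomial.X i) (X_mem i) one_pos

theorem iSup_standardOpen : ⨆ i, standardOpen K i = ⊤ := by
  refine Proj.iSup_basicOpen_eq_top' (𝒮 K) _ (fun i => ⟨1, X_mem i⟩) ?_
  rw [eq_top_iff]
  rintro x -
  induction x using MvPolynomial.induction_on with
  | C c =>
    exact Subalgebra.algebraMap_mem (R := 𝒮 K 0) _ ⟨MvPolynomial.C c, MvPolynomial.isHomogeneous_C _ c⟩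
  | add p q hp hq => exact add_mem hp hq
  | mul_X p i hp => exact mul_mem hp (Algebra.subset_adjoin ⟨i, rfl⟩)

theorem map_preimage_standardOpen (φ : K →+* E) (i : Fin 2) :
    P1.map φ ⁻¹ᵁ standardOpen K i = standardOpen E i := by
  change Proj.basicOpen (𝒮 E) (MvPolynomial.map φ (MvPolynomial.X i)) = _
  rw [MvPolynomial.map_X]
  rfl

/-- The ring of functions on the standard open subsets of the projective line. -/
noncomputable def chart (K : Type) [Field K] (i : Fin 2) :
    Polynomial K ≃+* Γ(P1 K, standardOpen K i) :=
  (RingEquiv.ofBijective (homogenize K i)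
    ⟨Function.LeftInverse.injective (dehomogenize_homogenize i), homogenize_surjective i⟩).trans
    (Proj.basicOpenIsoAway (𝒮 K) (MvPolynomial.X i) (X_mem i) one_pos).commRingCatIsoToRingEquiv

/-- The coordinate description of the base change morphism: in each affine chart it applies `φ` to
coefficients and fixes `t`. Later computations with rational functions on the line rest on this. -/
theorem map_app_chart (φ : K →+* E) (i : Fin 2) (p : Polynomial K) :
    (P1.map φ).appLE (standardOpen K i) (standardOpen E i) (map_preimage_standardOpen φ i).ge
      (chart K i p) = chart E i (p.map φ) := by
  have h1 := Proj.awayToSection_comp_appLE (gradedMap φ) (irrelevant_le φ) (X_mem i)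
  have h2 := congrArg (fun f => f (homogenize K i p)) h1
  have hs : gradedMap φ (MvPolynomial.X i) = MvPolynomial.X i := MvPolynomial.map_X φ i
  have h3 := awayToSection_homogenize_of_eq φ i hs
    ((Away.map (gradedMap φ) (MvPolynomial.X i)).comp (homogenize K i)) (fun c => ?_) ?_ p
  · change ((P1.map φ).appLE (Proj.basicOpen (𝒮 K) (MvPolynomial.X i))
      (Proj.basicOpen (𝒮 E) (MvPolynomial.X i)) _).hom ((Proj.awayToSection (𝒮 K)
      (MvPolynomial.X i)).hom (homogenize K i p)) = Proj.awayToSection (𝒮 E)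
      (MvPolynomial.X i) (homogenize E i (p.map φ))
    rw [← h3]
    refine Eq.trans ?_ (congrArg _ h2)
    exact congrArg (fun f => f.hom ((Proj.awayToSection (𝒮 K) (MvPolynomial.X i)).hom
      (homogenize K i p))) (Scheme.Hom.appLE_map (P1.map φ)
      (V := Proj.basicOpen (𝒮 E) (gradedMap φ (MvPolynomial.X i))) le_rfl
      (homOfLE (congrArg (Proj.basicOpen (𝒮 E)) hs).ge).op).symm
  · simp only [homogenize, RingHom.coe_comp, Function.comp_apply, Polynomial.coe_eval₂RingHom,
      Polynomial.eval₂_C]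
    change Localization.mk (gradedMap φ (MvPolynomial.C c))
      (⟨gradedMap φ 1, _⟩ : Submonoid.powers (gradedMap φ (MvPolynomial.X i))) = _
    rw [← Localization.mk_one_eq_algebraMap]
    congr 1
    · exact MvPolynomial.map_C φ c
    · exact Subtype.ext (map_one _)
  · simp only [homogenize, RingHom.coe_comp, Function.comp_apply, Polynomial.coe_eval₂RingHom,
      Polynomial.eval₂_X]
    rw [coordinate, Away.map_mk, Away.val_mk, Localization.mk_eq_mk']
    have h4 := IsLocalization.mk'_spec (Localization.Away (gradedMap φ (MvPolynomial.X i)))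
      (gradedMap φ (MvPolynomial.X i.rev))
      (⟨gradedMap φ (MvPolynomial.X i) ^ 1, 1, rfl⟩ :
        Submonoid.powers (gradedMap φ (MvPolynomial.X i)))
    have h5 : gradedMap φ (MvPolynomial.X i.rev) = MvPolynomial.X i.rev := MvPolynomial.map_X φ _
    rw [← h5]
    simpa only [pow_one] using h4

end P1

end Charts

/-! ### Function fields and dominant morphisms. -/

section FunctionFields

variable {X Y : Scheme.{0}}

theorem functionFieldMap_germToFunctionField [IrreducibleSpace X] [IrreducibleSpace Y] (f : X ⟶ Y)
    [IsDominant f] (U : Y.Opens) (V : X.Opens) [Nonempty U] [Nonempty V] (h : V ≤ f ⁻¹ᵁ U)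
    (s : Γ(Y, U)) :
    functionFieldMap f (Y.germToFunctionField U s) = X.germToFunctionField V (f.appLE U V h s) := by
  have h1 : Y.germToFunctionField U ≫ functionFieldMap f =
      f.appLE U V h ≫ X.germToFunctionField V := by
    unfold functionFieldMap Scheme.germToFunctionField Scheme.Hom.appLE
    rw [TopCat.Presheaf.germ_stalkSpecializes_assoc, Scheme.Hom.germ_stalkMap, Category.assoc,
      TopCat.Presheaf.germ_res]
  exact congrArg (fun φ => φ.hom s) h1

theorem SpecMap_functionFieldMap [IrreducibleSpace X] [IrreducibleSpace Y] (f : X ⟶ Y)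
    [IsDominant f] :
    Spec.map (functionFieldMap f) ≫ Y.fromSpecStalk (genericPoint Y) =
      X.fromSpecStalk (genericPoint X) ≫ f := by
  unfold functionFieldMap
  rw [Spec.map_comp, Category.assoc, Scheme.SpecMap_stalkSpecializes_fromSpecStalk,
    Scheme.SpecMap_stalkMap_fromSpecStalk]

/-- Any nonempty open set contains a nonempty basic open `D(s)` inside `U`. Its preimage contains
the locus where the pullback of `s` is invertible, which is nonempty because that pullback is a
nonzero function on an integral scheme. -/
theorem isDominant_of_appLE_injective [IsIntegral X] [IsIntegral Y] (f : X ⟶ Y) (U : Y.Opens)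
    (hU : IsAffineOpen U) [Nonempty U] (V : X.Opens) (h : V ≤ f ⁻¹ᵁ U)
    (hinj : Function.Injective (f.appLE U V h)) : IsDominant f := by
  refine ⟨dense_iff_inter_open.mpr ?_⟩
  rintro W hW ⟨w, hw⟩
  obtain ⟨x, hxU, hxW⟩ := nonempty_preirreducible_inter U.isOpen hW
    (Set.nonempty_coe_sort.mp ‹Nonempty U›) ⟨w, hw⟩
  obtain ⟨s, hs, hxs⟩ := hU.exists_basicOpen_le (V := ⟨W, hW⟩) ⟨x, hxW⟩ hxU
  have hs0 : s ≠ 0 := by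
    rintro rfl
    rw [Scheme.basicOpen_zero] at hxs
    exact hxs
  have h0 : f.appLE U V h s ≠ 0 := fun h' => hs0 (hinj (h'.trans (map_zero _).symm))
  have h1 : X.basicOpen (f.appLE U V h s) ≠ ⊥ := fun h' => h0 ((basicOpen_eq_bot_iff _).mp h')
  obtain ⟨z, hz⟩ := (TopologicalSpace.Opens.ne_bot_iff_nonempty _).mp h1
  have h2 : X.basicOpen (f.appLE U V h s) ≤ f ⁻¹ᵁ Y.basicOpen s := by
    rw [Scheme.preimage_basicOpen]
    unfold Scheme.Hom.appLE
    rw [CommRingCat.comp_apply, Scheme.basicOpen_res]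
    exact inf_le_right
  exact ⟨f z, hs (h2 hz), z, rfl⟩

end FunctionFields

/-! ### Polynomials and rational functions on the line. -/

namespace P1

variable (K : Type) [Field K] {E : Type} [Field E]

instance (i : Fin 2) : Nonempty (standardOpen K i) := by
  refine ((TopologicalSpace.Opens.ne_bot_iff_nonempty (standardOpen K i)).mp fun h => ?_).to_subtype
  have h1 : Subsingleton Γ(P1 K, standardOpen K i) := by
    rw [h]; infer_instance
  exact not_subsingleton (Polynomial K) (chart K i).toEquiv.subsingleton

instance isDominant_map {K : Type} [Field K] (φ : K →+* E) : IsDominant (P1.map φ) := by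
  refine isDominant_of_appLE_injective _ (standardOpen K 0) (isAffineOpen_standardOpen 0)
    (standardOpen E 0) (map_preimage_standardOpen φ 0).ge ?_
  intro s t h
  obtain ⟨p, rfl⟩ := (chart K 0).surjective s
  obtain ⟨q, rfl⟩ := (chart K 0).surjective t
  rw [map_app_chart, map_app_chart] at h
  rw [Polynomial.map_injective φ φ.injective ((chart E 0).injective h)]

/-- Polynomials as rational functions on the projective line, for each of the two coordinates. -/
noncomputable def toFunctionField (i : Fin 2) : Polynomial K →+* (P1 K).functionField :=
  ((P1 K).germToFunctionField (standardOpen K i)).hom.comp (chart K i : Polynomial K →+* _)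

theorem toFunctionField_injective (i : Fin 2) : Function.Injective (toFunctionField K i) :=
  ((P1 K).germToFunctionField_injective (standardOpen K i)).comp (chart K i).injective

theorem exists_toFunctionField (i : Fin 2) (z : (P1 K).functionField) :
    ∃ p q : Polynomial K, q ≠ 0 ∧ z * toFunctionField K i q = toFunctionField K i p := by
  have := functionField_isFractionRing_of_isAffineOpen (P1 K) (standardOpen K i)
    (isAffineOpen_standardOpen i)
  obtain ⟨⟨s, t⟩, h⟩ := IsLocalization.surj (nonZeroDivisors Γ(P1 K, standardOpen K i)) z
  obtain ⟨p, rfl⟩ := (chart K i).surjective s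
  obtain ⟨q, hq⟩ := (chart K i).surjective t.1
  refine ⟨p, q, ?_, ?_⟩
  · rintro rfl
    exact nonZeroDivisors.coe_ne_zero t (by rw [← hq, map_zero])
  · dsimp only at h
    rw [← hq] at h
    exact h

variable {K}

theorem functionFieldMap_toFunctionField (φ : K →+* E) (i : Fin 2) (p : Polynomial K) :
    functionFieldMap (P1.map φ) (toFunctionField K i p) = toFunctionField E i (p.map φ) := by
  change functionFieldMap (P1.map φ) ((P1 K).germToFunctionField _ (chart K i p)) = _
  rw [functionFieldMap_germToFunctionField _ _ _ (map_preimage_standardOpen φ i).ge, map_app_chart]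
  rfl

end P1

/-! ### A criterion for a scheme to be a normalization. -/

section Sections

variable {L L' : CommRingCat.{0}} {T Y : Scheme.{0}}

/-- The pullback of functions along a morphism from an affine scheme. -/
noncomputable def pullbackSection (j : Spec L ⟶ T) (W : T.Opens) (h : ⊤ ≤ j ⁻¹ᵁ W) : Γ(T, W) ⟶ L :=
  j.appLE W ⊤ h ≫ (Scheme.ΓSpecIso L).hom

theorem appLE_pullbackSection (j : Spec L ⟶ T) (g : T ⟶ Y) (U : Y.Opens) (W : T.Opens)
    (hW : W ≤ g ⁻¹ᵁ U) (h : ⊤ ≤ j ⁻¹ᵁ W) :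
    g.appLE U W hW ≫ pullbackSection j W h =
      pullbackSection (j ≫ g) U (h.trans (j.preimage_mono hW)) := by
  rw [pullbackSection, pullbackSection, Scheme.Hom.appLE_comp_appLE_assoc]

theorem pullbackSection_SpecMap (φ : L ⟶ L') (j : Spec L ⟶ T) (W : T.Opens) (h : ⊤ ≤ j ⁻¹ᵁ W)
    (h' : ⊤ ≤ (Spec.map φ ≫ j) ⁻¹ᵁ W) :
    pullbackSection j W h ≫ φ = pullbackSection (Spec.map φ ≫ j) W h' := by
  unfold pullbackSection
  rw [Category.assoc, ← Scheme.ΓSpecIso_naturality,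
    ← Scheme.Hom.appLE_comp_appLE (Spec.map φ) j W ⊤ ⊤ h le_rfl, Category.assoc]
  simp [Scheme.Hom.app_eq_appLE]

theorem pullbackSection_fromSpecStalk (x : T) (W : T.Opens) (hx : x ∈ W)
    (h : ⊤ ≤ T.fromSpecStalk x ⁻¹ᵁ W) :
    pullbackSection (T.fromSpecStalk x) W h = T.presheaf.germ W x hx := by
  unfold pullbackSection
  rw [← Iso.eq_comp_inv, Scheme.Hom.appLE, T.fromSpecStalk_app hx, Category.assoc, Category.assoc,
    ← Functor.map_comp]
  congr 1

/-- Over an affine open of `Y` the normalization has as its sections the functions on `S` that are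
integral over `Y`. So it suffices that the sections of `T` embed into those of `S` and exhaust the
integral ones, chart by chart. -/
theorem isIso_normalizationDesc {S : Scheme.{0}} (f₁ : S ⟶ T) (f₂ : T ⟶ Y) [IsIntegralHom f₂]
    [QuasiCompact (f₁ ≫ f₂)] [QuasiSeparated (f₁ ≫ f₂)] {ι : Type*} (V : ι → Y.Opens)
    (hV : ∀ i, IsAffineOpen (V i)) (hVtop : ⨆ i, V i = ⊤)
    (hinj : ∀ i, Function.Injective (f₁.app (f₂ ⁻¹ᵁ V i)))
    (hsurj : ∀ i x, ((f₁ ≫ f₂).app (V i)).hom.IsIntegralElem x → ∃ y, f₁.app (f₂ ⁻¹ᵁ V i) y = x) :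
    IsIso ((f₁ ≫ f₂).normalizationDesc f₁ f₂ rfl) := by
  set d := (f₁ ≫ f₂).normalizationDesc f₁ f₂ rfl with hd
  have hdc : d ≫ f₂ = (f₁ ≫ f₂).fromNormalization := Scheme.Hom.normalizationDesc_comp ..
  have hnd : (f₁ ≫ f₂).toNormalization ≫ d = f₁ := Scheme.Hom.toNormalization_normalizationDesc ..
  have htop : ⨆ i, f₂ ⁻¹ᵁ V i = ⊤ := by
    rw [← Scheme.Hom.preimage_iSup, hVtop]
    rfl
  refine (IsZariskiLocalAtTarget.iff_of_iSup_eq_top (P := .isomorphisms _) _ htop).mpr fun i => ?_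
  refine (isIso_morphismRestrict_iff_isIso_app d ((hV i).preimage f₂)).mpr ?_
  have hVi : (f₁ ≫ f₂).fromNormalization ⁻¹ᵁ V i = d ⁻¹ᵁ f₂ ⁻¹ᵁ V i := by
    rw [← Scheme.Hom.comp_preimage, hdc]
  have h1 : ∀ U, U = (f₁ ≫ f₂).fromNormalization ⁻¹ᵁ V i →
      ∀ h : (f₁ ≫ f₂) ⁻¹ᵁ V i ≤ (f₁ ≫ f₂).toNormalization ⁻¹ᵁ U,
      Function.Injective ((f₁ ≫ f₂).toNormalization.appLE U ((f₁ ≫ f₂) ⁻¹ᵁ V i) h) ∧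
      ∀ y, ((f₁ ≫ f₂).app (V i)).hom.IsIntegralElem
        ((f₁ ≫ f₂).toNormalization.appLE U ((f₁ ≫ f₂) ⁻¹ᵁ V i) h y) := by
    rintro _ rfl h
    rw [← (f₁ ≫ f₂).normalizationObjIso_hom_val (hV i)]
    let := ((f₁ ≫ f₂).app (V i)).hom.toAlgebra
    refine ⟨?_, fun y => ?_⟩
    · exact Subtype.val_injective.comp (ConcreteCategory.bijective_of_isIso
        ((f₁ ≫ f₂).normalizationObjIso (hV i)).hom).1
    · exact ((f₁ ≫ f₂).normalizationObjIso (hV i)).hom y |>.2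
  have hle : (f₁ ≫ f₂) ⁻¹ᵁ V i ≤ (f₁ ≫ f₂).toNormalization ⁻¹ᵁ d ⁻¹ᵁ f₂ ⁻¹ᵁ V i := by
    rw [← Scheme.Hom.comp_preimage, hnd]
    exact le_rfl
  obtain ⟨h2, h3⟩ := h1 _ hVi.symm hle
  have h4 : f₁.app (f₂ ⁻¹ᵁ V i) = d.app (f₂ ⁻¹ᵁ V i) ≫
      (f₁ ≫ f₂).toNormalization.appLE _ ((f₁ ≫ f₂) ⁻¹ᵁ V i) hle := by
    rw [Scheme.Hom.app_eq_appLE, Scheme.Hom.app_eq_appLE, Scheme.Hom.appLE_comp_appLE]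
    congr 1
    exact hnd.symm
  rw [ConcreteCategory.isIso_iff_bijective]
  refine ⟨fun s t h => hinj i ?_, fun y => ?_⟩
  · rw [h4]
    exact congrArg ((f₁ ≫ f₂).toNormalization.appLE _ ((f₁ ≫ f₂) ⁻¹ᵁ V i) hle) h
  · obtain ⟨t, ht⟩ := hsurj i _ (h3 y)
    refine ⟨t, h2 ?_⟩
    rw [← ht, h4]
    rfl

/-- A criterion for a factorization of a morphism from an affine scheme to be the normalization. -/
theorem isIso_normalizationDesc_of_affine (f₁ : Spec L ⟶ T) (f₂ : T ⟶ Y)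
    [IsIntegralHom f₂] [QuasiCompact (f₁ ≫ f₂)] [QuasiSeparated (f₁ ≫ f₂)] {ι : Type*}
    (V : ι → Y.Opens) (hV : ∀ i, IsAffineOpen (V i)) (hVtop : ⨆ i, V i = ⊤)
    (h : ∀ i, ⊤ ≤ f₁ ⁻¹ᵁ f₂ ⁻¹ᵁ V i)
    (hinj : ∀ i, Function.Injective (pullbackSection f₁ (f₂ ⁻¹ᵁ V i) (h i)))
    (hsurj : ∀ i x, (pullbackSection (f₁ ≫ f₂) (V i) (h i)).hom.IsIntegralElem x →
      ∃ y, pullbackSection f₁ (f₂ ⁻¹ᵁ V i) (h i) y = x) :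
    IsIso ((f₁ ≫ f₂).normalizationDesc f₁ f₂ rfl) := by
  have h1 : ∀ i, pullbackSection f₁ (f₂ ⁻¹ᵁ V i) (h i) = f₁.app (f₂ ⁻¹ᵁ V i) ≫
      ((Spec L).presheaf.map (homOfLE (h i)).op ≫ (Scheme.ΓSpecIso L).hom) := fun i => rfl
  have h2 : ∀ i, IsIso ((Spec L).presheaf.map (homOfLE (h i)).op ≫ (Scheme.ΓSpecIso L).hom) := by
    intro i
    have : IsIso (homOfLE (h i)) := by
      refine ⟨homOfLE le_top, ?_, ?_⟩ <;> rfl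
    infer_instance
  have h3 := fun i => ConcreteCategory.bijective_of_isIso
    ((Spec L).presheaf.map (homOfLE (h i)).op ≫ (Scheme.ΓSpecIso L).hom)
  refine isIso_normalizationDesc f₁ f₂ V hV hVtop (fun i s t hst => hinj i ?_) fun i x hx => ?_
  · exact congrArg ((Spec L).presheaf.map (homOfLE (h i)).op ≫ (Scheme.ΓSpecIso L).hom) hst
  · obtain ⟨y, hy⟩ := hsurj i _ (hx.map ((Spec L).presheaf.map (homOfLE (h i)).op ≫ (Scheme.ΓSpecIso L).hom).hom)
    exact ⟨y, (h3 i).1 hy⟩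

end Sections

/-! ### Normal schemes and their function fields. -/

section Normal

variable {T T' Y : Scheme.{0}}

/-- The ring of functions on an affine open subset of a normal integral scheme is integrally
closed. -/
theorem isIntegrallyClosed_of_isAffineOpen [IsIntegral T]
    (hT : ∀ x : T, IsIntegrallyClosed (T.presheaf.stalk x)) (W : T.Opens) (hW : IsAffineOpen W)
    [Nonempty W] : IsIntegrallyClosed Γ(T, W) := by
  have key : ∀ P : Ideal Γ(T, W), ∀ hP : P.IsMaximal,
      @IsLocalization.AtPrime _ _ (T.presheaf.stalk (hW.fromSpec ⟨P, hP.isPrime⟩)) _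
        ((TopCat.Presheaf.algebra_section_stalk T.presheaf
          ⟨hW.fromSpec ⟨P, hP.isPrime⟩, (hW.isoSpec.inv _).2⟩)) P _ := fun P hP =>
    hW.isLocalization_stalk' ⟨P, hP.isPrime⟩ (hW.isoSpec.inv _).2
  let (P : Ideal Γ(T, W)) (hP : P.IsMaximal) :
      Algebra Γ(T, W) (T.presheaf.stalk (hW.fromSpec ⟨P, hP.isPrime⟩)) :=
    TopCat.Presheaf.algebra_section_stalk T.presheaf
      ⟨hW.fromSpec ⟨P, hP.isPrime⟩, (hW.isoSpec.inv _).2⟩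
  refine IsIntegrallyClosed.of_localization_maximal fun P _ hP => ?_
  let := this P hP
  have := key P hP
  have := hT (hW.fromSpec ⟨P, hP.isPrime⟩)
  exact IsIntegrallyClosed.of_equiv (IsLocalization.algEquiv P.primeCompl
    (T.presheaf.stalk (hW.fromSpec ⟨P, hP.isPrime⟩)) (Localization.AtPrime P)).toRingEquiv

/-- The morphism to an integral scheme from the spectrum of its function field. -/
noncomputable def fromSpecFunctionField (T : Scheme.{0}) [IrreducibleSpace T] :
    Spec T.functionField ⟶ T :=
  T.fromSpecStalk (genericPoint T)

theorem top_le_fromSpecFunctionField_preimage [IsIntegral T] (W : T.Opens) [h : Nonempty W] :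
    ⊤ ≤ fromSpecFunctionField T ⁻¹ᵁ W := by
  have h1 : genericPoint T ∈ W :=
    ((genericPoint_spec T).mem_open_set_iff W.isOpen).mpr (by simpa using h)
  rintro x -
  have h2 : fromSpecFunctionField T x ∈ Set.range (T.fromSpecStalk (genericPoint T)) := ⟨x, rfl⟩
  rw [Scheme.range_fromSpecStalk] at h2
  exact h2.mem_open W.isOpen h1

theorem pullbackSection_fromSpecFunctionField [IsIntegral T] (W : T.Opens) [h : Nonempty W] :
    pullbackSection (fromSpecFunctionField T) W (top_le_fromSpecFunctionField_preimage W) =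
      T.germToFunctionField W :=
  pullbackSection_fromSpecStalk _ _ _ _

theorem IsDominant.nonempty_preimage [Nonempty Y] (f : T ⟶ Y) [IsDominant f] (V : Y.Opens)
    [h : Nonempty V] : Nonempty (f ⁻¹ᵁ V) := by
  obtain ⟨x, hx⟩ := f.denseRange.exists_mem_open V.isOpen (Set.nonempty_coe_sort.mp h)
  exact ⟨⟨x, hx⟩⟩

theorem top_le_SpecMap_fromSpecFunctionField_preimage [IsIntegral T] {L : CommRingCat.{0}}
    (φ : T.functionField ⟶ L) (W : T.Opens) [h : Nonempty W] :
    ⊤ ≤ (Spec.map φ ≫ fromSpecFunctionField T) ⁻¹ᵁ W :=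
  fun _ _ => top_le_fromSpecFunctionField_preimage W (Set.mem_univ _)

theorem pullbackSection_SpecMap_fromSpecFunctionField [IsIntegral T] {L : CommRingCat.{0}}
    (φ : T.functionField ⟶ L) (W : T.Opens) [h : Nonempty W] :
    pullbackSection (Spec.map φ ≫ fromSpecFunctionField T) W
      (top_le_SpecMap_fromSpecFunctionField_preimage φ W) = T.germToFunctionField W ≫ φ := by
  rw [← pullbackSection_fromSpecFunctionField, pullbackSection_SpecMap]

/-- A normal integral scheme which is integral over `Y` is the normalization of `Y` in its function
field. -/
theorem isIso_normalizationDesc_of_normal [IsIntegral T] [IsIntegral Y]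
    (hT : ∀ x : T, IsIntegrallyClosed (T.presheaf.stalk x)) (f : T ⟶ Y) [IsIntegralHom f]
    [IsDominant f] {L : CommRingCat.{0}} (φ : T.functionField ⟶ L) [IsIso φ]
    [QuasiCompact ((Spec.map φ ≫ fromSpecFunctionField T) ≫ f)]
    [QuasiSeparated ((Spec.map φ ≫ fromSpecFunctionField T) ≫ f)]
    {ι : Type*} (V : ι → Y.Opens) (hV : ∀ i, IsAffineOpen (V i)) (hVtop : ⨆ i, V i = ⊤)
    [∀ i, Nonempty (V i)] :
    IsIso (((Spec.map φ ≫ fromSpecFunctionField T) ≫ f).normalizationDesc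
      (Spec.map φ ≫ fromSpecFunctionField T) f rfl) := by
  have hne : ∀ i, Nonempty (f ⁻¹ᵁ V i) := fun i => IsDominant.nonempty_preimage f (V i)
  have hφ := ConcreteCategory.bijective_of_isIso φ
  refine isIso_normalizationDesc_of_affine _ f V hV hVtop
    (fun i => top_le_SpecMap_fromSpecFunctionField_preimage φ (f ⁻¹ᵁ V i)) (fun i => ?_)
    fun i x hx => ?_
  · rw [pullbackSection_SpecMap_fromSpecFunctionField]
    exact hφ.1.comp (T.germToFunctionField_injective _)
  · have := isIntegrallyClosed_of_isAffineOpen hT (f ⁻¹ᵁ V i) ((hV i).preimage f)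
    have := functionField_isFractionRing_of_isAffineOpen T (f ⁻¹ᵁ V i) ((hV i).preimage f)
    rw [pullbackSection_SpecMap_fromSpecFunctionField]
    have h1 : pullbackSection ((Spec.map φ ≫ fromSpecFunctionField T) ≫ f) (V i)
        (top_le_SpecMap_fromSpecFunctionField_preimage φ (f ⁻¹ᵁ V i)) =
        (f.app (V i) ≫ T.germToFunctionField (f ⁻¹ᵁ V i)) ≫ φ := by
      refine (appLE_pullbackSection (Spec.map φ ≫ fromSpecFunctionField T) f (V i) (f ⁻¹ᵁ V i) le_rfl
        (top_le_SpecMap_fromSpecFunctionField_preimage φ (f ⁻¹ᵁ V i))).symm.trans ?_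
      rw [Category.assoc, pullbackSection_SpecMap_fromSpecFunctionField, Scheme.Hom.app_eq_appLE]
    rw [h1] at hx
    obtain ⟨x, rfl⟩ := hφ.2 x
    have h2 := RingHom.IsIntegralElem.of_map (g := φ.hom)
      (f := (f.app (V i) ≫ T.germToFunctionField (f ⁻¹ᵁ V i)).hom) hφ.1 hx
    -- Integrality over `Y` implies integrality over the sections of `T`, which are integrally
    -- closed in the function field.
    have h3 : _root_.IsIntegral Γ(T, f ⁻¹ᵁ V i) x := h2.of_comp (f := (f.app (V i)).hom)
    obtain ⟨y, hy⟩ := IsIntegrallyClosed.isIntegral_iff.mp h3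
    exact ⟨y, congrArg φ hy⟩

/-- Both factorizations are identified with the same normalization of `Y` in `S`, so they agree by a
unique comparison through it. -/
theorem exists_iso_of_isIso_normalizationDesc {S : Scheme.{0}} (f₁ : S ⟶ T) (f₂ : T ⟶ Y)
    (f₁' : S ⟶ T') (f₂' : T' ⟶ Y) [IsIntegralHom f₂] [IsIntegralHom f₂']
    [QuasiCompact (f₁ ≫ f₂)] [QuasiSeparated (f₁ ≫ f₂)]
    [QuasiCompact (f₁' ≫ f₂')] [QuasiSeparated (f₁' ≫ f₂')] (h : f₁ ≫ f₂ = f₁' ≫ f₂')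
    (h₁ : IsIso ((f₁ ≫ f₂).normalizationDesc f₁ f₂ rfl))
    (h₂ : IsIso ((f₁' ≫ f₂').normalizationDesc f₁' f₂' rfl)) :
    ∃ η : T ≅ T', f₁ ≫ η.hom = f₁' ∧ η.hom ≫ f₂' = f₂ := by
  have h₃ : ∀ (g : S ⟶ Y) [QuasiCompact g] [QuasiSeparated g] (h : g = f₁' ≫ f₂'),
      IsIso (g.normalizationDesc f₁' f₂' h) := by
    rintro g _ _ rfl
    exact h₂
  have := h₃ _ h
  refine ⟨(asIso ((f₁ ≫ f₂).normalizationDesc f₁ f₂ rfl)).symm ≪≫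
    asIso ((f₁ ≫ f₂).normalizationDesc f₁' f₂' h), ?_, ?_⟩
  · have := (f₁ ≫ f₂).toNormalization_normalizationDesc f₁ f₂ rfl
    simp only [Iso.trans_hom, Iso.symm_hom, asIso_inv, asIso_hom]
    rw [← Category.assoc, (IsIso.comp_inv_eq _).mpr this.symm]
    exact Scheme.Hom.toNormalization_normalizationDesc ..
  · simp only [Iso.trans_hom, Iso.symm_hom, asIso_inv, asIso_hom, Category.assoc]
    rw [IsIso.inv_comp_eq, Scheme.Hom.normalizationDesc_comp, Scheme.Hom.normalizationDesc_comp]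

/-- The morphism to a scheme from the spectrum of a stalk is a monomorphism, so the map on function
fields can be read off after composing with it. -/
theorem functionFieldMap_eq_of_comp [IrreducibleSpace T] [IrreducibleSpace T'] (f : T ⟶ T')
    [IsDominant f] (ψ : T'.functionField ⟶ T.functionField)
    (h : fromSpecFunctionField T ≫ f = Spec.map ψ ≫ fromSpecFunctionField T') :
    functionFieldMap f = ψ := by
  have h1 := SpecMap_functionFieldMap f
  change _ = fromSpecFunctionField T ≫ f at h1
  rw [h] at h1
  exact Spec.map_injective ((cancel_mono (T'.fromSpecStalk (genericPoint T'))).mp h1)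

/-- Two normal integral schemes which are integral over `Y` and have isomorphic function fields are
isomorphic. -/
theorem exists_iso_of_functionField_iso [IsIntegral T] [IsIntegral T'] [IsIntegral Y]
    [Y.IsSeparated]
    (hT : ∀ x : T, IsIntegrallyClosed (T.presheaf.stalk x))
    (hT' : ∀ x : T', IsIntegrallyClosed (T'.presheaf.stalk x)) (f : T ⟶ Y) (f' : T' ⟶ Y)
    [IsIntegralHom f] [IsDominant f] [IsIntegralHom f'] [IsDominant f']
    {ι : Type*} (V : ι → Y.Opens) (hV : ∀ i, IsAffineOpen (V i)) (hVtop : ⨆ i, V i = ⊤)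
    [∀ i, Nonempty (V i)] (ψ : T'.functionField ⟶ T.functionField) [IsIso ψ]
    (hψ : functionFieldMap f' ≫ ψ = functionFieldMap f) :
    ∃ η : T ≅ T', η.hom ≫ f' = f ∧ functionFieldMap η.hom = ψ := by
  -- Both schemes are the normalization of `Y` in the one point `Spec` of the function field of `T`;
  -- for `T'` this point is reached through `ψ`.
  have h1 := isIso_normalizationDesc_of_normal hT f (𝟙 _) V hV hVtop
  have h2 := isIso_normalizationDesc_of_normal hT' f' ψ V hV hVtop
  obtain ⟨η, h3, h4⟩ := exists_iso_of_isIso_normalizationDesc _ _ _ _ (by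
    rw [Spec.map_id, Category.id_comp, Category.assoc]
    refine (SpecMap_functionFieldMap f).symm.trans ?_
    rw [← hψ, Spec.map_comp, Category.assoc, SpecMap_functionFieldMap]
    rfl) h1 h2
  refine ⟨η, h4, functionFieldMap_eq_of_comp _ _ ?_⟩
  rw [Spec.map_id, Category.id_comp] at h3
  exact h3

end Normal

attribute [local instance] MvPolynomial.gradedAlgebra in
instance P1.isSeparated (K : Type) [Field K] : (P1 K).IsSeparated :=
  inferInstanceAs (Scheme.IsSeparated (Proj (MvPolynomial.homogeneousSubmodule (Fin 2) K)))

/-! ### Isomorphisms with twists as semilinear automorphisms of the function field. -/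

namespace BranchedCover

variable {K : Type} [Field K]

instance (C : BranchedCover K) : IsFinite C.hom := C.isFinite

theorem baseEquiv_apply (σ : K ≃+* K) (z : (P1 K).functionField) :
    baseEquiv σ z = functionFieldMap (P1.map (σ : K →+* K)) z := rfl

theorem baseEquiv_toFunctionField (σ : K ≃+* K) (i : Fin 2) (p : Polynomial K) :
    baseEquiv σ (P1.toFunctionField K i p) = P1.toFunctionField K i (p.map (σ : K →+* K)) := by
  rw [baseEquiv_apply, P1.functionFieldMap_toFunctionField]

theorem baseEquiv_mul (σ τ : K ≃+* K) (z : (P1 K).functionField) :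
    baseEquiv (σ * τ) z = baseEquiv σ (baseEquiv τ z) := by
  have h : functionFieldMap (P1.map ((σ * τ : K ≃+* K) : K →+* K)) =
      functionFieldMap (P1.map (τ : K →+* K)) ≫ functionFieldMap (P1.map (σ : K →+* K)) := by
    rw [← functionFieldMap_comp]
    congr 1
    rw [← P1.map_comp]
    rfl
  exact congrArg (fun f => f.hom z) h

theorem baseEquiv_one (z : (P1 K).functionField) : baseEquiv (1 : K ≃+* K) z = z := by
  have h : functionFieldMap (P1.map ((1 : K ≃+* K) : K →+* K)) = 𝟙 _ := by
    rw [← functionFieldMap_id]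
    congr 1
    exact P1.map_id K
  exact congrArg (fun f => f.hom z) h

theorem baseEquiv_symm (σ : K ≃+* K) (z : (P1 K).functionField) :
    baseEquiv σ.symm z = (baseEquiv σ).symm z := by
  have h : σ * σ.symm = 1 := RingEquiv.ext fun x => σ.apply_symm_apply x
  rw [RingEquiv.eq_symm_apply, ← baseEquiv_mul, h, baseEquiv_one]

/-- An automorphism of the function field of a cover which extends the action of `σ` on the function
field of the projective line. -/
def IsLift (C : BranchedCover K) (σ : K ≃+* K) (θ : C.FunctionField ≃+* C.FunctionField) : Prop :=
  ∀ z : (P1 K).functionField, θ (algebraMap _ C.FunctionField z) = algebraMap _ _ (baseEquiv σ z)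

/-- A cover is recovered from its function field by normalization, so an isomorphism of extensions
of `κ(ℙ¹)` suffices. The inverse of `θ` appears because the twist composes the structure morphism
with the action of `σ⁻¹`. -/
theorem exists_iso_of_isLift (C : BranchedCover K) (σ : K ≃+* K)
    (θ : C.FunctionField ≃+* C.FunctionField) (h : C.IsLift σ θ) :
    ∃ η : (C.twist σ).X ≅ C.X, η.hom ≫ C.hom = (C.twist σ).hom ∧
      ∀ z, pullbackFunction (C := C.twist σ) (C' := C) η z = C.twistEquiv σ (θ.symm z) := by
  have hint := (C.twist σ).isFinite
  let ψ : C.X.functionField ⟶ (C.twist σ).X.functionField := CommRingCat.ofHom θ.symm.toRingHom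
  have hψ : IsIso ψ := by
    rw [ConcreteCategory.isIso_iff_bijective]
    exact θ.symm.bijective
  obtain ⟨η, h1, h2⟩ := exists_iso_of_functionField_iso (C.twist σ).normal C.normal
    (C.twist σ).hom C.hom (P1.standardOpen K) P1.isAffineOpen_standardOpen P1.iSup_standardOpen
    ψ (by
      refine CommRingCat.hom_ext (RingHom.ext fun z => ?_)
      have h3 : θ.symm (algebraMap _ C.FunctionField z) =
          algebraMap _ C.FunctionField (baseEquiv σ.symm z) := by
        rw [RingEquiv.symm_apply_eq, h, baseEquiv_symm, RingEquiv.apply_symm_apply]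
      refine h3.trans ?_
      have h4 : functionFieldMap (C.twist σ).hom =
          functionFieldMap (P1.map (σ.symm : K →+* K)) ≫ functionFieldMap C.hom :=
        functionFieldMap_comp C.hom (P1.map (σ.symm : K →+* K))
      rw [h4]
      rfl)
  refine ⟨η, h1, fun z => ?_⟩
  exact congrArg (fun f => f.hom z) h2

theorem exists_isLift_of_iso (C : BranchedCover K) (σ : K ≃+* K) (η : (C.twist σ).X ≅ C.X)
    (h : η.hom ≫ C.hom = (C.twist σ).hom) :
    ∃ θ, C.IsLift σ θ ∧
      ∀ z, pullbackFunction (C := C.twist σ) (C' := C) η z = C.twistEquiv σ (θ.symm z) := by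
  let e : C.FunctionField ≃+* C.FunctionField :=
    (asIso (functionFieldMap η.hom)).commRingCatIsoToRingEquiv
  refine ⟨e.symm, fun z => ?_, fun z => rfl⟩
  rw [RingEquiv.symm_apply_eq]
  have h1 : functionFieldMap C.hom ≫ functionFieldMap η.hom =
      functionFieldMap (P1.map (σ.symm : K →+* K)) ≫ functionFieldMap C.hom := by
    rw [← functionFieldMap_comp, ← functionFieldMap_comp]
    congr 1
  have h2 : e (algebraMap _ C.FunctionField (baseEquiv σ z)) =
      algebraMap _ C.FunctionField (baseEquiv σ.symm (baseEquiv σ z)) :=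
    congrArg (fun f => f.hom (baseEquiv σ z)) h1
  rw [h2, baseEquiv_symm, RingEquiv.symm_apply_apply]

/-- A cover is isomorphic with its twist by `σ` if and only if the action of `σ` on the function
field of the projective line extends to the function field of the cover. -/
theorem isIsomorphic_twist_iff (C : BranchedCover K) (σ : K ≃+* K) :
    (C.twist σ).IsIsomorphic C ↔ ∃ θ, C.IsLift σ θ := by
  constructor
  · rintro ⟨η, h⟩
    obtain ⟨θ, h, -⟩ := C.exists_isLift_of_iso σ η h
    exact ⟨θ, h⟩
  · rintro ⟨θ, h⟩
    obtain ⟨η, h, -⟩ := C.exists_iso_of_isLift σ θ h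
    exact ⟨η, h⟩

end BranchedCover

/-- The analogue of `isIsomorphic_twist_iff` for Galois covers. -/
theorem GaloisCover.isIsomorphic_twist_iff {G : Type*} [Group G] (C : GaloisCover G)
    (σ : Qbar ≃ₐ[ℚ] Qbar) :
    (C.twist σ).IsIsomorphic C ↔ ∃ θ, C.toBranchedCover.IsLift (σ : Qbar ≃+* Qbar) θ ∧
      ∀ (g : G) (z : C.FunctionField), θ (C.galEquiv.symm g z) = C.galEquiv.symm g (θ z) := by
  have key : ∀ θ : C.FunctionField ≃+* C.FunctionField,
      (∀ (g : G) (z : C.FunctionField), θ (C.galEquiv.symm g z) = C.galEquiv.symm g (θ z)) ↔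
      ∀ (g : G) (z : C.FunctionField),
        θ.symm (C.galEquiv.symm g z) = C.galEquiv.symm g (θ.symm z) := by
    intro θ
    constructor
    · intro h g z
      rw [RingEquiv.symm_apply_eq, h, RingEquiv.apply_symm_apply]
    · intro h g z
      rw [← RingEquiv.eq_symm_apply, h, RingEquiv.symm_apply_apply]
  constructor
  · rintro ⟨η, h, h'⟩
    obtain ⟨θ, h1, h2⟩ := C.toBranchedCover.exists_isLift_of_iso (σ : Qbar ≃+* Qbar) η h
    refine ⟨θ, h1, (key θ).mpr fun g z => ?_⟩
    exact (h2 _).symm.trans ((h' g z).trans (congrArg ((C.twist σ).galEquiv.symm g) (h2 z)))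
  · rintro ⟨θ, h, h'⟩
    obtain ⟨η, h1, h2⟩ := C.toBranchedCover.exists_iso_of_isLift (σ : Qbar ≃+* Qbar) θ h
    refine ⟨η, h1, fun g z => ?_⟩
    exact (h2 _).trans (((key θ).mp h' g z).trans
      (congrArg ((C.twist σ).galEquiv.symm g) (h2 z)).symm)

/-! ### Galois descent for vector spaces with a smooth semilinear action. -/

section GaloisDescent

variable {k K V : Type*} [Field k] [Field K] [Algebra k K] [IsGalois k K] [AddCommGroup V]
  [Module K V] (act : (K ≃ₐ[k] K) → V →+ V)

/-- The vectors fixed by a semilinear Galois action span the space. -/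
theorem span_fixed_eq_top (hmul : ∀ σ τ v, act (σ * τ) v = act σ (act τ v))
    (hsmul : ∀ σ (a : K) v, act σ (a • v) = σ a • act σ v)
    (hsmooth : ∀ v, ∃ s : Finset K, ∀ σ : K ≃ₐ[k] K, (∀ a ∈ s, σ a = a) → act σ v = v) :
    Submodule.span K {w : V | ∀ σ, act σ w = w} = ⊤ := by
  classical
  rw [eq_top_iff]
  rintro v -
  by_contra hv
  obtain ⟨s, hs⟩ := hsmooth v
  -- A finite Galois extension whose fixing group leaves `v` invariant; all sums can then be taken
  -- over the finite group of `F`.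
  let F := FiniteGaloisIntermediateField.adjoin k (s : Set K)
  have hsF : ∀ a ∈ s, a ∈ F.toIntermediateField := fun a ha =>
    FiniteGaloisIntermediateField.subset_adjoin k (s : Set K) ha
  -- If `v` were outside the span, a linear form `l` would kill the span but not `v`. It kills every
  -- trace of `e • v` with `e ∈ F`, and Dedekind's independence of the embeddings of `F` into `K`
  -- then forces `l v = 0`.
  obtain ⟨l, hlv, hl⟩ := Submodule.exists_le_ker_of_notMem hv
  let lift : (F ≃ₐ[k] F) → (K ≃ₐ[k] K) := fun τ => τ.liftNormal K
  have hlift : ∀ τ (e : F), lift τ e = (τ e : K) := fun τ e => τ.liftNormal_commutes K e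
  have hact : ∀ σ σ' : K ≃ₐ[k] K, (∀ e : F, σ e = σ' e) → ∀ e : F,
      act σ ((e : K) • v) = act σ' ((e : K) • v) := by
    intro σ σ' h e
    have h1 : act (σ'⁻¹ * σ) v = v := hs _ fun a ha => by
      have := h ⟨a, hsF a ha⟩
      rw [AlgEquiv.mul_apply]
      dsimp only at this
      rw [this]
      exact σ'.symm_apply_apply a
    have h2 : act σ v = act σ' v := by
      conv_rhs => rw [← h1]
      rw [← hmul, mul_inv_cancel_left]
    rw [hsmul, hsmul, h, h2]
  have hfix : ∀ e : F, ∑ τ : F ≃ₐ[k] F, act (lift τ) ((e : K) • v) ∈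
      Submodule.span K {w : V | ∀ σ, act σ w = w} := by
    intro e
    refine Submodule.subset_span fun σ => ?_
    rw [map_sum]
    refine Fintype.sum_equiv (Equiv.mulLeft (AlgEquiv.restrictNormal σ F)) _ _ fun τ => ?_
    rw [← hmul]
    refine hact _ _ (fun x => ?_) e
    rw [AlgEquiv.mul_apply, hlift, hlift, Equiv.coe_mulLeft, AlgEquiv.mul_apply]
    exact (AlgEquiv.restrictNormal_commutes σ F (τ x)).symm
  have hzero : ∀ e : F, ∑ τ : F ≃ₐ[k] F, l (act (lift τ) v) * (τ e : K) = 0 := by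
    intro e
    have := hl (hfix e)
    rw [LinearMap.mem_ker, map_sum] at this
    rw [← this]
    refine Finset.sum_congr rfl fun τ _ => ?_
    rw [hsmul, map_smul, hlift, smul_eq_mul, mul_comm]
  have hind := linearIndependent_monoidHom F K
  let c : (F ≃ₐ[k] F) → (F →* K) := fun τ =>
    ((algebraMap F K).comp (τ : F →+* F) : F →+* K)
  have hc : Function.Injective c := fun τ τ' h => by
    ext e
    exact congrArg (fun f => f e) h
  have hind' := hind.comp c hc
  rw [Fintype.linearIndependent_iff] at hind'
  have h2 := hind' (fun τ => l (act (lift τ) v)) (by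
    ext e
    simp only [Finset.sum_apply, Pi.smul_apply, smul_eq_mul, Pi.zero_apply]
    exact hzero e) 1
  refine hlv ?_
  rwa [hs (lift 1) fun a ha => (hlift 1 ⟨a, hsF a ha⟩)] at h2

/-- Vectors fixed by a semilinear action which are linearly independent over the fixed field are
linearly independent. -/
theorem linearIndependent_of_fixed {k K V Γ : Type*} [Field k] [Field K] [Algebra k K]
    [AddCommGroup V] [Module K V] [Module k V] [IsScalarTower k K V] (s : Γ → K →+* K)
    (hs : ∀ a : K, (∀ σ, s σ a = a) → ∃ c, algebraMap k K c = a) (act : Γ → V →+ V)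
    (hsmul : ∀ σ (a : K) v, act σ (a • v) = s σ a • act σ v) {ι : Type*} (v : ι → V)
    (hfix : ∀ i σ, act σ (v i) = v i) (hv : LinearIndependent k v) : LinearIndependent K v := by
  classical
  rw [linearIndependent_iff'] at hv ⊢
  intro t
  induction t using Finset.induction_on with
  | empty => simp
  | insert j t hj ih =>
    intro g hg
    have hgj : g j = 0 := by
      by_contra hne
      -- Normalize the relation to have coefficient `1` at `j` and subtract it from its image under
      -- `σ`. The term at `j` cancels, so by induction all ratios are fixed, and hence come from
      -- `k`.
      have h1 : ∀ σ, ∀ i ∈ t, s σ (g i / g j) - g i / g j = 0 := by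
        intro σ
        refine ih (fun i => s σ (g i / g j) - g i / g j) ?_
        have h2 : ∑ i ∈ insert j t, (g i / g j) • v i = 0 := by
          have := congrArg (fun w => (g j)⁻¹ • w) hg
          simp only [Finset.smul_sum, smul_smul, smul_zero] at this
          rw [← this]
          exact Finset.sum_congr rfl fun i _ => by rw [div_eq_inv_mul]
        have h3 : ∑ i ∈ insert j t, (s σ (g i / g j)) • v i = 0 := by
          have := congrArg (act σ) h2
          rw [map_sum, map_zero] at this
          rw [← this]
          exact Finset.sum_congr rfl fun i _ => by rw [hsmul, hfix]
        rw [Finset.sum_insert hj, div_self hne] at h2 h3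
        rw [map_one] at h3
        simp only [sub_smul, Finset.sum_sub_distrib]
        rw [← sub_eq_zero.mpr (h3.trans h2.symm)]
        abel
      have h4 : ∀ i ∈ t, ∃ c : k, algebraMap k K c = g i / g j := fun i hi =>
        hs _ fun σ => sub_eq_zero.mp (h1 σ i hi)
      choose! c hc using h4
      have h5 := hv (insert j t) (fun i => if i = j then 1 else c i) (by
        have := congrArg (fun w => (g j)⁻¹ • w) hg
        simp only [Finset.smul_sum, smul_smul, smul_zero] at this
        rw [← this]
        refine Finset.sum_congr rfl fun i hi => ?_
        split_ifs with hij
        · rw [hij, inv_mul_cancel₀ hne, one_smul, one_smul]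
        · rw [← div_eq_inv_mul, ← hc i ((Finset.mem_insert.mp hi).resolve_left hij),
            algebraMap_smul]) j (Finset.mem_insert_self j t)
      simp at h5
    rw [Finset.sum_insert hj, hgj, zero_smul, zero_add] at hg
    intro i hi
    rcases Finset.mem_insert.mp hi with rfl | hi
    · exact hgj
    · exact ih g hg i hi

/-- **Galois descent** for vector spaces. -/
theorem isBaseChange_of_fixed [Module k V] [IsScalarTower k K V]
    (hmul : ∀ σ τ v, act (σ * τ) v = act σ (act τ v))
    (hsmul : ∀ σ (a : K) v, act σ (a • v) = σ a • act σ v)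
    (hsmooth : ∀ v, ∃ s : Finset K, ∀ σ : K ≃ₐ[k] K, (∀ a ∈ s, σ a = a) → act σ v = v)
    {W : Type*} [AddCommGroup W] [Module k W] (f : W →ₗ[k] V) (hf : Function.Injective f)
    (hrange : ∀ v, (∃ w, f w = v) ↔ ∀ σ, act σ v = v) : IsBaseChange K f := by
  let b := Module.Basis.ofVectorSpace k W
  have hb : LinearIndependent k (f ∘ b) := b.linearIndependent.map' f (LinearMap.ker_eq_bot.mpr hf)
  have hb' := linearIndependent_of_fixed (fun σ : K ≃ₐ[k] K => (σ : K →+* K))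
    (fun a h => (InfiniteGalois.mem_range_algebraMap_iff_fixed _).mpr h) act hsmul (f ∘ b)
    (fun i => (hrange _).mp ⟨b i, rfl⟩) hb
  -- A `k`-basis of `W` is thus a `K`-basis of `V`: it is independent because its images are fixed,
  -- and it spans because the fixed vectors do.
  have hspan : ⊤ ≤ Submodule.span K (Set.range (f ∘ b)) := by
    rw [← span_fixed_eq_top act hmul hsmul hsmooth, Submodule.span_le]
    intro v hv
    obtain ⟨w, rfl⟩ := (hrange v).mpr hv
    have h1 : w ∈ Submodule.span k (Set.range b) := b.span_eq ▸ Submodule.mem_top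
    have h2 : f w ∈ Submodule.span k (Set.range (f ∘ b)) := by
      rw [Set.range_comp, ← Submodule.map_span]
      exact Submodule.mem_map_of_mem h1
    exact Submodule.span_le_restrictScalars k K _ h2
  let b' := Module.Basis.mk hb' hspan
  refine IsBaseChange.of_equiv ((b.baseChange K).equiv b' (Equiv.refl _)) fun w => ?_
  have h3 : (((b.baseChange K).equiv b' (Equiv.refl _)).toLinearMap.restrictScalars k).comp
      (TensorProduct.mk k K W 1) = f := by
    refine b.ext fun i => ?_
    have h4 : TensorProduct.mk k K W 1 (b i) = b.baseChange K i := by simp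
    rw [LinearMap.comp_apply, h4]
    exact (((b.baseChange K).equiv_apply i b' (Equiv.refl _)).trans
      (Module.Basis.mk_apply hb' hspan i))
  exact congrArg (fun g => g w) h3

end GaloisDescent

/-! ### Integral closures and the existence of covers with given function field. -/

section IntegralClosureOfFiniteExtension

theorem IsIntegralClosure.isIntegrallyClosed_of_isFractionRing {A B Φ : Type*} [CommRing A]
    [CommRing B] [Field Φ] [Algebra A B] [Algebra B Φ] [Algebra A Φ] [IsScalarTower A B Φ]
    [IsIntegralClosure B A Φ] [IsFractionRing B Φ] : IsIntegrallyClosed B := by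
  refine (isIntegrallyClosed_iff Φ).mpr fun {x} hx => ?_
  have : Algebra.IsIntegral A B := IsIntegralClosure.isIntegral_algebra A Φ
  exact IsIntegralClosure.isIntegral_iff.mp (isIntegral_trans (R := A) x hx)

/-- The integral closure in a finite extension of characteristic zero is generically étale. -/
theorem IsIntegralClosure.exists_etale (A κ B Φ : Type*) [CommRing A] [IsDomain A]
    [IsIntegrallyClosed A] [IsNoetherianRing A] [Field κ] [Algebra A κ] [IsFractionRing A κ]
    [CommRing B] [Field Φ] [CharZero Φ] [Algebra A B] [Algebra B Φ] [Algebra A Φ] [Algebra κ Φ]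
    [IsScalarTower A B Φ] [IsScalarTower A κ Φ] [FiniteDimensional κ Φ] [IsIntegralClosure B A Φ] :
    ∃ b : B, b ≠ 0 ∧ Algebra.Etale A (Localization.Away b) := by
  have hinj : Function.Injective (algebraMap B Φ) := IsIntegralClosure.algebraMap_injective B A Φ
  have : IsDomain B := hinj.isDomain
  have : CharZero κ := (algebraMap κ Φ).charZero
  have : Module.Finite A B := IsIntegralClosure.finite A κ Φ B
  have : Algebra.FinitePresentation A B :=
    Algebra.FinitePresentation.of_finiteType.mp inferInstance
  have : IsFractionRing B Φ := IsIntegralClosure.isFractionRing_of_finite_extension A κ Φ B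
  have hbot : (⊥ : Ideal B).IsPrime := Ideal.isPrime_bot
  -- The generic point is étale: `κ` is a localization of `A`, and `Φ` is separable over `κ`. Since
  -- `Φ` is the local ring of `B` at the zero ideal and `B` is of finite presentation, étaleness
  -- spreads to a basic open.
  have h1 : Algebra.FormallyEtale A κ := Algebra.FormallyEtale.of_isLocalization (nonZeroDivisors A)
  have h2 : Algebra.FormallyEtale κ Φ := Algebra.FormallyEtale.of_isSeparable κ Φ
  have h3 : Algebra.FormallyEtale A Φ := Algebra.FormallyEtale.comp A κ Φ
  have h4 : IsLocalization.AtPrime Φ (⊥ : Ideal B) := by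
    have : (⊥ : Ideal B).primeCompl = nonZeroDivisors B := by
      ext x
      simp [Ideal.primeCompl]
    rw [IsLocalization.AtPrime, this]
    infer_instance
  have h5 : Algebra.IsEtaleAt A (⊥ : Ideal B) :=
    Algebra.FormallyEtale.of_equiv
      ((IsLocalization.algEquiv (⊥ : Ideal B).primeCompl Φ
        (Localization.AtPrime (⊥ : Ideal B))).restrictScalars A)
  obtain ⟨f, hf, h⟩ := Algebra.exists_etale_of_isEtaleAt (R := A) (⊥ : Ideal B)
  exact ⟨f, by simpa using hf, h⟩

end IntegralClosureOfFiniteExtension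

section NormalizationOfPoint

variable {L : CommRingCat.{0}} {Y : Scheme.{0}}

theorem top_le_toNormalization_preimage (g : Spec L ⟶ Y) [QuasiCompact g] [QuasiSeparated g]
    (V : Y.Opens) (h : ⊤ ≤ g ⁻¹ᵁ V) : ⊤ ≤ g.toNormalization ⁻¹ᵁ g.fromNormalization ⁻¹ᵁ V := by
  rw [← Scheme.Hom.comp_preimage, g.toNormalization_fromNormalization]
  exact h

/-- Describes the normalization in a point by rings: its sections over an affine `V` are identified,
inside the ring `L`, with the elements integral over the sections of `V`. -/
theorem pullbackSection_toNormalization (g : Spec L ⟶ Y) [QuasiCompact g] [QuasiSeparated g]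
    (V : Y.Opens) (hV : IsAffineOpen V) (h : ⊤ ≤ g ⁻¹ᵁ V) :
    Function.Injective (pullbackSection g.toNormalization (g.fromNormalization ⁻¹ᵁ V)
      (top_le_toNormalization_preimage g V h)) ∧
    ∀ x, (pullbackSection g V h).hom.IsIntegralElem x ↔
      ∃ y, pullbackSection g.toNormalization (g.fromNormalization ⁻¹ᵁ V)
        (top_le_toNormalization_preimage g V h) y = x := by
  let := (g.app V).hom.toAlgebra
  have hle : g ⁻¹ᵁ V ≤ g.toNormalization ⁻¹ᵁ g.fromNormalization ⁻¹ᵁ V := by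
    simp [← Scheme.Hom.comp_preimage]
  let ρ := (Spec L).presheaf.map (homOfLE h).op ≫ (Scheme.ΓSpecIso L).hom
  have hρ : IsIso ρ := by
    have : IsIso (homOfLE h) := ⟨homOfLE le_top, rfl, rfl⟩
    infer_instance
  have hρ' := ConcreteCategory.bijective_of_isIso ρ
  have h1 : pullbackSection g.toNormalization (g.fromNormalization ⁻¹ᵁ V)
      (top_le_toNormalization_preimage g V h) = (g.normalizationObjIso hV).hom ≫
        CommRingCat.ofHom (Subalgebra.val _).toRingHom ≫ ρ := by
    rw [← Category.assoc, g.normalizationObjIso_hom_val hV]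
    unfold pullbackSection
    simp only [ρ]
    rw [Scheme.Hom.appLE_map_assoc]
  have h2 : pullbackSection g V h = g.app V ≫ ρ := rfl
  have h3 := ConcreteCategory.bijective_of_isIso (g.normalizationObjIso hV).hom
  rw [h1, h2]
  refine ⟨hρ'.1.comp (Subtype.val_injective.comp h3.1), fun x => ⟨fun hx => ?_, ?_⟩⟩
  · obtain ⟨x, rfl⟩ := hρ'.2 x
    have h4 : (g.app V).hom.IsIntegralElem x := RingHom.IsIntegralElem.of_map hρ'.1 hx
    obtain ⟨y, hy⟩ := h3.2 ⟨x, h4⟩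
    refine ⟨y, ?_⟩
    exact congrArg ρ (congrArg Subtype.val hy)
  · rintro ⟨y, rfl⟩
    exact RingHom.IsIntegralElem.map ((g.normalizationObjIso hV).hom y).2 ρ.hom

end NormalizationOfPoint

theorem Etale.of_appLE {X Y : Scheme.{0}} (f : X ⟶ Y) (V : Y.Opens) (hV : IsAffineOpen V)
    (U : X.Opens) (hU : IsAffineOpen U) (h : U ≤ f ⁻¹ᵁ V) (hf : (f.appLE V U h).hom.Etale) :
    Etale (U.ι ≫ f) := by
  refine (HasRingHomProperty.iff_exists_appLE (P := @Etale)
    (RingHom.Etale.stableUnderComposition.stableUnderCompositionWithLocalizationAway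
      (RingHom.Etale.propertyIsLocal.HoldsForLocalizationAway
        RingHom.Etale.containsIdentities)).1).mpr fun x => ?_
  have hle : (⊤ : U.toScheme.Opens) ≤ U.ι ⁻¹ᵁ U := by simp
  refine ⟨⟨V, hV⟩, ⟨⊤, ?_⟩, trivial, hle.trans (U.ι.preimage_mono h), ?_⟩
  · have : IsAffine U := hU
    exact isAffineOpen_top _
  · rw [← Scheme.Hom.appLE_comp_appLE U.ι f V U ⊤ h hle]
    have : IsIso (U.ι.appLE U ⊤ hle) := by
      rw [Scheme.Opens.ι_appLE]
      exact inferInstanceAs (IsIso U.topIso.inv)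
    exact (RingHom.Etale.respectsIso.cancel_right_isIso _ _).mpr hf

/-- All that is needed, in one affine chart, for the normalization of the line in a finite extension
to be a branched cover. Ring homomorphisms replace algebra structures so that the result applies
directly to rings of sections. -/
theorem RingHom.integralClosure_of_finite {A κ B Φ : Type*} [CommRing A] [IsDomain A]
    [IsIntegrallyClosed A] [IsNoetherianRing A] [Field κ] [Algebra A κ] [IsFractionRing A κ]
    [CommRing B] [Field Φ] [CharZero Φ] (a : A →+* B) (β : B →+* Φ) (b : κ →+* Φ) (hb : b.Finite)
    (h : β.comp a = b.comp (algebraMap A κ)) (hβ : Function.Injective β)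
    (hint : ∀ x, (β.comp a).IsIntegralElem x ↔ ∃ y, β y = x) :
    a.Finite ∧ IsIntegrallyClosed B ∧ @IsFractionRing B _ Φ _ β.toAlgebra ∧
      ∃ s : B, s ≠ 0 ∧ ((algebraMap B (Localization.Away s)).comp a).Etale := by
  let := a.toAlgebra
  let := β.toAlgebra
  let := b.toAlgebra
  let := (β.comp a).toAlgebra
  have : IsScalarTower A B Φ := .of_algebraMap_eq fun _ => rfl
  have : IsScalarTower A κ Φ := .of_algebraMap_eq fun x => congrArg (fun f => f x) h
  have : FiniteDimensional κ Φ := hb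
  have : IsIntegralClosure B A Φ := ⟨hβ, fun {x} => hint x⟩
  have : CharZero κ := b.charZero
  have : IsDomain B := hβ.isDomain
  have : IsFractionRing B Φ := IsIntegralClosure.isFractionRing_of_finite_extension A κ Φ B
  refine ⟨IsIntegralClosure.finite A κ Φ B,
    IsIntegralClosure.isIntegrallyClosed_of_isFractionRing (A := A) (Φ := Φ), this, ?_⟩
  obtain ⟨s, hs, h⟩ := IsIntegralClosure.exists_etale A κ B Φ
  exact ⟨s, hs, RingHom.etale_algebraMap.mpr h⟩

namespace BranchedCover

variable {k : Type} [Field k]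

instance (i : Fin 2) : IsNoetherianRing Γ(P1 k, P1.standardOpen k i) :=
  isNoetherianRing_of_ringEquiv _ (P1.chart k i)

instance (i : Fin 2) : IsIntegrallyClosed Γ(P1 k, P1.standardOpen k i) :=
  IsIntegrallyClosed.of_equiv (P1.chart k i)

/-- Every finite extension of the function field of the projective line is the function field of a
branched cover. -/
theorem exists_functionField_equiv {Φ : Type} [Field Φ] [CharZero Φ]
    (b : (P1 k).functionField →+* Φ) (hb : b.Finite) :
    ∃ (D : BranchedCover k) (e : D.FunctionField ≃+* Φ), ∀ z, e (algebraMap _ _ z) = b z := by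
  let L : CommRingCat.{0} := CommRingCat.of Φ
  let β : (P1 k).functionField ⟶ L := CommRingCat.ofHom b
  -- The cover is the normalization of the line in the point `Spec Φ`.
  let g : Spec L ⟶ P1 k := Spec.map β ≫ fromSpecFunctionField (P1 k)
  let W (i : Fin 2) := g.fromNormalization ⁻¹ᵁ P1.standardOpen k i
  have hWtop : ⨆ i, W i = ⊤ := by
    simp only [W, ← Scheme.Hom.preimage_iSup]
    rw [P1.iSup_standardOpen]
    rfl
  have hW (i : Fin 2) : IsAffineOpen (W i) :=
    (P1.isAffineOpen_standardOpen i).preimage g.fromNormalization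
  have hg (i : Fin 2) : ⊤ ≤ g ⁻¹ᵁ P1.standardOpen k i :=
    top_le_SpecMap_fromSpecFunctionField_preimage β _
  have hs (i : Fin 2) := pullbackSection_toNormalization g _ (P1.isAffineOpen_standardOpen i) (hg i)
  have hcomp (i : Fin 2) : g.fromNormalization.appLE (P1.standardOpen k i) (W i) le_rfl ≫
      pullbackSection g.toNormalization (W i) (top_le_toNormalization_preimage g _ (hg i)) =
      pullbackSection g (P1.standardOpen k i) (hg i) := by
    rw [appLE_pullbackSection]
    congr 1
    exact g.toNormalization_fromNormalization
  have hgerm (i : Fin 2) : pullbackSection g (P1.standardOpen k i) (hg i) =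
      (P1 k).germToFunctionField _ ≫ β := pullbackSection_SpecMap_fromSpecFunctionField _ _
  have hne (i : Fin 2) : Nonempty (W i) := by
    have : Nonempty (Spec L) := inferInstance
    obtain ⟨x⟩ := this
    exact ⟨⟨g.toNormalization x, top_le_toNormalization_preimage g _ (hg i) (Set.mem_univ x)⟩⟩
  have hint : IsIntegral g.normalization := inferInstance
  have hfr (i : Fin 2) := functionField_isFractionRing_of_isAffineOpen (P1 k)
    (P1.standardOpen k i) (P1.isAffineOpen_standardOpen i)
  have key (i : Fin 2) := RingHom.integralClosure_of_finite
    (g.fromNormalization.appLE (P1.standardOpen k i) (W i) le_rfl).hom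
    (pullbackSection g.toNormalization (W i) (top_le_toNormalization_preimage g _ (hg i))).hom
    b hb (congrArg CommRingCat.Hom.hom ((hcomp i).trans (hgerm i))) (hs i).1 (fun x => by
      rw [← (hs i).2, ← hcomp]
      rfl)
  have hdom : IsDominant g.fromNormalization := by
    refine isDominant_of_appLE_injective _ (P1.standardOpen k 0) (P1.isAffineOpen_standardOpen 0)
      (W 0) le_rfl fun s t hst => ?_
    have h1 := congrArg (pullbackSection g.toNormalization (W 0)
      (top_le_toNormalization_preimage g _ (hg 0))).hom hst
    have h2 := fun s => congrArg (fun f => f.hom s) ((hcomp 0).trans (hgerm 0))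
    exact (P1 k).germToFunctionField_injective _ (b.injective ((h2 s).symm.trans (h1.trans (h2 t))))
  let D : BranchedCover k :=
    { X := g.normalization
      hom := g.fromNormalization
      isIntegral := hint
      normal := by
        intro x
        obtain ⟨i, hx⟩ := TopologicalSpace.Opens.mem_iSup.mp (hWtop.ge (Set.mem_univ x))
        have := (key i).2.1
        let := TopCat.Presheaf.algebra_section_stalk g.normalization.presheaf (⟨x, hx⟩ : W i)
        have h1 := (hW i).isLocalization_stalk ⟨x, hx⟩
        exact isIntegrallyClosed_of_isLocalization _ _
          (Ideal.primeCompl_le_nonZeroDivisors ((hW i).primeIdealOf ⟨x, hx⟩).asIdeal)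
      isFinite := by
        refine (IsFinite.iff_isIntegralHom_and_locallyOfFiniteType _).mpr ⟨inferInstance, ?_⟩
        refine (HasRingHomProperty.iff_exists_appLE (P := @LocallyOfFiniteType)
          (RingHom.finiteType_stableUnderComposition.stableUnderCompositionWithLocalizationAway
            RingHom.finiteType_holdsForLocalizationAway).1).mpr fun x => ?_
        obtain ⟨i, hx⟩ := TopologicalSpace.Opens.mem_iSup.mp (hWtop.ge (Set.mem_univ x))
        exact ⟨⟨_, P1.isAffineOpen_standardOpen i⟩, ⟨W i, hW i⟩, hx, le_rfl, (key i).1.finiteType⟩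
      isDominant := hdom
      genericallyEtale := by
        obtain ⟨s, hs, h⟩ := (key 0).2.2.2
        refine ⟨g.normalization.basicOpen s, ?_, ?_⟩
        · refine (g.normalization.basicOpen s).isOpen.dense ?_
          refine (TopologicalSpace.Opens.ne_bot_iff_nonempty _).mp fun h0 => hs ?_
          exact (basicOpen_eq_bot_iff _).mp h0
        · refine Etale.of_appLE _ _ (P1.isAffineOpen_standardOpen 0) _ ((hW 0).basicOpen s)
            (g.normalization.basicOpen_le s) ?_
          have h1 := (hW 0).isLocalization_basicOpen s
          let e := IsLocalization.algEquiv (Submonoid.powers s) (Localization.Away s)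
            Γ(g.normalization, g.normalization.basicOpen s)
          have h2 := RingHom.Etale.respectsIso.1 _ e.toRingEquiv h
          convert! h2 using 1
          rw [← RingHom.comp_assoc]
          have h3 : e.toRingEquiv.toRingHom.comp (algebraMap Γ(g.normalization, W 0)
            (Localization.Away s)) = algebraMap _ _ := e.toAlgHom.comp_algebraMap
          refine Eq.trans ?_ (congrArg (fun f => RingHom.comp f _) h3.symm)
          exact congrArg CommRingCat.Hom.hom
            (Scheme.Hom.appLE_map g.fromNormalization (U := P1.standardOpen k 0) (V := W 0) le_rfl
              (homOfLE (g.normalization.basicOpen_le s)).op).symm }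
  have := functionField_isFractionRing_of_isAffineOpen g.normalization (W 0) (hW 0)
  let := (pullbackSection g.toNormalization (W 0)
    (top_le_toNormalization_preimage g _ (hg 0))).hom.toAlgebra
  have h1 := (key 0).2.2.1
  let e : g.normalization.functionField ≃ₐ[Γ(g.normalization, W 0)] Φ := IsLocalization.algEquiv
    (nonZeroDivisors Γ(g.normalization, W 0)) g.normalization.functionField Φ
  have h2 : e.toRingEquiv.toRingHom.comp (functionFieldMap g.fromNormalization).hom = b := by
    have := hfr 0
    refine IsLocalization.ringHom_ext (nonZeroDivisors Γ(P1 k, P1.standardOpen k 0))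
      (RingHom.ext fun s => ?_)
    have h3 := functionFieldMap_germToFunctionField g.fromNormalization (P1.standardOpen k 0) (W 0)
      le_rfl s
    refine (congrArg e h3).trans ((e.commutes _).trans ?_)
    exact congrArg (fun f => f.hom s) ((hcomp 0).trans (hgerm 0))
  exact ⟨D, e.toRingEquiv, fun z => congrArg (fun f => f z) h2⟩

end BranchedCover

/-- Galois descent for a base change of rings which maps to a field with a semilinear Galois
action. -/
theorem bijOn_of_isPushout_of_fixed {k K B Γ Φ : Type} [Field k] [Field K] [Algebra k K]
    [IsGalois k K] [CommRing B] [CommRing Γ] [Field Φ] (κB : k →+* B) (κΓ : K →+* Γ) (u : B →+* Γ)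
    (hpush : IsPushout (CommRingCat.ofHom (algebraMap k K)) (CommRingCat.ofHom κB)
      (CommRingCat.ofHom κΓ) (CommRingCat.ofHom u)) (w : Γ →+* Φ)
    (θ : (K ≃ₐ[k] K) → Φ ≃+* Φ) (hmul : ∀ σ τ x, θ (σ * τ) x = θ σ (θ τ x))
    (hθ : ∀ σ a, θ σ (w (κΓ a)) = w (κΓ (σ a)))
    (hsmooth : ∀ x, ∃ s : Finset K, ∀ σ : K ≃ₐ[k] K, (∀ a ∈ s, σ a = a) → θ σ x = x)
    (R : Subring Φ) (hR : ∀ a, w (κΓ a) ∈ R) (hRθ : ∀ σ, ∀ x ∈ R, θ σ x ∈ R)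
    (hinj : Function.Injective (w.comp u))
    (hfix : ∀ x, (∃ b, w (u b) = x) ↔ x ∈ R ∧ ∀ σ, θ σ x = x) :
    Function.Injective w ∧ ∀ x ∈ R, ∃ y, w y = x := by
  let := κB.toAlgebra
  let := κΓ.toAlgebra
  let := u.toAlgebra
  let := (κΓ.comp (algebraMap k K)).toAlgebra
  let := w.toAlgebra
  let := (w.comp κΓ).toAlgebra
  let := ((w.comp κΓ).comp (algebraMap k K)).toAlgebra
  have : IsScalarTower k K Γ := .of_algebraMap_eq fun _ => rfl
  have : IsScalarTower k K Φ := .of_algebraMap_eq fun _ => rfl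
  have : IsScalarTower K Γ Φ := .of_algebraMap_eq fun _ => rfl
  have : IsScalarTower k B Γ := .of_algebraMap_eq fun x => congrArg (fun f => f.hom x) hpush.w
  have h1 : Algebra.IsPushout k K B Γ := CommRingCat.isPushout_iff_isPushout.mp hpush
  -- Descent applied to `R` with its semilinear action: the fixed elements are the image of `B`, so
  -- `R` is the base change of `B`. Since `Γ` is also this base change, by the pushout square, `w`
  -- identifies `Γ` with `R`.
  let R' : Subalgebra K Φ := { R with algebraMap_mem' := hR }
  let act : (K ≃ₐ[k] K) → R' →+ R' := fun σ =>
    { toFun := fun x => ⟨θ σ x, hRθ σ x x.2⟩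
      map_zero' := Subtype.ext (map_zero _)
      map_add' := fun x y => Subtype.ext (map_add _ _ _) }
  have hwu : ∀ b, w (u b) ∈ R := fun b => ((hfix _).mp ⟨b, rfl⟩).1
  let f : B →ₗ[k] R' :=
    { toFun := fun b => ⟨w (u b), hwu b⟩
      map_add' := fun x y => Subtype.ext (by simp)
      map_smul' := fun a x => Subtype.ext (by
        change w (u (κB a * x)) = w (κΓ (algebraMap k K a)) * w (u x)
        rw [map_mul, map_mul]
        congr 2
        exact (congrArg (fun f => f.hom a) hpush.w).symm) }
  have h2 : IsBaseChange K f := by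
    refine isBaseChange_of_fixed act (fun σ τ v => Subtype.ext (hmul σ τ v)) (fun σ a v => ?_)
      (fun v => ?_) f (fun x y h => hinj (congrArg Subtype.val h)) fun v => ?_
    · refine Subtype.ext ?_
      change θ σ (w (κΓ a) * v) = w (κΓ (σ a)) * θ σ v
      rw [map_mul, hθ]
    · obtain ⟨s, hs⟩ := hsmooth v
      exact ⟨s, fun σ h => Subtype.ext (hs σ h)⟩
    · have h3 := hfix v
      constructor
      · rintro ⟨b, rfl⟩ σ
        exact Subtype.ext ((h3.mp ⟨b, rfl⟩).2 σ)
      · intro h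
        obtain ⟨b, hb⟩ := h3.mpr ⟨v.2, fun σ => congrArg Subtype.val (h σ)⟩
        exact ⟨b, Subtype.ext hb⟩
  let e : Γ ≃ₗ[K] R' := h1.out.equiv.symm ≪≫ₗ h2.equiv
  have h4 : ((IsScalarTower.toAlgHom K Γ Φ).toLinearMap) = R'.val.toLinearMap ∘ₗ e.toLinearMap := by
    refine h1.out.algHom_ext _ _ fun b => ?_
    change w (u b) = (h2.equiv (h1.out.equiv.symm (IsScalarTower.toAlgHom k B Γ b)) : Φ)
    have h5 := h1.out.equiv_symm_apply b
    rw [AlgHom.toLinearMap_apply] at h5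
    rw [h5, h2.equiv_tmul, one_smul]
    rfl
  have h5 : ∀ y, w y = e y := fun y => congrArg (fun f => f y) h4
  refine ⟨fun x y h => e.injective (Subtype.ext ?_), fun x hx => ?_⟩
  · rwa [← h5, ← h5]
  · obtain ⟨y, hy⟩ := e.surjective ⟨x, hx⟩
    exact ⟨y, by rw [h5, hy]⟩

/-! ### Descent of covers along a Galois extension of constants. -/

namespace BranchedCover

section Sections

variable {K : Type} [Field K] (C : BranchedCover K) (i : Fin 2)

/-- Polynomials as functions on the cover, for each of the two coordinates of the line. -/
noncomputable def polynomialFunction : Polynomial K →+* C.FunctionField :=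
  (algebraMap (P1 K).functionField C.FunctionField).comp (P1.toFunctionField K i)

instance : Nonempty (C.hom ⁻¹ᵁ P1.standardOpen K i) := IsDominant.nonempty_preimage _ _

theorem isAffineOpen_preimage : IsAffineOpen (C.hom ⁻¹ᵁ P1.standardOpen K i) :=
  (P1.isAffineOpen_standardOpen i).preimage C.hom

/-- The functions on the preimage of a standard affine open subset of the projective line. -/
noncomputable def germ : Γ(C.X, C.hom ⁻¹ᵁ P1.standardOpen K i) →+* C.FunctionField :=
  (C.X.germToFunctionField (C.hom ⁻¹ᵁ P1.standardOpen K i)).hom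

theorem germ_injective : Function.Injective (C.germ i) := C.X.germToFunctionField_injective _

theorem germ_chart (p : Polynomial K) :
    C.germ i (C.hom.appLE _ _ le_rfl (P1.chart K i p)) = C.polynomialFunction i p :=
  (functionFieldMap_germToFunctionField C.hom _ _ le_rfl _).symm

/-- The preimage of a chart is finite over the chart, which gives one direction. Its ring is
integrally closed with fraction field the whole function field, which gives the other. -/
theorem exists_germ_eq_iff (y : C.FunctionField) :
    (∃ b, C.germ i b = y) ↔ (C.polynomialFunction i).IsIntegralElem y := by
  have h0 : C.polynomialFunction i = ((C.germ i).comp (C.hom.appLE _ _ le_rfl).hom).comp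
      (P1.chart K i : Polynomial K →+* _) := RingHom.ext fun p => (C.germ_chart i p).symm
  constructor
  · rintro ⟨b, rfl⟩
    have h1 : (C.hom.appLE (P1.standardOpen K i) _ le_rfl).hom.IsIntegralElem b := by
      have := (C.hom.finite_app _ (P1.isAffineOpen_standardOpen i)).to_isIntegral
      rw [Scheme.Hom.app_eq_appLE] at this
      exact this b
    have h2 : ((C.hom.appLE (P1.standardOpen K i) _ le_rfl).hom.comp
        (P1.chart K i : Polynomial K →+* _)).IsIntegralElem b := by
      obtain ⟨q, hq, h⟩ := h1
      refine ⟨q.map (P1.chart K i).symm.toRingHom, hq.map _, ?_⟩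
      rw [Polynomial.eval₂_map, RingHom.comp_assoc]
      convert h
      ext x
      simp
    rw [h0, RingHom.comp_assoc]
    exact h2.map (C.germ i)
  · intro h
    have h1 := isIntegrallyClosed_of_isAffineOpen C.normal _ (C.isAffineOpen_preimage i)
    have h2 := functionField_isFractionRing_of_isAffineOpen C.X _ (C.isAffineOpen_preimage i)
    rw [h0] at h
    have h3 : (C.germ i).IsIntegralElem y := h.of_comp.of_comp
    obtain ⟨b, hb⟩ := (IsIntegrallyClosed.isIntegral_iff
      (R := Γ(C.X, C.hom ⁻¹ᵁ P1.standardOpen K i)) (K := C.X.functionField)).mp h3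
    exact ⟨b, hb⟩

end Sections

end BranchedCover

theorem RingHom.IsIntegralElem.comp_ringEquiv {A A' B : Type*} [CommRing A] [CommRing A']
    [CommRing B] {f : A →+* B} {x : B} (h : f.IsIntegralElem x) (e : A' ≃+* A) :
    (f.comp (e : A' →+* A)).IsIntegralElem x := by
  have h1 : f = (f.comp (e : A' →+* A)).comp (e.symm : A →+* A') := by
    ext x; simp
  rw [h1] at h
  exact h.of_comp

theorem SpecMap_functionFieldMap_fromSpecFunctionField {X Y : Scheme.{0}} [IrreducibleSpace X]
    [IrreducibleSpace Y] (f : X ⟶ Y) [IsDominant f] :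
    Spec.map (functionFieldMap f) ≫ fromSpecFunctionField Y = fromSpecFunctionField X ≫ f :=
  SpecMap_functionFieldMap f

namespace BranchedCover

section Descent

variable {k K : Type} [Field k] [Field K] [Algebra k K]

theorem pullbackSection_fromSpecFunctionField_comp (C : BranchedCover K) (V : (P1 K).Opens)
    [Nonempty V] (h : ⊤ ≤ (fromSpecFunctionField C.X ≫ C.hom) ⁻¹ᵁ V) :
    pullbackSection (fromSpecFunctionField C.X ≫ C.hom) V h =
      (P1 K).germToFunctionField V ≫ functionFieldMap C.hom := by
  rw [← pullbackSection_SpecMap_fromSpecFunctionField]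
  congr 1
  exact (SpecMap_functionFieldMap C.hom).symm

/-- A semilinear action of a Galois group `Gal(K/k)` on the function field of a cover of `ℙ¹_K`
makes the cover descend to the cover of `ℙ¹_k` given by the fixed field. -/
theorem isModel_of_fixed [IsGalois k K] (D : BranchedCover k) (C : BranchedCover K)
    (ψ : D.FunctionField →+* C.FunctionField)
    (hψ : ∀ z, ψ (algebraMap _ _ z) = algebraMap _ C.FunctionField
      (functionFieldMap (P1.map (algebraMap k K)) z))
    (θ : (K ≃ₐ[k] K) → C.FunctionField ≃+* C.FunctionField)
    (hmul : ∀ σ τ x, θ (σ * τ) x = θ σ (θ τ x)) (hlift : ∀ σ : K ≃ₐ[k] K, C.IsLift (σ : K ≃+* K) (θ σ))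
    (hsmooth : ∀ x, ∃ s : Finset K, ∀ σ : K ≃ₐ[k] K, (∀ a ∈ s, σ a = a) → θ σ x = x)
    (hfix : ∀ x, (∃ y, ψ y = x) ↔ ∀ σ, θ σ x = x) : D.IsModel C := by
  have hψ' (i : Fin 2) (p : Polynomial k) : ψ (D.polynomialFunction i p) =
      C.polynomialFunction i (p.map (algebraMap k K)) := by
    unfold polynomialFunction
    rw [RingHom.comp_apply, hψ, P1.functionFieldMap_toFunctionField]
    rfl
  have hθp (i : Fin 2) (σ : K ≃ₐ[k] K) (p : Polynomial K) : θ σ (C.polynomialFunction i p) =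
      C.polynomialFunction i (p.map (σ : K →+* K)) := by
    unfold polynomialFunction
    rw [RingHom.comp_apply, hlift, baseEquiv_toFunctionField]
    rfl
  -- The base change `T` of `D` is shown to be the normalization of `ℙ¹_K` in the function field of
  -- `C`. As `C` is that normalization too, the two are isomorphic over `ℙ¹_K`.
  let T := Limits.pullback D.hom (P1.map (algebraMap k K))
  let ψ' : D.X.functionField ⟶ C.X.functionField := CommRingCat.ofHom ψ
  have hcomm : (Spec.map ψ' ≫ fromSpecFunctionField D.X) ≫ D.hom =
      (fromSpecFunctionField C.X ≫ C.hom) ≫ P1.map (algebraMap k K) := by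
    have h1 : functionFieldMap D.hom ≫ ψ' =
        functionFieldMap (P1.map (algebraMap k K)) ≫ functionFieldMap C.hom :=
      CommRingCat.hom_ext (RingHom.ext hψ)
    have h2 := congrArg (fun f => Spec.map f ≫ fromSpecFunctionField (P1 k)) h1
    simp only [Spec.map_comp, Category.assoc, SpecMap_functionFieldMap_fromSpecFunctionField] at h2 ⊢
    rw [h2, ← Category.assoc, SpecMap_functionFieldMap_fromSpecFunctionField, Category.assoc]
  let f₁ : Spec C.X.functionField ⟶ T :=
    Limits.pullback.lift (Spec.map ψ' ≫ fromSpecFunctionField D.X)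
      (fromSpecFunctionField C.X ≫ C.hom) hcomm
  let f₂ : T ⟶ P1 K := Limits.pullback.snd D.hom (P1.map (algebraMap k K))
  have hf₂ : IsFinite f₂ := inferInstance
  have hf₁₂ : f₁ ≫ f₂ = fromSpecFunctionField C.X ≫ C.hom := Limits.pullback.lift_snd _ _ _
  have hf₁₁ : f₁ ≫ Limits.pullback.fst D.hom (P1.map (algebraMap k K)) =
    Spec.map ψ' ≫ fromSpecFunctionField D.X := Limits.pullback.lift_fst _ _ _
  have htop (i : Fin 2) : ⊤ ≤ f₁ ⁻¹ᵁ f₂ ⁻¹ᵁ P1.standardOpen K i := by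
    rw [← Scheme.Hom.comp_preimage, hf₁₂]
    exact top_le_fromSpecFunctionField_preimage (C.hom ⁻¹ᵁ P1.standardOpen K i)
  have hsnd (i : Fin 2) : pullbackSection (f₁ ≫ f₂) (P1.standardOpen K i) (htop i) =
      (P1 K).germToFunctionField _ ≫ functionFieldMap C.hom := by
    rw [← pullbackSection_fromSpecFunctionField_comp C (P1.standardOpen K i)
      (top_le_fromSpecFunctionField_preimage (C.hom ⁻¹ᵁ P1.standardOpen K i))]
    congr 1
  have key (i : Fin 2) : Function.Injective (pullbackSection f₁ (f₂ ⁻¹ᵁ P1.standardOpen K i) (htop i)) ∧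
      ∀ x, (C.polynomialFunction i).IsIntegralElem x →
        ∃ y, pullbackSection f₁ (f₂ ⁻¹ᵁ P1.standardOpen K i) (htop i) y = x := by
    have hUY : f₂ ⁻¹ᵁ P1.standardOpen K i = Limits.pullback.fst D.hom (P1.map (algebraMap k K)) ⁻¹ᵁ
        D.hom ⁻¹ᵁ P1.standardOpen k i ⊓ f₂ ⁻¹ᵁ P1.standardOpen K i := by
      rw [← Scheme.Hom.comp_preimage, Limits.pullback.condition, Scheme.Hom.comp_preimage,
        P1.map_preimage_standardOpen, inf_idem]
    have h1 := (isIso_pushoutSection_iff (IsPullback.of_hasPullback D.hom (P1.map (algebraMap k K)))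
      (P1.map_preimage_standardOpen (algebraMap k K) i).ge le_rfl hUY).mp
      (isIso_pushoutSection_of_isAffineOpen _ _ _ _ (P1.isAffineOpen_standardOpen i)
        (P1.isAffineOpen_standardOpen i) (D.isAffineOpen_preimage i))
    have h2 : IsPushout (CommRingCat.ofHom (Polynomial.mapRingHom (algebraMap k K)))
        (CommRingCat.ofHom ((D.hom.appLE _ (D.hom ⁻¹ᵁ P1.standardOpen k i) le_rfl).hom.comp
          (P1.chart k i : Polynomial k →+* _)))
        (CommRingCat.ofHom ((f₂.appLE (P1.standardOpen K i) _ le_rfl).hom.comp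
          (P1.chart K i : Polynomial K →+* _)))
        ((Limits.pullback.fst D.hom (P1.map (algebraMap k K))).appLE
          (D.hom ⁻¹ᵁ P1.standardOpen k i) (f₂ ⁻¹ᵁ P1.standardOpen K i) (by
            rw [hUY]; exact inf_le_left)) := by
      refine IsPushout.of_iso h1.flip (P1.chart k i).symm.toCommRingCatIso
        (P1.chart K i).symm.toCommRingCatIso (Iso.refl _) (Iso.refl _) ?_ ?_ ?_ ?_
      · refine CommRingCat.hom_ext (RingHom.ext fun s => ?_)
        obtain ⟨p, rfl⟩ := (P1.chart k i).surjective s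
        have h4 := P1.map_app_chart (algebraMap k K) i p
        simp only [h4, RingEquiv.toCommRingCatIso_hom,
          CommRingCat.hom_comp, RingHom.comp_apply]
        simp
      · refine CommRingCat.hom_ext (RingHom.ext fun s => ?_)
        simp
      · refine CommRingCat.hom_ext (RingHom.ext fun s => ?_)
        simp [f₂]
      · simp
    let := Polynomial.algebra (R := k) (A := K)
    -- Pasting with `K[t] = K ⊗ k[t]` shows that the functions on `T` over a chart are the base
    -- change from `k` to `K` of the functions on `D`.
    have h3 := (CommRingCat.isPushout_of_isPushout k K (Polynomial k) (Polynomial K)).paste_vert h2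
    let w : Γ(T, f₂ ⁻¹ᵁ P1.standardOpen K i) →+* C.FunctionField :=
      (pullbackSection f₁ (f₂ ⁻¹ᵁ P1.standardOpen K i) (htop i)).hom
    let κΓ : K →+* Γ(T, f₂ ⁻¹ᵁ P1.standardOpen K i) :=
      ((f₂.appLE (P1.standardOpen K i) _ le_rfl).hom.comp
        (P1.chart K i : Polynomial K →+* _)).comp (algebraMap K (Polynomial K))
    have hle : f₂ ⁻¹ᵁ P1.standardOpen K i ≤ Limits.pullback.fst D.hom (P1.map (algebraMap k K)) ⁻¹ᵁ
        D.hom ⁻¹ᵁ P1.standardOpen k i := by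
      rw [hUY]; exact inf_le_left
    let u : Γ(D.X, D.hom ⁻¹ᵁ P1.standardOpen k i) →+* Γ(T, f₂ ⁻¹ᵁ P1.standardOpen K i) :=
      ((Limits.pullback.fst D.hom (P1.map (algebraMap k K))).appLE _ _ hle).hom
    have hwK (a : K) : w (κΓ a) = C.polynomialFunction i (Polynomial.C a) := by
      have h4 := appLE_pullbackSection f₁ f₂ (P1.standardOpen K i) _ le_rfl (htop i)
      exact congrArg (fun f => f.hom (P1.chart K i (Polynomial.C a))) (h4.trans (hsnd i))
    have hwB (b : Γ(D.X, D.hom ⁻¹ᵁ P1.standardOpen k i)) : w (u b) = ψ (D.germ i b) := by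
      have h4 := appLE_pullbackSection f₁ (Limits.pullback.fst D.hom (P1.map (algebraMap k K)))
        (D.hom ⁻¹ᵁ P1.standardOpen k i) (f₂ ⁻¹ᵁ P1.standardOpen K i) hle (htop i)
      have h5 := pullbackSection_SpecMap_fromSpecFunctionField ψ' (D.hom ⁻¹ᵁ P1.standardOpen k i)
      refine congrArg (fun f => f.hom b) (h4.trans (Eq.trans ?_ h5))
      congr 1
    -- The target of descent is the integral closure of `K[t]`. It is stable under the action, and
    -- its fixed elements are the functions on `D` integral over `k[t]`, because `K[t]` is itself
    -- integral over `k[t]`.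
    let R : Subring C.FunctionField :=
      letI := (C.polynomialFunction i).toAlgebra
      (integralClosure (Polynomial K) C.FunctionField).toSubring
    refine bijOn_of_isPushout_of_fixed _ κΓ u h3 w θ hmul (fun σ a => ?_) hsmooth R (fun a => ?_)
      ?_ (fun b b' h => ?_) ?_
    · rw [hwK, hwK, hθp, Polynomial.map_C]
      rfl
    · rw [hwK]
      exact RingHom.isIntegralElem_map _
    · intro σ x hx
      have h5 : ((θ σ).toRingHom.comp (C.polynomialFunction i)) =
        (C.polynomialFunction i).comp (Polynomial.mapRingHom (σ : K →+* K)) :=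
        RingHom.ext fun p => hθp i σ p
      have h6 : (C.polynomialFunction i).IsIntegralElem x := hx
      have h7 := h6.map (θ σ).toRingHom
      rw [h5] at h7
      exact h7.of_comp
    · exact D.germ_injective i (ψ.injective ((hwB b).symm.trans (h.trans (hwB b'))))
    · intro x
      have h5 : ψ.comp (D.polynomialFunction i) =
        (C.polynomialFunction i).comp (Polynomial.mapRingHom (algebraMap k K)) :=
        RingHom.ext fun p => hψ' i p
      constructor
      · rintro ⟨b, rfl⟩
        rw [hwB]
        refine ⟨?_, (hfix _).mp ⟨_, rfl⟩⟩
        have h6 := ((D.exists_germ_eq_iff i _).mp ⟨b, rfl⟩).map ψ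
        rw [h5] at h6
        exact h6.of_comp
      · rintro ⟨h6, h7⟩
        obtain ⟨y, rfl⟩ := (hfix _).mpr h7
        have h8 : (ψ.comp (D.polynomialFunction i)).IsIntegralElem (ψ y) := by
          rw [h5]
          let := (C.polynomialFunction i).toAlgebra
          let := ((C.polynomialFunction i).comp (Polynomial.mapRingHom (algebraMap k K))).toAlgebra
          have : IsScalarTower (Polynomial k) (Polynomial K) C.FunctionField :=
            .of_algebraMap_eq fun _ => rfl
          exact isIntegral_trans (R := Polynomial k) (A := Polynomial K) (ψ y) h6
        obtain ⟨b, rfl⟩ := (D.exists_germ_eq_iff i y).mpr (h8.of_map ψ.injective)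
        exact ⟨b, hwB b⟩
  have h1 : IsIso ((f₁ ≫ f₂).normalizationDesc f₁ f₂ rfl) := by
    refine isIso_normalizationDesc_of_affine f₁ f₂ (P1.standardOpen K) P1.isAffineOpen_standardOpen
      P1.iSup_standardOpen htop (fun i => (key i).1) fun i x hx => (key i).2 x ?_
    rw [hsnd] at hx
    exact hx.comp_ringEquiv (P1.chart K i)
  have h2 := isIso_normalizationDesc_of_normal C.normal C.hom (𝟙 _) (P1.standardOpen K)
    P1.isAffineOpen_standardOpen P1.iSup_standardOpen
  obtain ⟨η, -, hη⟩ := exists_iso_of_isIso_normalizationDesc _ _ f₁ f₂ (by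
    rw [hf₁₂, Spec.map_id, Category.id_comp]) h2 h1
  refine ⟨η.hom ≫ Limits.pullback.fst D.hom (P1.map (algebraMap k K)), ?_⟩
  exact IsPullback.of_iso (IsPullback.of_hasPullback D.hom (P1.map (algebraMap k K))) η.symm
    (Iso.refl _) (Iso.refl _) (Iso.refl _) (by simp) (by simp [← hη, f₂]) (by simp) (by simp)

end Descent

end BranchedCover

/-! ### Finiteness of function fields and the rational functions fixed by a Galois group. -/

namespace BranchedCover

section Finite

variable {K : Type} [Field K] (C : BranchedCover K)

/-- Over a chart the ring of the cover is a finite module; inverting the nonzero functions of the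
chart turns it into the function field. -/
instance : FiniteDimensional (P1 K).functionField C.FunctionField := by
  let A := Γ(P1 K, P1.standardOpen K 0)
  let B := Γ(C.X, C.hom ⁻¹ᵁ P1.standardOpen K 0)
  have h1 : IsFractionRing A (P1 K).functionField := functionField_isFractionRing_of_isAffineOpen
    (P1 K) (P1.standardOpen K 0) (P1.isAffineOpen_standardOpen 0)
  have h2 : IsFractionRing B C.X.functionField := functionField_isFractionRing_of_isAffineOpen C.X _
    (C.isAffineOpen_preimage 0)
  let : Algebra A B := (C.hom.appLE (P1.standardOpen K 0) _ le_rfl).hom.toAlgebra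
  let : Algebra B C.FunctionField := (C.germ 0).toAlgebra
  have h2 : IsFractionRing B C.FunctionField := h2
  have h3 : Module.Finite A B := by
    have := C.hom.finite_app _ (P1.isAffineOpen_standardOpen 0)
    rw [Scheme.Hom.app_eq_appLE] at this
    exact this
  let : Algebra A C.FunctionField :=
    ((algebraMap (P1 K).functionField C.FunctionField).comp (algebraMap A _)).toAlgebra
  have : IsScalarTower A (P1 K).functionField C.FunctionField := .of_algebraMap_eq fun _ => rfl
  have : IsScalarTower A B C.FunctionField := .of_algebraMap_eq fun s =>
    functionFieldMap_germToFunctionField C.hom _ _ le_rfl s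
  have : FaithfulSMul A B := by
    rw [faithfulSMul_iff_algebraMap_injective]
    refine Function.Injective.of_comp (f := algebraMap B C.FunctionField) ?_
    rw [← RingHom.coe_comp, ← IsScalarTower.algebraMap_eq,
      IsScalarTower.algebraMap_eq A (P1 K).functionField]
    exact (algebraMap (P1 K).functionField C.FunctionField).injective.comp
      (IsFractionRing.injective A (P1 K).functionField)
  have : IsLocalization (Algebra.algebraMapSubmonoid B (nonZeroDivisors A)) C.FunctionField :=
    inferInstance
  exact Module.Finite.of_isLocalization A B (nonZeroDivisors A)

end Finite

section Fixed

variable {k K : Type} [Field k] [Field K] [Algebra k K]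

theorem baseEquiv_functionFieldMap (σ : K ≃ₐ[k] K) (z : (P1 k).functionField) :
    baseEquiv (σ : K ≃+* K) (functionFieldMap (P1.map (algebraMap k K)) z) =
      functionFieldMap (P1.map (algebraMap k K)) z := by
  have h : functionFieldMap (P1.map (algebraMap k K)) ≫
      functionFieldMap (P1.map ((σ : K ≃+* K) : K →+* K)) =
      functionFieldMap (P1.map (algebraMap k K)) := by
    rw [← functionFieldMap_comp]
    congr 1
    rw [← P1.map_comp]
    congr 1
    ext x
    exact σ.commutes x
  exact congrArg (fun f => f.hom z) h

/-- The rational functions on the line which are fixed by the Galois group are defined over the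
base field. -/
theorem exists_functionFieldMap_eq [IsGalois k K] (x : (P1 K).functionField)
    (hx : ∀ σ : K ≃ₐ[k] K, baseEquiv (σ : K ≃+* K) x = x) :
    ∃ c, functionFieldMap (P1.map (algebraMap k K)) c = x := by
  obtain ⟨p, q, hq, h⟩ := P1.exists_toFunctionField K 0 x
  let := Polynomial.algebra (R := k) (A := K)
  have halg : Algebra.IsAlgebraic (Polynomial k) (Polynomial K) := inferInstance
  have : IsDomain (Polynomial K) := inferInstance
  -- Since `K[t]` is algebraic over `k[t]`, the fraction can be rewritten with its denominator in
  -- `k[t]`. The numerator is then fixed as well, so its coefficients lie in `k`.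
  obtain ⟨c, r, hr, hc⟩ := halg.exists_smul_eq_mul (Polynomial k) p hq
  rw [Algebra.smul_def] at hc
  change r.map (algebraMap k K) * p = q * c at hc
  have hr' : r.map (algebraMap k K) ≠ 0 := (Polynomial.map_ne_zero_iff (algebraMap k K).injective).mpr hr
  have hq' : P1.toFunctionField K 0 q ≠ 0 :=
    (map_ne_zero_iff _ (P1.toFunctionField_injective K 0)).mpr hq
  have h1 : x * P1.toFunctionField K 0 (r.map (algebraMap k K)) = P1.toFunctionField K 0 c := by
    apply mul_left_cancel₀ hq'
    rw [← map_mul, ← hc, map_mul, ← h]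
    ring
  have h2 : ∀ σ : K ≃ₐ[k] K, c.map (σ : K →+* K) = c := by
    intro σ
    apply P1.toFunctionField_injective K 0
    have := congrArg (baseEquiv (σ : K ≃+* K)) h1
    rw [map_mul, hx, baseEquiv_toFunctionField, baseEquiv_toFunctionField, Polynomial.map_map] at this
    refine this.symm.trans (Eq.trans ?_ h1)
    congr 3
    ext x
    exact σ.commutes x
  obtain ⟨c, rfl⟩ : ∃ c' : Polynomial k, c'.map (algebraMap k K) = c := by
    refine (Polynomial.mem_lifts c).mp ((Polynomial.lifts_iff_coeff_lifts c).mpr fun n => ?_)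
    refine (InfiniteGalois.mem_range_algebraMap_iff_fixed _).mpr fun σ => ?_
    conv_rhs => rw [← h2 σ, Polynomial.coeff_map]
    rfl
  rw [← P1.functionFieldMap_toFunctionField, ← P1.functionFieldMap_toFunctionField] at h1
  refine ⟨P1.toFunctionField k 0 c / P1.toFunctionField k 0 r, ?_⟩
  rw [map_div₀, ← h1, mul_div_cancel_right₀]
  rw [P1.functionFieldMap_toFunctionField]
  exact (map_ne_zero_iff _ (P1.toFunctionField_injective K 0)).mpr hr'

end Fixed

end BranchedCover

/-- Elements of `F` independent over `κ` remain independent over `κ'`, because they are fixed and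
the fixed elements of `κ'` come from `κ`. So a basis of `F` is no larger than the dimension of `Φ`
over `κ'`. -/
theorem RingHom.finite_of_fixed {κ κ' Φ Γ : Type*} [Field κ] [Field κ'] [Field Φ] [Algebra κ' Φ]
    [FiniteDimensional κ' Φ] (β : κ →+* κ') (s : Γ → κ' →+* κ')
    (hs : ∀ a, (∀ σ, s σ a = a) → ∃ c, β c = a) (θ : Γ → Φ →+* Φ)
    (hθ : ∀ σ a, θ σ (algebraMap κ' Φ a) = algebraMap κ' Φ (s σ a)) (F : Subfield Φ)
    (hF : ∀ x ∈ F, ∀ σ, θ σ x = x) (b : κ →+* F)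
    (hb : ∀ z, (b z : Φ) = algebraMap κ' Φ (β z)) : b.Finite := by
  let := b.toAlgebra
  let := β.toAlgebra
  let := ((algebraMap κ' Φ).comp β).toAlgebra
  have : IsScalarTower κ κ' Φ := .of_algebraMap_eq fun _ => rfl
  have : IsScalarTower κ F Φ := .of_algebraMap_eq fun z => (hb z).symm
  let v := Module.Basis.ofVectorSpace κ F
  have h1 : LinearIndependent κ (fun i => (v i : Φ)) :=
    v.linearIndependent.map' (IsScalarTower.toAlgHom κ F Φ).toLinearMap
      (LinearMap.ker_eq_bot.mpr Subtype.val_injective)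
  have h2 := linearIndependent_of_fixed s hs (fun σ => (θ σ).toAddMonoidHom) (fun σ a x => by
    rw [Algebra.smul_def, Algebra.smul_def]
    exact (map_mul (θ σ) _ _).trans (congrArg (· * _) (hθ σ a))) _
    (fun i σ => hF _ (v i).2 σ) h1
  have := h2.finite_of_isNoetherian
  exact Module.Finite.of_basis v

namespace BranchedCover

variable {k K : Type} [Field k] [Field K] [Algebra k K]

/-- A smooth semilinear action of a Galois group `Gal(K/k)` on the function field of a cover of
`ℙ¹_K` defines a model of the cover over `k`. If the cover is Galois and the action commutes with
its Galois group, then the model is Galois. -/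
theorem exists_isModel [CharZero K] [IsGalois k K] (C : BranchedCover K)
    (θ : (K ≃ₐ[k] K) → C.FunctionField ≃+* C.FunctionField)
    (hmul : ∀ σ τ x, θ (σ * τ) x = θ σ (θ τ x))
    (hlift : ∀ σ : K ≃ₐ[k] K, C.IsLift (σ : K ≃+* K) (θ σ))
    (hsmooth : ∀ x, ∃ s : Finset K, ∀ σ : K ≃ₐ[k] K, (∀ a ∈ s, σ a = a) → θ σ x = x) :
    ∃ D : BranchedCover k, D.IsModel C ∧ (C.IsGaloisCover →
      (∀ σ (g : C.FunctionField ≃ₐ[(P1 K).functionField] C.FunctionField) x,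
        θ σ (g x) = g (θ σ x)) → D.IsGaloisCover) := by
  let F : Subfield C.FunctionField :=
    { carrier := {x | ∀ σ, θ σ x = x}
      mul_mem' := fun ha hb σ => by rw [map_mul, ha, hb]
      one_mem' := fun σ => map_one _
      add_mem' := fun ha hb σ => by rw [map_add, ha, hb]
      zero_mem' := fun σ => map_zero _
      neg_mem' := fun ha σ => by rw [map_neg, ha]
      inv_mem' := fun a ha σ => by rw [map_inv₀, ha] }
  have hF : ∀ {x}, x ∈ F ↔ ∀ σ, θ σ x = x := Iff.rfl
  let β : (P1 k).functionField →+* (P1 K).functionField :=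
    (functionFieldMap (P1.map (algebraMap k K))).hom
  let b : (P1 k).functionField →+* F :=
    ((algebraMap (P1 K).functionField C.FunctionField).comp β).codRestrict F fun z σ =>
      (hlift σ _).trans (congrArg _ (baseEquiv_functionFieldMap σ z))
  have : CharZero C.FunctionField :=
    charZero_of_injective_ringHom (f := (C.polynomialFunction 0).comp Polynomial.C)
      (RingHom.injective _)
  have : CharZero F := F.subtype.charZero
  have hfin : b.Finite := RingHom.finite_of_fixed β
    (fun σ : K ≃ₐ[k] K => (baseEquiv (σ : K ≃+* K)).toRingHom)
    (fun a ha => exists_functionFieldMap_eq a ha) (fun σ => (θ σ).toRingHom)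
    (fun σ a => hlift σ a) F (fun x hx σ => hx σ) b fun z => rfl
  -- The candidate model is the cover of `ℙ¹_k` whose function field is the fixed field `F`.
  obtain ⟨D, e, he⟩ := exists_functionField_equiv b hfin
  let ψ : D.FunctionField →+* C.FunctionField := F.subtype.comp (e : D.FunctionField →+* F)
  have hψ : ∀ z, ψ (algebraMap _ _ z) = algebraMap _ C.FunctionField (β z) := fun z =>
    congrArg Subtype.val (he z)
  refine ⟨D, isModel_of_fixed D C ψ hψ θ hmul hlift hsmooth fun x => ⟨?_, fun h => ?_⟩, fun hgal hcomm => ?_⟩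
  · rintro ⟨y, rfl⟩
    exact (e y).2
  · obtain ⟨y, hy⟩ := e.surjective ⟨x, h⟩
    exact ⟨y, congrArg Subtype.val hy⟩
  · have : IsGalois (P1 K).functionField C.FunctionField := hgal
    -- Automorphisms of the large field commute with the action, so they restrict to `F`. A function
    -- on `D` fixed by all of them is a rational function on `ℙ¹_K`, and being fixed by `θ` it is
    -- defined over `k`.
    refine IsGalois.of_fixedField_eq_bot _ _ (le_bot_iff.mp fun y hy => ?_)
    have h1 : ∀ g : C.FunctionField ≃ₐ[(P1 K).functionField] C.FunctionField, g (ψ y) = ψ y := by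
      intro g
      let gF : F →+* F := (g.toRingEquiv.toRingHom.comp F.subtype).codRestrict F fun x σ => by
        change θ σ (g x) = g x
        rw [hcomm, x.2 σ]
      let gD : D.FunctionField →ₐ[(P1 k).functionField] D.FunctionField :=
        { (e.symm : F →+* D.FunctionField).comp (gF.comp (e : D.FunctionField →+* F)) with
          commutes' := fun z => by
            change e.symm (gF (e (algebraMap _ _ z))) = _
            rw [RingEquiv.symm_apply_eq, he]
            exact Subtype.ext (g.commutes (β z)) }
      have h2 := hy ⟨AlgEquiv.ofBijective gD gD.bijective, trivial⟩
      have h3 : e.symm (gF (e y)) = y := h2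
      rw [RingEquiv.symm_apply_eq] at h3
      exact congrArg Subtype.val h3
    obtain ⟨x, hx⟩ := (IsGalois.mem_bot_iff_fixed (F := (P1 K).functionField) (ψ y)).mpr h1
    obtain ⟨c, hc⟩ := exists_functionFieldMap_eq (k := k) x fun σ => by
      apply (algebraMap (P1 K).functionField C.FunctionField).injective
      rw [← hlift σ]
      erw [hx]
      exact (e y).2 σ
    refine ⟨c, ψ.injective ?_⟩
    refine (hψ c).trans ?_
    rw [← hx]
    exact congrArg _ hc

/-- A cover with a model over `k` is isomorphic with its twists by automorphisms over `k`. -/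
theorem IsModel.isIsomorphic_twist {D : BranchedCover k} {C : BranchedCover K} (h : D.IsModel C)
    (σ : K ≃ₐ[k] K) : (C.twist (σ : K ≃+* K)).IsIsomorphic C := by
  obtain ⟨p, hp⟩ := h
  have h1 : P1.map ((σ : K ≃+* K).symm : K →+* K) ≫ P1.map (algebraMap k K) =
      P1.map (algebraMap k K) := by
    rw [← P1.map_comp]
    congr 1
    ext x
    exact σ.symm.commutes x
  -- An automorphism over `k` does not change the projection to `ℙ¹_k`, so the twist is a base
  -- change of the same model; base changes are unique.
  have h2 : IsPullback p (C.hom ≫ P1.map ((σ : K ≃+* K).symm : K →+* K)) D.hom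
      (P1.map (algebraMap k K)) := by
    refine IsPullback.of_iso hp (Iso.refl _) (Iso.refl _)
      (asIso (P1.map ((σ : K ≃+* K).symm : K →+* K))) (Iso.refl _) (by simp) (by simp) (by simp) ?_
    rw [Iso.refl_hom, Category.comp_id]
    exact h1.symm
  refine ⟨h2.isoIsPullback _ _ hp, ?_⟩
  exact IsPullback.isoIsPullback_hom_snd _ _ h2 hp

end BranchedCover

/-! ### Points above a value of the coordinate. -/

section Points

open Polynomial Pointwise

variable {K B : Type*} [Field K] [CommRing B] [Algebra K[X] B]

/-- The residue field at a maximal ideal above `t = a` is integral over the algebraically closed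
field `K`, hence equal to it. -/
theorem exists_point [IsAlgClosed K] [FaithfulSMul K[X] B] [Algebra.IsIntegral K[X] B] (a : K) :
    ∃ π : B →+* K, ∀ p, π (algebraMap K[X] B p) = p.eval a := by
  have hmax : (RingHom.ker (evalRingHom a)).IsMaximal :=
    RingHom.ker_isMaximal_of_surjective _ fun c => ⟨C c, by simp⟩
  obtain ⟨P, hP, hPa⟩ := Ideal.exists_ideal_over_maximal_of_isIntegral (S := B)
    (RingHom.ker (evalRingHom a)) (by
      rw [(RingHom.injective_iff_ker_eq_bot _).mp (FaithfulSMul.algebraMap_injective K[X] B)]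
      exact bot_le)
  let κ : K →+* B ⧸ P := ((Ideal.Quotient.mk P).comp (algebraMap K[X] B)).comp C
  have hκ : ∀ p, Ideal.Quotient.mk P (algebraMap K[X] B p) = κ (p.eval a) := by
    intro p
    have h1 : p - C (p.eval a) ∈ P.comap (algebraMap K[X] B) := by
      rw [hPa]
      simp [RingHom.mem_ker]
    rw [Ideal.mem_comap, map_sub] at h1
    exact (Ideal.Quotient.eq.mpr h1)
  let := κ.toAlgebra
  have : Algebra.IsIntegral K (B ⧸ P) := by
    refine ⟨fun z => ?_⟩
    obtain ⟨b, rfl⟩ := Ideal.Quotient.mk_surjective z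
    have h2 : ((Ideal.Quotient.mk P).comp (algebraMap K[X] B)).IsIntegralElem
        (Ideal.Quotient.mk P b) :=
      RingHom.IsIntegralElem.map (Algebra.IsIntegral.isIntegral (R := K[X]) b) (Ideal.Quotient.mk P)
    have h3 : (Ideal.Quotient.mk P).comp (algebraMap K[X] B) = κ.comp (evalRingHom a) :=
      RingHom.ext hκ
    rw [h3] at h2
    exact h2.of_comp
  let e : K ≃+* B ⧸ P := RingEquiv.ofBijective κ IsAlgClosed.algebraMap_bijective_of_isIntegral
  refine ⟨(e.symm : B ⧸ P →+* K).comp (Ideal.Quotient.mk P), fun p => ?_⟩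
  change e.symm (Ideal.Quotient.mk P (algebraMap K[X] B p)) = _
  rw [hκ, RingEquiv.symm_apply_eq]
  rfl

variable {𝒢 : Type*} [Group 𝒢] [Finite 𝒢] [MulSemiringAction 𝒢 B]
  [Algebra.IsInvariant K[X] B 𝒢]

/-- The group acts transitively on the points above a given point of the line. -/
theorem exists_smul_of_point [SMulCommClass 𝒢 K[X] B] (π π' : B →+* K) (a : K)
    (hπ : ∀ p, π (algebraMap K[X] B p) = p.eval a)
    (hπ' : ∀ p, π' (algebraMap K[X] B p) = p.eval a) : ∃ g : 𝒢, ∀ b, π' b = π (g • b) := by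
  have h1 : (RingHom.ker π').under K[X] = (RingHom.ker π).under K[X] := by
    ext p
    simp [Ideal.mem_comap, RingHom.mem_ker, hπ, hπ']
  have : (RingHom.ker π).IsPrime := RingHom.ker_isPrime π
  have : (RingHom.ker π').IsPrime := RingHom.ker_isPrime π'
  -- The group is transitive on the primes above `t = a`, and a `K`-valued point is determined by
  -- its kernel.
  obtain ⟨g, hg⟩ := Algebra.IsInvariant.exists_smul_of_under_eq K[X] B 𝒢 _ _ h1
  refine ⟨g, fun b => ?_⟩
  have h2 : b - algebraMap K[X] B (C (π' b)) ∈ RingHom.ker π' := by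
    rw [RingHom.mem_ker, map_sub, hπ', eval_C, sub_self]
  have h3 := Ideal.smul_mem_pointwise_smul g _ _ h2
  rw [← hg, RingHom.mem_ker, smul_sub, smul_algebraMap, map_sub, hπ, eval_C] at h3
  exact (sub_eq_zero.mp h3).symm

/-- For all but finitely many values of the coordinate, the stabilizers of the points are
trivial. -/
theorem exists_forall_point_ne [IsDomain B] [FaithfulSMul K[X] B] {k : Type*} [Field k] [Infinite k]
    [Algebra k K] (y : B) (hy : ∀ g : 𝒢, g ≠ 1 → g • y ≠ y) :
    ∃ a : k, ∀ π : B →+* K, (∀ p, π (algebraMap K[X] B p) = p.eval (algebraMap k K a)) →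
      ∀ g : 𝒢, π (g • y) = π y → g = 1 := by
  classical
  cases nonempty_fintype 𝒢
  -- The product over the group of the conjugates of `δ` is an invariant, that is, a nonzero
  -- polynomial in `t`. Away from its roots no nontrivial `g` can preserve the value of `y`.
  let δ : B := ∏ g ∈ Finset.univ.erase (1 : 𝒢), (g • y - y)
  have hδ : δ ≠ 0 := Finset.prod_ne_zero_iff.mpr fun g hg =>
    sub_ne_zero.mpr (hy g (Finset.ne_of_mem_erase hg))
  have hinv : ∀ g : 𝒢, g • (∏ h : 𝒢, h • δ) = ∏ h : 𝒢, h • δ := by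
    intro g
    rw [Finset.smul_prod']
    exact Fintype.prod_equiv (Equiv.mulLeft g) _ _ fun h => by simp [mul_smul]
  obtain ⟨n, hn⟩ := Algebra.IsInvariant.isInvariant (A := K[X]) _ hinv
  have hn0 : n ≠ 0 := by
    rintro rfl
    rw [map_zero] at hn
    obtain ⟨h, -, hh⟩ := Finset.prod_eq_zero_iff.mp hn.symm
    exact hδ ((smul_eq_zero_iff_eq h).mp hh)
  obtain ⟨a, ha⟩ : ∃ a : k, n.eval (algebraMap k K a) ≠ 0 := by
    by_contra! h
    refine hn0 (Polynomial.eq_zero_of_infinite_isRoot n ?_)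
    exact (Set.infinite_range_of_injective (algebraMap k K).injective).mono
      (Set.range_subset_iff.mpr h)
  refine ⟨a, fun π hπ g hg => ?_⟩
  by_contra hg1
  refine ha ?_
  rw [← hπ, hn, map_prod]
  refine Finset.prod_eq_zero (Finset.mem_univ 1) ?_
  rw [one_smul, map_prod]
  refine Finset.prod_eq_zero (Finset.mem_erase.mpr ⟨hg1, Finset.mem_univ g⟩) ?_
  rw [map_sub, hg, sub_self]

end Points

/-! ### Compatible lifts of automorphisms of the constants. -/

section Semilinear

open Polynomial

variable {k K κ Φ : Type*} [Field k] [Field K] [Algebra k K] [Field κ] [Field Φ]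
  [Algebra K[X] κ] [Algebra κ Φ] [Algebra K[X] Φ]

/-- Automorphisms of an extension of `K(t)` which act on `K` through `σ` and fix `t`. -/
def IsSemilinear (σ : K ≃+* K) (θ : Φ ≃+* Φ) : Prop :=
  ∀ p : K[X], θ (algebraMap K[X] Φ p) = algebraMap K[X] Φ (p.map (σ : K →+* K))

theorem IsSemilinear.symm {σ : K ≃+* K} {θ : Φ ≃+* Φ} (h : IsSemilinear σ θ) :
    IsSemilinear σ.symm θ.symm := by
  intro p
  rw [RingEquiv.symm_apply_eq, h, Polynomial.map_map]
  simp

theorem IsSemilinear.mul {σ τ : K ≃+* K} {θ η : Φ ≃+* Φ} (h : IsSemilinear σ θ)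
    (h' : IsSemilinear τ η) : IsSemilinear (σ * τ) (θ * η) := by
  intro p
  rw [RingAut.mul_apply, h', h, Polynomial.map_map]
  rfl

theorem IsSemilinear.isIntegral {σ : K ≃+* K} {θ : Φ ≃+* Φ} (h : IsSemilinear σ θ) {x : Φ}
    (hx : _root_.IsIntegral K[X] x) : _root_.IsIntegral K[X] (θ x) := by
  have h1 : (θ : Φ →+* Φ).comp (algebraMap K[X] Φ) =
    (algebraMap K[X] Φ).comp (mapRingHom (σ : K →+* K)) := RingHom.ext h
  have h2 := RingHom.IsIntegralElem.map hx (θ : Φ →+* Φ)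
  rw [h1] at h2
  exact h2.of_comp

variable [IsFractionRing K[X] κ] [IsScalarTower K[X] κ Φ]

theorem IsSemilinear.one_iff_exists (θ : Φ ≃+* Φ) :
    IsSemilinear (1 : K ≃+* K) θ ↔ ∃ g : Φ ≃ₐ[κ] Φ, ∀ x, θ x = g x := by
  constructor
  · intro h
    refine ⟨AlgEquiv.ofRingEquiv (f := θ) fun z => ?_, fun x => rfl⟩
    have h1 : (θ : Φ →+* Φ).comp (algebraMap κ Φ) = algebraMap κ Φ := by
      refine IsLocalization.ringHom_ext (nonZeroDivisors K[X]) (RingHom.ext fun p => ?_)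
      rw [RingHom.comp_apply, RingHom.comp_apply, RingHom.comp_apply,
        ← IsScalarTower.algebraMap_apply K[X] κ Φ]
      exact (h p).trans (congrArg _ (Polynomial.map_id))
    exact congrArg (fun f => f z) h1
  · rintro ⟨g, hg⟩ p
    rw [hg, IsScalarTower.algebraMap_apply K[X] κ Φ, g.commutes,
      ← IsScalarTower.algebraMap_apply K[X] κ Φ]
    exact congrArg (algebraMap K[X] Φ) (Polynomial.map_id (p := p)).symm

theorem PowerBasis.exists_ringHom {A S S' : Type*} [CommRing A] [Ring S] [Algebra A S] [CommRing S']
    (pb : PowerBasis A S) (j : A →+* S') (y : S') (hy : (minpoly A pb.gen).eval₂ j y = 0) :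
    ∃ φ : S →+* S', (∀ a, φ (algebraMap A S a) = j a) ∧ φ pb.gen = y := by
  let := j.toAlgebra
  exact ⟨pb.lift y hy, (pb.lift y hy).commutes, pb.lift_gen y hy⟩

/-- Extend `σ` to `κ = K(t)`. As it preserves the minimal polynomial, the generator may be sent to
itself. The image is a field containing `κ` and the generator, so the map is onto. -/
theorem exists_isSemilinear_of_minpoly (σ : K ≃+* K) (pb : PowerBasis κ Φ)
    (hint : _root_.IsIntegral K[X] pb.gen)
    (hσ : (minpoly K[X] pb.gen).map (mapRingHom (σ : K →+* K)) = minpoly K[X] pb.gen) :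
    ∃ θ : Φ ≃+* Φ, IsSemilinear σ θ ∧ θ pb.gen = pb.gen := by
  let β : κ ≃+* κ := IsFractionRing.ringEquivOfRingEquiv (Polynomial.mapEquiv σ)
  have hβ : ∀ p : K[X], β (algebraMap K[X] κ p) = algebraMap K[X] κ (p.map (σ : K →+* K)) :=
    fun p => IsFractionRing.ringEquivOfRingEquiv_algebraMap _ p
  obtain ⟨φ, h1, h2⟩ := pb.exists_ringHom ((algebraMap κ Φ).comp (β : κ →+* κ)) pb.gen (by
    rw [minpoly.isIntegrallyClosed_eq_field_fractions' κ hint, Polynomial.eval₂_map]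
    have h3 : ((algebraMap κ Φ).comp (β : κ →+* κ)).comp (algebraMap K[X] κ) =
        (algebraMap K[X] Φ).comp (mapRingHom (σ : K →+* K)) := RingHom.ext fun p => by
      simp only [RingHom.comp_apply, RingEquiv.coe_toRingHom, hβ, coe_mapRingHom,
        IsScalarTower.algebraMap_apply K[X] κ Φ]
    rw [h3, ← Polynomial.eval₂_map, hσ]
    exact minpoly.aeval K[X] pb.gen)
  have h4 : Function.Surjective φ := by
    let R : IntermediateField κ Φ := { φ.fieldRange with
      algebraMap_mem' := fun z => ⟨algebraMap κ Φ (β.symm z), by rw [h1]; simp⟩ }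
    have h5 : R = ⊤ := by
      rw [eq_top_iff]
      intro x _
      have h6 : x ∈ Algebra.adjoin κ {pb.gen} := pb.adjoin_gen_eq_top ▸ Algebra.mem_top
      exact Algebra.adjoin_le (S := R.toSubalgebra) (Set.singleton_subset_iff.mpr ⟨_, h2⟩) h6
    intro x
    exact (h5 ▸ IntermediateField.mem_top : x ∈ R)
  refine ⟨RingEquiv.ofBijective φ ⟨φ.injective, h4⟩, fun p => ?_, h2⟩
  change φ _ = _
  rw [IsScalarTower.algebraMap_apply K[X] κ Φ, h1, IsScalarTower.algebraMap_apply K[X] κ Φ, ← hβ]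
  rfl

end Semilinear

section Semilinear

open Polynomial

/-- The automorphisms of `K` which extend to a Galois extension of `K(t)` can be extended
compatibly, namely by letting them fix a point over a rational value of `t`. -/
theorem exists_semilinear_action (k K κ Φ : Type*) [Field k] [Infinite k] [Field K] [Algebra k K]
    [IsAlgClosed K] [Field κ] [Field Φ] [Algebra K[X] κ] [Algebra κ Φ] [Algebra K[X] Φ]
    [IsFractionRing K[X] κ] [IsScalarTower K[X] κ Φ] [FiniteDimensional κ Φ] [IsGalois κ Φ] :
    ∃ (s₀ : Finset K) (θ : (K ≃ₐ[k] K) → Φ ≃+* Φ),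
      (∀ σ : K ≃ₐ[k] K, (∀ a ∈ s₀, σ a = a) →
        ∃ η : Φ ≃+* Φ, IsSemilinear (σ : K ≃+* K) η) ∧
      (∀ σ : K ≃ₐ[k] K, (∃ η : Φ ≃+* Φ, IsSemilinear (σ : K ≃+* K) η) →
        IsSemilinear (σ : K ≃+* K) (θ σ)) ∧
      (∀ σ τ : K ≃ₐ[k] K, (∃ η : Φ ≃+* Φ, IsSemilinear (σ : K ≃+* K) η) →
        (∃ η : Φ ≃+* Φ, IsSemilinear (τ : K ≃+* K) η) → θ (σ * τ) = θ σ * θ τ) ∧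
      ∀ x, ∃ s : Finset K, ∀ σ : K ≃ₐ[k] K, (∀ a ∈ s, σ a = a) → θ σ x = x := by
  classical
  have hcomm : SMulCommClass (Φ ≃ₐ[κ] Φ) K[X] Φ := ⟨fun g p x => by
    rw [← algebraMap_smul κ p x, ← algebraMap_smul κ p (g • x)]
    exact map_smul g _ _⟩
  let B := integralClosure K[X] Φ
  have hfaith : FaithfulSMul K[X] Φ := by
    rw [faithfulSMul_iff_algebraMap_injective, IsScalarTower.algebraMap_eq K[X] κ Φ]
    exact (algebraMap κ Φ).injective.comp (IsFractionRing.injective K[X] κ)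
  have : FaithfulSMul K[X] B := (faithfulSMul_iff_algebraMap_injective K[X] B).mpr fun p q h =>
    FaithfulSMul.algebraMap_injective K[X] Φ (congrArg (algebraMap B Φ) h)
  have : Algebra.IsInvariant K[X] B (Φ ≃ₐ[κ] Φ) := ⟨fun b hb => by
    obtain ⟨z, hz⟩ := (IsGalois.mem_bot_iff_fixed (F := κ) (b : Φ)).mpr
      fun g => congrArg (algebraMap B Φ) (hb g)
    have h1 : _root_.IsIntegral K[X] z :=
      (isIntegral_algebraMap_iff (algebraMap κ Φ).injective).mp (hz ▸ b.2)
    obtain ⟨q, hq⟩ := IsIntegrallyClosed.isIntegral_iff.mp h1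
    refine ⟨q, Subtype.ext ?_⟩
    rw [← hz, ← hq]
    exact IsScalarTower.algebraMap_apply K[X] κ Φ q⟩
  obtain ⟨pb, hint⟩ : ∃ pb : PowerBasis κ Φ, _root_.IsIntegral K[X] pb.gen := by
    obtain ⟨y, hy⟩ := Field.exists_primitive_element κ Φ
    obtain ⟨d, hd, hdy⟩ := ((IsFractionRing.isAlgebraic_iff K[X] κ Φ).mpr
      (Algebra.IsAlgebraic.isAlgebraic (R := κ) y)).exists_integral_multiple
    have h1 : IntermediateField.adjoin κ {d • y} = ⊤ := by
      rw [eq_top_iff, ← hy, IntermediateField.adjoin_simple_le_iff]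
      have h2 : d • y ∈ IntermediateField.adjoin κ {d • y} :=
        IntermediateField.mem_adjoin_simple_self κ _
      have hd' : algebraMap K[X] κ d ≠ 0 := by simpa using hd
      have h3 := (IntermediateField.adjoin κ {d • y}).smul_mem (x := (algebraMap K[X] κ d)⁻¹) h2
      have h4 : (algebraMap K[X] κ d)⁻¹ • (d • y) = y := by
        rw [← algebraMap_smul κ d y, smul_smul, inv_mul_cancel₀ hd', one_smul]
      rwa [h4] at h3
    refine ⟨(IntermediateField.adjoin.powerBasis
      (IsIntegral.of_finite κ (d • y))).map ((IntermediateField.equivOfEq h1).trans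
        IntermediateField.topEquiv), ?_⟩
    simpa using hdy
  let y : B := ⟨pb.gen, hint⟩
  -- The value `a` is taken in `k`, so that every `σ` fixes it, and outside the finitely many values
  -- over which the group fails to act freely.
  obtain ⟨a, ha⟩ := exists_forall_point_ne (K := K) (k := k) (𝒢 := Φ ≃ₐ[κ] Φ) y fun g hg h => by
    refine hg (AlgEquiv.coe_toAlgHom_injective (pb.algHom_ext ?_))
    exact congrArg (algebraMap B Φ) h
  obtain ⟨π, hπ⟩ := exists_point (B := B) (algebraMap k K a)
  have hfree := ha π hπ
  -- The normalization of a lift: it is compatible with the point, `π ∘ θ = σ ∘ π` on `B`. Two lifts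
  -- differ by a Galois element, which must fix the value of `y` at `π` and is therefore trivial.
  let N (σ : K ≃ₐ[k] K) (θ : Φ ≃+* Φ) : Prop := ∀ x x' : B, θ x = x' → π x' = σ (π x)
  have huniq : ∀ (σ : K ≃ₐ[k] K) (θ θ' : Φ ≃+* Φ), IsSemilinear (σ : K ≃+* K) θ →
      IsSemilinear (σ : K ≃+* K) θ' → N σ θ → N σ θ' → θ = θ' := by
    intro σ θ θ' h h' hN hN'
    have h1 : IsSemilinear (1 : K ≃+* K) (θ.symm * θ') := by
      have h2 := h.symm.mul h'
      rwa [show (σ : K ≃+* K).symm * (σ : K ≃+* K) = 1 from RingEquiv.ext (by simp)] at h2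
    obtain ⟨g, hg⟩ := (IsSemilinear.one_iff_exists (κ := κ) _).mp h1
    have hg' : ∀ x, θ' x = θ (g x) := fun x => by
      rw [← hg, RingAut.mul_apply, RingEquiv.apply_symm_apply]
    have h3 := hN' y ⟨θ' y, h'.isIntegral y.2⟩ rfl
    have h4 := hN (g • y) ⟨θ' y, h'.isIntegral y.2⟩ (hg' y).symm
    have h5 := hfree g (σ.injective (h4.symm.trans h3))
    refine RingEquiv.ext fun x => ?_
    rw [hg', h5]
    rfl
  have htrans : ∀ (σ : K ≃ₐ[k] K) (θ : Φ ≃+* Φ), IsSemilinear (σ : K ≃+* K) θ →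
      ∃ g : Φ ≃ₐ[κ] Φ, ∀ x x' : B, θ x = x' → π x' = σ (π (g • x)) := by
    intro σ θ h
    let θB : B →+* B := ((θ : Φ →+* Φ).comp B.toSubring.subtype).codRestrict B.toSubring
      fun x => h.isIntegral x.2
    -- The composite `σ⁻¹ ∘ π ∘ θ` is again a point above `a`, because `σ` fixes `a`; so it differs
    -- from `π` by some `g`, and correcting `θ` by `g⁻¹` normalizes it.
    obtain ⟨g, hg⟩ := exists_smul_of_point (𝒢 := Φ ≃ₐ[κ] Φ) π
      ((σ.symm : K →+* K).comp (π.comp θB)) (algebraMap k K a) hπ fun p => by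
        have h1 : θB (algebraMap K[X] B p) = algebraMap K[X] B (p.map (σ : K →+* K)) :=
          Subtype.ext (h p)
        change σ.symm (π (θB _)) = _
        rw [h1, hπ, AlgEquiv.symm_apply_eq, Polynomial.eval_map]
        have h2 := Polynomial.eval₂_at_apply (p := p) (σ : K →+* K) (algebraMap k K a)
        rw [RingHom.coe_coe, σ.commutes] at h2
        exact h2
    refine ⟨g, fun x x' hx => ?_⟩
    have h3 : σ.symm (π (θB x)) = π (g • x) := hg x
    rw [AlgEquiv.symm_apply_eq] at h3
    rw [← h3]
    exact congrArg π (Subtype.ext hx.symm)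
  have hex : ∀ σ : K ≃ₐ[k] K, (∃ η : Φ ≃+* Φ, IsSemilinear (σ : K ≃+* K) η) →
      ∃ η : Φ ≃+* Φ, IsSemilinear (σ : K ≃+* K) η ∧ N σ η := by
    rintro σ ⟨η, h⟩
    obtain ⟨g, hg⟩ := htrans σ η h
    refine ⟨η * (g⁻¹ : Φ ≃ₐ[κ] Φ).toRingEquiv, ?_, fun x x' hx => ?_⟩
    · have h1 := h.mul ((IsSemilinear.one_iff_exists (κ := κ) (K := K)
        (g⁻¹ : Φ ≃ₐ[κ] Φ).toRingEquiv).mpr ⟨g⁻¹, fun _ => rfl⟩)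
      rwa [mul_one] at h1
    · rw [hg (g⁻¹ • x) x' hx, smul_inv_smul]
  -- If `σ` fixes the coefficients of the minimal polynomial, it has a lift fixing the generator. If
  -- it also fixes the value `π y`, that lift is the normalized one.
  let s₀ : Finset K := insert (π y) ((minpoly K[X] pb.gen).support.biUnion fun i =>
    ((minpoly K[X] pb.gen).coeff i).coeffs)
  have hy : ∀ σ : K ≃ₐ[k] K, (∀ a ∈ s₀, σ a = a) →
      ∃ η : Φ ≃+* Φ, IsSemilinear (σ : K ≃+* K) η ∧ N σ η ∧ η pb.gen = pb.gen := by
    intro σ hσ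
    obtain ⟨η, h1, h2⟩ := exists_isSemilinear_of_minpoly (σ : K ≃+* K) pb hint (by
      ext i j
      rw [Polynomial.coeff_map, coe_mapRingHom, Polynomial.coeff_map]
      by_cases hij : ((minpoly K[X] pb.gen).coeff i).coeff j = 0
      · rw [hij, map_zero]
      · refine hσ _ (Finset.mem_insert_of_mem (Finset.mem_biUnion.mpr ⟨i, ?_, ?_⟩))
        · rw [Polynomial.mem_support_iff]
          intro h0
          rw [h0, Polynomial.coeff_zero] at hij
          exact hij rfl
        · exact Polynomial.coeff_mem_coeffs hij)
    obtain ⟨g, hg⟩ := htrans σ η h1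
    have h3 : g = 1 := by
      refine hfree g (σ.injective ?_)
      rw [← hg y y h2, hσ _ (Finset.mem_insert_self _ _)]
    subst h3
    exact ⟨η, h1, fun x x' hx => by rw [hg x x' hx, one_smul], h2⟩
  choose! θ hθ hθN using hex
  have hgen : ∀ σ : K ≃ₐ[k] K, (∀ a ∈ s₀, σ a = a) →
      (∃ η : Φ ≃+* Φ, IsSemilinear (σ : K ≃+* K) η) ∧ θ σ pb.gen = pb.gen := by
    intro σ hσ
    obtain ⟨η, h1, h2, h3⟩ := hy σ hσ
    refine ⟨⟨η, h1⟩, ?_⟩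
    rw [huniq σ _ _ (hθ σ ⟨η, h1⟩) h1 (hθN σ ⟨η, h1⟩) h2, h3]
  refine ⟨s₀, θ, fun σ hσ => (hgen σ hσ).1, hθ, fun σ τ hσ hτ => ?_, ?_⟩
  · have h1 : IsSemilinear ((σ * τ : K ≃ₐ[k] K) : K ≃+* K) (θ σ * θ τ) := (hθ σ hσ).mul (hθ τ hτ)
    refine huniq (σ * τ) _ _ (hθ _ ⟨_, h1⟩) h1 (hθN _ ⟨_, h1⟩) fun x x' hx => ?_
    rw [hθN σ hσ ⟨θ τ x, (hθ τ hτ).isIntegral x.2⟩ x' hx, hθN τ hτ x _ rfl]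
    rfl
  have hpoly : ∀ p : K[X], ∀ σ : K ≃ₐ[k] K, (∀ a ∈ s₀ ∪ p.coeffs, σ a = a) →
      θ σ (algebraMap K[X] Φ p) = algebraMap K[X] Φ p := by
    intro p σ hσ
    rw [hθ σ (hgen σ fun a ha => hσ a (Finset.mem_union_left _ ha)).1]
    congr 1
    ext j
    rw [Polynomial.coeff_map]
    by_cases hj : p.coeff j = 0
    · rw [hj, map_zero]
    · exact hσ _ (Finset.mem_union_right _ (Polynomial.coeff_mem_coeffs hj))
  -- The functions with open stabilizer form a field. It contains `κ`, by fixing the coefficients of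
  -- numerator and denominator, and the generator, by `s₀`; so it is all of `Φ`.
  let S : IntermediateField κ Φ :=
    { carrier := {x | ∃ s : Finset K, ∀ σ : K ≃ₐ[k] K, (∀ a ∈ s, σ a = a) → θ σ x = x}
      mul_mem' := by
        rintro x x' ⟨s, hs⟩ ⟨s', hs'⟩
        refine ⟨s ∪ s', fun σ h => ?_⟩
        rw [map_mul, hs σ fun a ha => h a (Finset.mem_union_left _ ha),
          hs' σ fun a ha => h a (Finset.mem_union_right _ ha)]
      add_mem' := by
        rintro x x' ⟨s, hs⟩ ⟨s', hs'⟩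
        refine ⟨s ∪ s', fun σ h => ?_⟩
        rw [map_add, hs σ fun a ha => h a (Finset.mem_union_left _ ha),
          hs' σ fun a ha => h a (Finset.mem_union_right _ ha)]
      algebraMap_mem' := by
        intro z
        obtain ⟨p, q, -, rfl⟩ := IsFractionRing.div_surjective (A := K[X]) z
        refine ⟨s₀ ∪ (p.coeffs ∪ q.coeffs), fun σ h => ?_⟩
        rw [map_div₀, map_div₀, ← IsScalarTower.algebraMap_apply K[X] κ Φ,
          ← IsScalarTower.algebraMap_apply K[X] κ Φ, hpoly p σ, hpoly q σ]
        · intro a ha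
          refine h a (Finset.union_subset_union_right Finset.subset_union_right ha)
        · intro a ha
          refine h a (Finset.union_subset_union_right Finset.subset_union_left ha)
      inv_mem' := by
        rintro x ⟨s, hs⟩
        exact ⟨s, fun σ h => by rw [map_inv₀, hs σ h]⟩ }
  intro x
  have h1 : x ∈ Algebra.adjoin κ {pb.gen} := pb.adjoin_gen_eq_top ▸ Algebra.mem_top
  exact Algebra.adjoin_le (S := S.toSubalgebra)
    (Set.singleton_subset_iff.mpr ⟨s₀, fun σ h => (hgen σ h).2⟩) h1

end Semilinear

namespace BranchedCover

/-- Every rational function on the line is a quotient of polynomials in `t`, so the lifting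
condition need only be tested on polynomials. This links covers with the purely algebraic
`IsSemilinear`. -/
theorem isLift_iff {K : Type} [Field K] (C : BranchedCover K) (σ : K ≃+* K)
    (θ : C.FunctionField ≃+* C.FunctionField) :
    C.IsLift σ θ ↔ ∀ p, θ (C.polynomialFunction 0 p) =
      C.polynomialFunction 0 (p.map (σ : K →+* K)) := by
  constructor
  · intro h p
    refine (h _).trans ?_
    rw [baseEquiv_toFunctionField]
    rfl
  · intro h z
    obtain ⟨p, q, hq, hz⟩ := P1.exists_toFunctionField K 0 z
    have hq' : q.map (σ : K →+* K) ≠ 0 := (Polynomial.map_ne_zero_iff σ.injective).mpr hq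
    have hq'' : P1.toFunctionField K 0 (q.map (σ : K →+* K)) ≠ 0 :=
      (map_ne_zero_iff _ (P1.toFunctionField_injective K 0)).mpr hq'
    have h0 : algebraMap (P1 K).functionField C.FunctionField (P1.toFunctionField K 0 (q.map (σ : K →+* K))) ≠ 0 :=
      (map_ne_zero_iff _ (algebraMap (P1 K).functionField C.FunctionField).injective).mpr hq''
    refine mul_right_cancel₀ h0 ?_
    have h1 := congrArg (fun w => θ (algebraMap (P1 K).functionField C.FunctionField w)) hz
    have h2 := congrArg (fun w => algebraMap (P1 K).functionField C.FunctionField (baseEquiv σ w)) hz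
    simp only [map_mul, baseEquiv_toFunctionField] at h1 h2
    rw [h2]
    have h3 := h q
    have h4 := h p
    change θ (algebraMap (P1 K).functionField C.FunctionField _) =
      algebraMap (P1 K).functionField C.FunctionField _ at h3 h4
    rw [h3, h4] at h1
    exact h1

theorem IsLift.apply_polynomialFunction {k K : Type} [Field k] [Field K] [Algebra k K]
    {C : BranchedCover K} {σ : K ≃ₐ[k] K} {θ : C.FunctionField ≃+* C.FunctionField}
    (h : C.IsLift (σ : K ≃+* K) θ) (p : Polynomial K) :
    θ (C.polynomialFunction 0 p) = C.polynomialFunction 0 (p.map (σ : K →+* K)) :=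
  (C.isLift_iff (σ : K ≃+* K) θ).mp h p

/-- The automorphisms of the base field which lift to a Galois cover can be lifted compatibly. -/
theorem exists_lift_action {k K : Type} [Field k] [Infinite k] [Field K] [Algebra k K]
    [IsAlgClosed K] (C : BranchedCover K) (hC : C.IsGaloisCover) :
    ∃ (S : Subgroup (K ≃ₐ[k] K)) (θ : S →* RingAut C.FunctionField),
      (∀ σ : K ≃ₐ[k] K, σ ∈ S ↔ ∃ η, C.IsLift (σ : K ≃+* K) η) ∧
      (∀ σ : S, C.IsLift ((σ : K ≃ₐ[k] K) : K ≃+* K) (θ σ)) ∧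
      (∃ s : Finset K, ∀ σ : K ≃ₐ[k] K, (∀ a ∈ s, σ a = a) → σ ∈ S) ∧
      ∀ x, ∃ s : Finset K, ∀ σ : S, (∀ a ∈ s, (σ : K ≃ₐ[k] K) a = a) → θ σ x = x := by
  let : Algebra (Polynomial K) (P1 K).functionField := (P1.toFunctionField K 0).toAlgebra
  let : Algebra (Polynomial K) C.FunctionField := (C.polynomialFunction 0).toAlgebra
  have : IsScalarTower (Polynomial K) (P1 K).functionField C.FunctionField :=
    .of_algebraMap_eq fun _ => rfl
  have : FaithfulSMul (Polynomial K) (P1 K).functionField :=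
    (faithfulSMul_iff_algebraMap_injective _ _).mpr (P1.toFunctionField_injective K 0)
  have : IsFractionRing (Polynomial K) (P1 K).functionField := by
    refine IsFractionRing.of_field _ _ fun z => ?_
    obtain ⟨p, q, hq, h⟩ := P1.exists_toFunctionField K 0 z
    refine ⟨p, q, ?_⟩
    exact (eq_div_of_mul_eq ((map_ne_zero_iff _ (P1.toFunctionField_injective K 0)).mpr hq) h)
  have : IsGalois (P1 K).functionField C.FunctionField := hC
  obtain ⟨s, θ, h1, h2, h3, h4⟩ :=
    exists_semilinear_action k K (P1 K).functionField C.FunctionField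
  have key : ∀ (σ : K ≃+* K) η, C.IsLift σ η ↔ IsSemilinear σ η := fun σ η => C.isLift_iff σ η
  let S : Subgroup (K ≃ₐ[k] K) :=
    { carrier := {σ | ∃ η, C.IsLift (σ : K ≃+* K) η}
      mul_mem' := by
        rintro σ τ ⟨η, h⟩ ⟨η', h'⟩
        exact ⟨η * η', (key _ _).mpr (((key _ _).mp h).mul ((key _ _).mp h'))⟩
      one_mem' := ⟨RingEquiv.refl _, fun z => congrArg (algebraMap (P1 K).functionField C.FunctionField)
        (baseEquiv_one z).symm⟩
      inv_mem' := by
        rintro σ ⟨η, h⟩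
        exact ⟨η.symm, (key _ _).mpr ((key _ _).mp h).symm⟩ }
  have hS : ∀ σ : S, ∃ η : C.FunctionField ≃+* C.FunctionField,
      IsSemilinear ((σ : K ≃ₐ[k] K) : K ≃+* K) η := fun σ => by
    obtain ⟨η, h⟩ := σ.2
    exact ⟨η, (key _ _).mp h⟩
  refine ⟨S, MonoidHom.mk' (fun σ => θ σ) fun σ τ => h3 σ τ (hS σ) (hS τ), fun σ => Iff.rfl,
    fun σ => (key _ _).mpr (h2 σ (hS σ)), ⟨s, fun σ h => ?_⟩, fun x => ?_⟩
  · obtain ⟨η, h⟩ := h1 σ h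
    exact ⟨η, (key _ _).mpr h⟩
  · obtain ⟨t, ht⟩ := h4 x
    exact ⟨t, fun σ h => ht σ h⟩

end BranchedCover

/-! ### Open subgroups of infinite Galois groups and their fixed fields. -/

section Galois

variable {k K : Type*} [Field k] [Field K] [Algebra k K] [IsGalois k K]

theorem isOpen_of_finset (U : Subgroup (K ≃ₐ[k] K)) (s : Finset K)
    (h : ∀ σ : K ≃ₐ[k] K, (∀ a ∈ s, σ a = a) → σ ∈ U) :
    IsOpen (U : Set (K ≃ₐ[k] K)) := by
  let E := IntermediateField.adjoin k (s : Set K)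
  have : FiniteDimensional k E := IntermediateField.finiteDimensional_adjoin fun x _ =>
    Algebra.IsIntegral.isIntegral x
  refine Subgroup.isOpen_mono (H₁ := E.fixingSubgroup) (fun σ hσ => h σ fun a ha => ?_)
    E.fixingSubgroup_isOpen
  exact (IntermediateField.mem_fixingSubgroup_iff E σ).mp hσ a
    (IntermediateField.subset_adjoin k (s : Set K) ha)

theorem fixingSubgroup_fixedField_of_isOpen (U : Subgroup (K ≃ₐ[k] K))
    (hU : IsOpen (U : Set (K ≃ₐ[k] K))) :
    (IntermediateField.fixedField U).fixingSubgroup = U :=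
  InfiniteGalois.fixingSubgroup_fixedField ⟨U, Subgroup.isClosed_of_isOpen U hU⟩

theorem finiteDimensional_fixedField_of_isOpen (U : Subgroup (K ≃ₐ[k] K))
    (hU : IsOpen (U : Set (K ≃ₐ[k] K))) :
    FiniteDimensional k (IntermediateField.fixedField U) := by
  rw [← InfiniteGalois.isOpen_iff_finite, fixingSubgroup_fixedField_of_isOpen U hU]
  exact hU

/-- The fixed field of the preimage of a normal subgroup. -/
theorem exists_algEquiv_mulEquiv_of_surjective {H : Type*} [Group H] (f : (K ≃ₐ[k] K) →* H)
    (hf : Function.Surjective f) (N : Subgroup H) [N.Normal]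
    (hN : IsOpen ((N.comap f : Subgroup (K ≃ₐ[k] K)) : Set (K ≃ₐ[k] K))) :
    IsGalois k (IntermediateField.fixedField (N.comap f)) ∧
      Nonempty ((IntermediateField.fixedField (N.comap f) ≃ₐ[k]
        IntermediateField.fixedField (N.comap f)) ≃* H ⧸ N) := by
  have h1 := fixingSubgroup_fixedField_of_isOpen _ hN
  refine ⟨?_, ?_⟩
  · rw [← InfiniteGalois.normal_iff_isGalois, h1]
    infer_instance
  · let U : ClosedSubgroup (K ≃ₐ[k] K) := ⟨N.comap f, Subgroup.isClosed_of_isOpen _ hN⟩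
    have : U.toSubgroup.Normal := inferInstanceAs (N.comap f).Normal
    let q : (K ≃ₐ[k] K) →* H ⧸ N := (QuotientGroup.mk' N).comp f
    have hq : q.ker = N.comap f := by
      rw [← MonoidHom.comap_ker, QuotientGroup.ker_mk']
    exact ⟨(InfiniteGalois.normalAutEquivQuotient U).symm.trans
      ((QuotientGroup.quotientMulEquivOfEq hq.symm).trans
        (QuotientGroup.quotientKerEquivOfSurjective q
          ((QuotientGroup.mk'_surjective N).comp hf)))⟩

end Galois

/-! ### Conjugation actions and semidirect products. -/

section Conjugation

variable {A G Γ : Type*} [Group A] [Group G] [Group Γ]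

theorem exists_conj_action (ι : G →* A) (hι : Function.Injective ι) (θ : Γ →* A)
    (h : ∀ σ g, θ σ * ι g * (θ σ)⁻¹ ∈ ι.range) :
    ∃ c : Γ →* MulAut G, ∀ σ g, ι (c σ g) = θ σ * ι g * (θ σ)⁻¹ := by
  choose f hf using h
  have hmul : ∀ σ τ g, f (σ * τ) g = f σ (f τ g) := fun σ τ g => hι (by
    rw [hf, hf, hf, map_mul, mul_inv_rev]
    group)
  have hone : ∀ g, f 1 g = g := fun g => hι (by rw [hf, map_one]; group)
  refine ⟨MonoidHom.mk' (fun σ =>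
    { toFun := f σ
      invFun := f σ⁻¹
      left_inv := fun g => by rw [← hmul, inv_mul_cancel, hone]
      right_inv := fun g => by rw [← hmul, mul_inv_cancel, hone]
      map_mul' := fun g g' => hι (by rw [map_mul, hf, hf, hf, map_mul]; group) })
    fun σ τ => MulEquiv.ext fun g => hmul σ τ g, fun σ g => hf σ g⟩

/-- The semidirect product is the image of an action with the right kernel. -/
theorem nonempty_mulEquiv_range (c : Γ →* MulAut G) (f : G ⋊[c] Γ →* A)
    (hf : ∀ x, f x = 1 ↔ x.left = 1 ∧ c x.right = 1) :
    Nonempty (f.range ≃* G ⋊[c.range.subtype] c.range) := by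
  let q : G ⋊[c] Γ →* G ⋊[c.range.subtype] c.range :=
    SemidirectProduct.map (MonoidHom.id G) c.rangeRestrict fun σ => rfl
  have hq : Function.Surjective q := by
    rintro ⟨g, ⟨_, σ, rfl⟩⟩
    exact ⟨⟨g, σ⟩, rfl⟩
  -- Both homomorphisms out of `G ⋊ Γ` have the same kernel, so their images are isomorphic.
  have hk : f.ker = q.ker := by
    ext x
    rw [MonoidHom.mem_ker, hf, MonoidHom.mem_ker, SemidirectProduct.ext_iff, Subtype.ext_iff]
    rfl
  exact ⟨(QuotientGroup.quotientKerEquivRange f).symm.trans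
    ((QuotientGroup.quotientMulEquivOfEq hk).trans
      (QuotientGroup.quotientKerEquivOfSurjective q hq))⟩

end Conjugation

/-! ### The conjugation action on `G` and Galois models. -/

namespace GaloisCover

variable {G : Type*} [Group G] (C : GaloisCover G)

/-- The action of `G` on the function field of a `G`-Galois branched cover. -/
noncomputable def galAction : G →* RingAut C.FunctionField where
  toFun g := (C.galEquiv.symm g).toRingEquiv
  map_one' := by rw [map_one]; rfl
  map_mul' g g' := by rw [map_mul]; rfl

theorem galAction_apply (g : G) (z : C.FunctionField) :
    C.galAction g z = C.galEquiv.symm g z := rfl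

theorem galAction_algebraMap (g : G) (z : (P1 Qbar).functionField) :
    C.galAction g (algebraMap _ C.FunctionField z) = algebraMap _ C.FunctionField z :=
  (C.galEquiv.symm g).commutes z

theorem galAction_injective : Function.Injective C.galAction := fun _ _ h =>
  C.galEquiv.symm.injective (AlgEquiv.ext fun z => congrArg (fun f => f z) h)

theorem mem_range_galAction {η : RingAut C.FunctionField}
    (h : ∀ z : (P1 Qbar).functionField,
      η (algebraMap _ C.FunctionField z) = algebraMap _ C.FunctionField z) :
    η ∈ C.galAction.range := by
  refine ⟨C.galEquiv (AlgEquiv.ofRingEquiv (f := η) h), RingEquiv.ext fun z => ?_⟩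
  rw [galAction_apply, MulEquiv.symm_apply_apply]
  rfl

/-- Conjugating by a lift of `τ` undoes and redoes the action of `τ` on `κ(ℙ¹)`, so the result is
again an automorphism over `κ(ℙ¹)`. -/
theorem conj_mem_range_galAction {τ : Qbar ≃+* Qbar} {η : RingAut C.FunctionField}
    (h : C.IsLift τ η) (g : G) : η * C.galAction g * η⁻¹ ∈ C.galAction.range := by
  refine C.mem_range_galAction fun z => ?_
  have h1 : η⁻¹ (algebraMap (P1 Qbar).functionField C.FunctionField z) =
      algebraMap (P1 Qbar).functionField C.FunctionField ((BranchedCover.baseEquiv τ).symm z) := by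
    change η.symm _ = _
    rw [RingEquiv.symm_apply_eq, h, RingEquiv.apply_symm_apply]
  rw [RingAut.mul_apply, RingAut.mul_apply, h1, galAction_algebraMap, h,
    RingEquiv.apply_symm_apply]

variable {L : Type} [Field L] [Algebra L Qbar]

/-- The action on `G` by conjugation of a Galois group acting on a `G`-Galois branched cover. -/
theorem exists_conj_hom [Finite G] (θ : (Qbar ≃ₐ[L] Qbar) →* RingAut C.FunctionField)
    (hlift : ∀ σ : Qbar ≃ₐ[L] Qbar, C.IsLift (σ : Qbar ≃+* Qbar) (θ σ))
    (hsmooth : ∀ x, ∃ s : Finset Qbar, ∀ σ : Qbar ≃ₐ[L] Qbar, (∀ a ∈ s, σ a = a) → θ σ x = x) :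
    ∃ c : (Qbar ≃ₐ[L] Qbar) →* MulAut G,
      (∀ σ g, C.galAction (c σ g) = θ σ * C.galAction g * (θ σ)⁻¹) ∧
      ∃ s : Finset Qbar, ∀ σ : Qbar ≃ₐ[L] Qbar, (∀ a ∈ s, σ a = a) → c σ = 1 := by
  classical
  obtain ⟨c, hc⟩ := exists_conj_action C.galAction C.galAction_injective θ
    fun σ g => C.conj_mem_range_galAction (hlift σ) g
  refine ⟨c, hc, ?_⟩
  have : IsGalois (P1 Qbar).functionField C.FunctionField := C.isGaloisCover
  obtain ⟨y, hy⟩ := Field.exists_primitive_element (P1 Qbar).functionField C.FunctionField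
  choose s hs using hsmooth
  have := Fintype.ofFinite G
  -- If `σ` is close enough to `1` that its lift fixes all conjugates of a primitive element `y`,
  -- then `c σ g` and `g` agree at `y`, hence everywhere; so `c` is trivial on an open subgroup.
  refine ⟨Finset.univ.biUnion fun g : G => s (C.galAction g y), fun σ hσ => ?_⟩
  have h1 : ∀ g, θ σ (C.galAction g y) = C.galAction g y := fun g => hs _ σ fun a ha =>
    hσ a (Finset.mem_biUnion.mpr ⟨g, Finset.mem_univ _, ha⟩)
  refine MulEquiv.ext fun g => ?_
  have h2 : C.galAction (c σ g) y = C.galAction g y := by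
    have h3 : (θ σ)⁻¹ y = y := by
      change (θ σ).symm y = y
      rw [RingEquiv.symm_apply_eq]
      have := h1 1
      rw [map_one] at this
      exact this.symm
    rw [hc, RingAut.mul_apply, RingAut.mul_apply, h3, h1]
  refine C.galEquiv.symm.injective (AlgEquiv.coe_toAlgHom_injective ?_)
  refine AlgHom.ext fun x => ?_
  have h4 : x ∈ IntermediateField.adjoin (P1 Qbar).functionField {y} := hy ▸ IntermediateField.mem_top
  have h5 : IntermediateField.adjoin (P1 Qbar).functionField {y} ≤
      { __ := AlgHom.equalizer (C.galEquiv.symm (c σ g)).toAlgHom (C.galEquiv.symm g).toAlgHom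
        inv_mem' := fun a ha => by
          change _ = _ at ha
          change _ = _
          rw [map_inv₀, map_inv₀, ha] } := by
    rw [IntermediateField.adjoin_simple_le_iff]
    exact h2
  exact h5 h4

variable [IsGalois L Qbar]

/-- `E` is the fixed field of the kernel of the conjugation action `c`. Over `E` the semilinear
action commutes with `G`, so the descended cover is Galois, and the Galois group of `E` over `L` is
the range of `c`. -/
theorem exists_isFieldOfDefinition [Finite G] (θ : (Qbar ≃ₐ[L] Qbar) →* RingAut C.FunctionField)
    (hlift : ∀ σ : Qbar ≃ₐ[L] Qbar, C.IsLift (σ : Qbar ≃+* Qbar) (θ σ))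
    (hsmooth : ∀ x, ∃ s : Finset Qbar, ∀ σ : Qbar ≃ₐ[L] Qbar, (∀ a ∈ s, σ a = a) → θ σ x = x) :
    ∃ E : IntermediateField L Qbar, FiniteDimensional L E ∧ IsGalois L E ∧
      C.IsFieldOfDefinition E ∧ ∃ H : Subgroup (MulAut G), Nonempty ((E ≃ₐ[L] E) ≃* H) := by
  obtain ⟨c, hc, s, hs⟩ := C.exists_conj_hom θ hlift hsmooth
  let f := c.rangeRestrict
  have hf : (⊥ : Subgroup c.range).comap f = c.ker := by
    rw [MonoidHom.comap_bot, MonoidHom.ker_rangeRestrict]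
  have hopen : IsOpen (((⊥ : Subgroup c.range).comap f : Subgroup _) : Set (Qbar ≃ₐ[L] Qbar)) := by
    rw [hf]
    exact isOpen_of_finset _ s hs
  let E := IntermediateField.fixedField ((⊥ : Subgroup c.range).comap f)
  obtain ⟨h1, ⟨e⟩⟩ := exists_algEquiv_mulEquiv_of_surjective f c.rangeRestrict_surjective ⊥ hopen
  refine ⟨E, finiteDimensional_fixedField_of_isOpen _ hopen, h1, ?_, c.range,
    ⟨e.trans QuotientGroup.quotientBot⟩⟩
  have hE : ∀ σ : Qbar ≃ₐ[E] Qbar, c (σ.restrictScalars L) = 1 := by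
    intro σ
    rw [← MonoidHom.mem_ker, ← hf, ← fixingSubgroup_fixedField_of_isOpen _ hopen]
    exact (IntermediateField.mem_fixingSubgroup_iff _ _).mpr fun x hx => σ.commutes ⟨x, hx⟩
  obtain ⟨D, hD, hgal⟩ := C.toBranchedCover.exists_isModel (k := E)
    (fun σ => θ (σ.restrictScalars L))
    (fun σ τ x => by
      rw [← RingAut.mul_apply, ← map_mul]
      rfl)
    (fun σ => hlift _)
    (fun x => by
      obtain ⟨t, ht⟩ := hsmooth x
      exact ⟨t, fun σ h => ht _ h⟩)
  refine ⟨D, hD, hgal C.isGaloisCover fun σ g x => ?_⟩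
  have h2 := hc (σ.restrictScalars L) (C.galEquiv g)
  rw [hE, MulAut.one_apply, eq_mul_inv_iff_mul_eq] at h2
  have h3 := congrArg (fun f => f x) h2
  simp only [RingAut.mul_apply, galAction_apply, MulEquiv.symm_apply_apply] at h3
  exact h3.symm

end GaloisCover

theorem exists_restrict_ringAut {Γ Φ : Type*} [Group Γ] [Field Φ] (Ψ : Γ →* RingAut Φ)
    (Φ' : Subfield Φ) (h : ∀ x, ∀ z ∈ Φ', Ψ x z ∈ Φ') :
    ∃ f : Γ →* RingAut Φ', ∀ x z, (f x z : Φ) = Ψ x z := by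
  let r (x : Γ) : Φ' →+* Φ' := ((Ψ x : Φ →+* Φ).comp Φ'.subtype).codRestrict Φ' fun z => h x z z.2
  have hmul : ∀ x y, (r x).comp (r y) = r (x * y) := fun x y => RingHom.ext fun z =>
    Subtype.ext (by
      change Ψ x (Ψ y z) = Ψ (x * y) z
      rw [map_mul]
      rfl)
  have hone : r 1 = RingHom.id _ := RingHom.ext fun z => Subtype.ext (by
    change Ψ 1 z = z
    rw [map_one]
    rfl)
  refine ⟨MonoidHom.mk' (fun x => RingEquiv.ofRingHom (r x) (r x⁻¹) ?_ ?_) fun x y => ?_,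
    fun x z => rfl⟩
  · rw [hmul, mul_inv_cancel, hone]
  · rw [hmul, inv_mul_cancel, hone]
  · exact RingEquiv.ext fun z => congrArg (fun f => f z) (hmul x y).symm

theorem map_fixed_of_normal {Γ Φ : Type*} [Group Γ] [Field Φ] (θ : Γ →* RingAut Φ)
    (N : Subgroup Γ) [N.Normal] (σ : Γ) {z : Φ} (hz : ∀ τ ∈ N, θ τ z = z) (τ : Γ) (hτ : τ ∈ N) :
    θ τ (θ σ z) = θ σ z := by
  have h1 : σ⁻¹ * τ * σ ∈ N := by simpa using Subgroup.Normal.conj_mem inferInstance τ hτ σ⁻¹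
  have h2 : θ τ * θ σ = θ σ * θ (σ⁻¹ * τ * σ) := by
    rw [← map_mul, ← map_mul]
    congr 1
    group
  exact (congrArg (fun f => f z) h2).trans (congrArg (θ σ) (hz _ h1))

/-! ### Realizing the semidirect product as a Galois group. -/

namespace GaloisCover

variable {G : Type*} [Group G] (C : GaloisCover G) {L : Type} [Field L] [Algebra L Qbar]
  [IsGalois L Qbar]

theorem polynomialFunction_C_injective :
    Function.Injective fun a => C.polynomialFunction 0 (Polynomial.C a) :=
  ((C.polynomialFunction 0).comp Polynomial.C).injective

/-- The functions fixed by an open subgroup are not all fixed by a nontrivial element of `G`. -/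
theorem eq_one_of_fixed (U : Subgroup (Qbar ≃ₐ[L] Qbar))
    (hU : IsOpen (U : Set (Qbar ≃ₐ[L] Qbar)))
    (θ : (Qbar ≃ₐ[L] Qbar) →* RingAut C.FunctionField)
    (hlift : ∀ σ : Qbar ≃ₐ[L] Qbar, C.IsLift (σ : Qbar ≃+* Qbar) (θ σ))
    (hsmooth : ∀ x, ∃ s : Finset Qbar, ∀ σ : Qbar ≃ₐ[L] Qbar, (∀ a ∈ s, σ a = a) → θ σ x = x)
    (g : G) (hg : ∀ z, (∀ σ ∈ U, θ σ z = z) → C.galAction g z = z) : g = 1 := by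
  let E := IntermediateField.fixedField U
  have hE : E.fixingSubgroup = U := fixingSubgroup_fixedField_of_isOpen U hU
  let : Algebra Qbar C.FunctionField := ((C.polynomialFunction 0).comp Polynomial.C).toAlgebra
  have hsmul : ∀ (a : Qbar) (x : C.FunctionField), a • x =
      algebraMap (P1 Qbar).functionField C.FunctionField
        (P1.toFunctionField Qbar 0 (Polynomial.C a)) * x := fun a x => Algebra.smul_def a x
  -- By descent the functions fixed by `U` span the function field over `ℚ̄`. The action of `g` is
  -- `ℚ̄`-linear, so it is determined by its effect on them.
  have hspan := span_fixed_eq_top (k := E) (K := Qbar) (V := C.FunctionField)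
    (fun σ => (θ (σ.restrictScalars L) : C.FunctionField →+* C.FunctionField).toAddMonoidHom)
    (fun σ τ v => by
      change θ ((σ * τ).restrictScalars L) v = (θ (σ.restrictScalars L) * θ (τ.restrictScalars L)) v
      rw [← map_mul]
      rfl)
    (fun σ a v => by
      change θ (σ.restrictScalars L) (a • v) = σ a • θ (σ.restrictScalars L) v
      rw [hsmul, hsmul, map_mul, hlift, BranchedCover.baseEquiv_toFunctionField, Polynomial.map_C]
      rfl)
    (fun v => by
      obtain ⟨t, ht⟩ := hsmooth v
      exact ⟨t, fun σ h => ht _ h⟩)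
  let l : C.FunctionField →ₗ[Qbar] C.FunctionField :=
    { toFun := C.galAction g
      map_add' := map_add _
      map_smul' := fun a x => by
        rw [hsmul, hsmul, map_mul, galAction_algebraMap]
        rfl }
  have h1 : l = LinearMap.id := LinearMap.ext_on hspan fun z hz => hg z fun σ hσ => by
    rw [← hE] at hσ
    exact hz (IntermediateField.fixingSubgroupEquiv E ⟨σ, hσ⟩)
  refine C.galAction_injective ?_
  rw [map_one]
  exact RingEquiv.ext fun z => congrArg (fun f => f z) h1

/-- The group `G ⋊ Gal(ℚ̄/L)` acts on the function field and preserves the subfield `Φ'` fixed by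
`ker c`, which commutes with `G`. On `Φ'` it acts through `G ⋊ range c`, a finite group with fixed
field `L(t)`, so Hilbert's theorem applies. -/
theorem exists_isGalois_semidirectProduct [NumberField L] [Finite G]
    (θ : (Qbar ≃ₐ[L] Qbar) →* RingAut C.FunctionField)
    (hlift : ∀ σ : Qbar ≃ₐ[L] Qbar, C.IsLift (σ : Qbar ≃+* Qbar) (θ σ))
    (hsmooth : ∀ x, ∃ s : Finset Qbar, ∀ σ : Qbar ≃ₐ[L] Qbar, (∀ a ∈ s, σ a = a) → θ σ x = x) :
    ∃ (H : Subgroup (MulAut G)) (N : IntermediateField L Qbar),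
      FiniteDimensional L N ∧ IsGalois L N ∧ Nonempty ((N ≃ₐ[L] N) ≃* G ⋊[H.subtype] H) := by
  obtain ⟨c, hc, s, hs⟩ := C.exists_conj_hom θ hlift hsmooth
  have hopen : IsOpen (c.ker : Set (Qbar ≃ₐ[L] Qbar)) := isOpen_of_finset _ s hs
  obtain ⟨Ψ, hΨ⟩ : ∃ Ψ : G ⋊[c] (Qbar ≃ₐ[L] Qbar) →* RingAut C.FunctionField,
      ∀ x z, Ψ x z = C.galAction x.left (θ x.right z) :=
    ⟨SemidirectProduct.lift C.galAction θ fun σ => MonoidHom.ext fun g => hc σ g, fun _ _ => rfl⟩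
  obtain ⟨Φ', hΦ'⟩ : ∃ Φ' : Subfield C.FunctionField, ∀ z, z ∈ Φ' ↔ ∀ σ ∈ c.ker, θ σ z = z :=
    ⟨{carrier := {z | ∀ σ ∈ c.ker, θ σ z = z}
      mul_mem' := fun ha hb σ hσ => by rw [map_mul, ha σ hσ, hb σ hσ]
      one_mem' := fun σ _ => map_one _
      add_mem' := fun ha hb σ hσ => by rw [map_add, ha σ hσ, hb σ hσ]
      zero_mem' := fun σ _ => map_zero _
      neg_mem' := fun ha σ hσ => by rw [map_neg, ha σ hσ]
      inv_mem' := fun a ha σ hσ => by rw [map_inv₀, ha σ hσ] }, fun _ => Iff.rfl⟩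
  have hcomm : ∀ τ ∈ c.ker, ∀ g z, θ τ (C.galAction g z) = C.galAction g (θ τ z) := by
    intro τ hτ g z
    have h1 := hc τ g
    rw [MonoidHom.mem_ker.mp hτ, MulAut.one_apply, eq_mul_inv_iff_mul_eq] at h1
    exact (congrArg (fun f => f z) h1).symm
  have hpres : ∀ x, ∀ z ∈ Φ', Ψ x z ∈ Φ' := by
    intro x z hz
    rw [hΦ'] at hz ⊢
    intro τ hτ
    rw [hΨ, hcomm τ hτ]
    exact congrArg _ (map_fixed_of_normal θ c.ker x.right hz τ hτ)
  obtain ⟨f, hf⟩ := exists_restrict_ringAut Ψ Φ' hpres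
  have hθp : ∀ (σ : Qbar ≃ₐ[L] Qbar) (p : Polynomial Qbar), θ σ (C.polynomialFunction 0 p) =
      C.polynomialFunction 0 (p.map (σ : Qbar →+* Qbar)) := fun σ p =>
    (hlift σ).apply_polynomialFunction p
  have hker : ∀ x, f x = 1 ↔ x.left = 1 ∧ c x.right = 1 := by
    intro x
    constructor
    · intro hx
      have hx' : ∀ z ∈ Φ', C.galAction x.left (θ x.right z) = z := fun z hz => by
        rw [← hΨ, ← hf x ⟨z, hz⟩, hx]
        rfl
      -- Constants fixed by `ker c` belong to `Φ'`, and there `G` acts trivially. So the Galois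
      -- component fixes the fixed field of `ker c`, and by openness lies in `ker c`.
      have h1 : x.right ∈ c.ker := by
        rw [← fixingSubgroup_fixedField_of_isOpen _ hopen, IntermediateField.mem_fixingSubgroup_iff]
        intro a ha
        have h2 := hx' (C.polynomialFunction 0 (Polynomial.C a)) ((hΦ' _).mpr fun τ hτ => by
          rw [hθp, Polynomial.map_C]
          congr 2
          exact (IntermediateField.mem_fixedField_iff _ _).mp ha τ hτ)
        rw [hθp, Polynomial.map_C] at h2
        exact C.polynomialFunction_C_injective ((C.galAction_algebraMap _ _).symm.trans h2)
      refine ⟨C.eq_one_of_fixed c.ker hopen θ hlift hsmooth x.left fun z hz => ?_, h1⟩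
      conv_lhs => rw [← hz _ h1]
      exact hx' z ((hΦ' z).mpr hz)
    · rintro ⟨h1, h2⟩
      refine RingEquiv.ext fun z => Subtype.ext ?_
      rw [hf, hΨ, h1, map_one]
      exact (hΦ' _).mp z.2 x.right h2
  obtain ⟨e⟩ := nonempty_mulEquiv_range c f hker
  have : Finite (MulAut G) := Finite.of_injective (fun f : MulAut G => (f : G → G))
    DFunLike.coe_injective
  have : Finite (G ⋊[c.range.subtype] c.range) := Finite.of_equiv _ SemidirectProduct.equivProd.symm
  have : Finite f.range := Finite.of_equiv _ e.symm.toEquiv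
  let : Algebra (Polynomial L) Φ' := (((C.polynomialFunction 0).comp
    (Polynomial.mapRingHom (algebraMap L Qbar))).codRestrict Φ' fun p => (hΦ' _).mpr fun τ _ => by
      rw [RingHom.comp_apply, hθp, Polynomial.coe_mapRingHom, Polynomial.map_map]
      congr 2
      exact RingHom.ext fun a => τ.commutes a).toAlgebra
  have halg : ∀ p : Polynomial L, (algebraMap (Polynomial L) Φ' p : C.FunctionField) =
      C.polynomialFunction 0 (p.map (algebraMap L Qbar)) := fun p => rfl
  have : FaithfulSMul (Polynomial L) Φ' := (faithfulSMul_iff_algebraMap_injective _ _).mpr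
    fun p q h => by
      have h1 := congrArg (fun z : Φ' => (z : C.FunctionField)) h
      simp only [halg] at h1
      exact Polynomial.map_injective _ (algebraMap L Qbar).injective
        (P1.toFunctionField_injective Qbar 0
          ((algebraMap (P1 Qbar).functionField C.FunctionField).injective h1))
  have hfp : ∀ x p, f x (algebraMap (Polynomial L) Φ' p) = algebraMap _ _ p := fun x p => by
    refine Subtype.ext ?_
    rw [hf, hΨ, halg, hθp, Polynomial.map_map]
    refine (C.galAction_algebraMap _ _).trans ?_
    change C.polynomialFunction 0 _ = _
    congr 2
    exact RingHom.ext fun a => x.right.commutes a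
  have : SMulCommClass f.range (Polynomial L) Φ' := ⟨by
    rintro ⟨_, x, rfl⟩ p z
    change f x (p • z) = p • f x z
    rw [Algebra.smul_def, Algebra.smul_def, map_mul, hfp]⟩
  -- An invariant of the whole group is fixed by `G`, hence lies in `ℚ̄(t)`, and is fixed by
  -- `Gal(ℚ̄/L)`, hence lies in `L(t)`.
  obtain ⟨N, h1, h2, ⟨e'⟩⟩ := exists_isGalois_of_fixed (L := L) (Φ := Φ') (𝒢 := f.range)
    (fun z hz => by
      have hz' : ∀ x, Ψ x (z : C.FunctionField) = z := fun x => by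
        rw [← hf]
        exact congrArg _ (hz ⟨f x, x, rfl⟩)
      have : IsGalois (P1 Qbar).functionField C.FunctionField := C.isGaloisCover
      obtain ⟨w, hw⟩ := (IsGalois.mem_bot_iff_fixed (F := (P1 Qbar).functionField)
        (z : C.FunctionField)).mpr fun g => by
          have h3 := hz' (SemidirectProduct.inl (C.galEquiv g))
          rw [hΨ, SemidirectProduct.right_inl, SemidirectProduct.left_inl, map_one,
            galAction_apply, MulEquiv.symm_apply_apply] at h3
          exact h3
      change algebraMap (P1 Qbar).functionField C.FunctionField w = z at hw
      obtain ⟨v, hv⟩ := BranchedCover.exists_functionFieldMap_eq (k := L) w fun σ => by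
        refine (algebraMap (P1 Qbar).functionField C.FunctionField).injective ?_
        rw [← hlift σ, hw]
        have h3 := hz' (SemidirectProduct.inr σ)
        rw [hΨ, SemidirectProduct.left_inr, map_one] at h3
        exact h3
      obtain ⟨p, q, hq, h⟩ := P1.exists_toFunctionField L 0 v
      refine ⟨p, q, hq, Subtype.ext ?_⟩
      change (z : C.FunctionField) * algebraMap (Polynomial L) Φ' q = algebraMap (Polynomial L) Φ' p
      rw [halg, halg, ← hw, ← hv]
      have h4 := congrArg (fun u => algebraMap (P1 Qbar).functionField C.FunctionField
        (functionFieldMap (P1.map (algebraMap L Qbar)) u)) h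
      simp only [map_mul, P1.functionFieldMap_toFunctionField] at h4
      exact h4) Qbar
  exact ⟨c.range, N, h1, h2, ⟨e'.trans e⟩⟩

end GaloisCover

instance : IsGalois ℚ Qbar := by
  have : Algebra.IsAlgebraic ℚ Qbar := ⟨fun x => by
    obtain ⟨p, hp, h⟩ := (AlgebraicClosure.isAlgebraic ℚ).isAlgebraic x
    refine ⟨p, hp, ?_⟩
    rw [Polynomial.aeval_def] at h ⊢
    -- Ring homomorphisms out of `ℚ` are unique, so the choice of `ℚ`-algebra structure does not
    -- matter.
    exact (congrArg (fun f => p.eval₂ f x) (Subsingleton.elim _ _)).trans h⟩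
  have : Normal ℚ Qbar := normal_iff.mpr fun x =>
    ⟨Algebra.IsIntegral.isIntegral x, IsAlgClosed.splits _⟩
  exact ⟨⟩

/-! ### Fields of moduli and fields of definition. -/

namespace GaloisCover

variable {G : Type*} [Group G] (C : GaloisCover G)

/-- The Galois group of a field containing the field of moduli acts on the function field of the
cover. -/
theorem exists_galois_action :
    FiniteDimensional ℚ C.mereFieldOfModuli ∧
    ∀ L : IntermediateField ℚ Qbar, C.mereFieldOfModuli ≤ L →
      ∃ θ : (Qbar ≃ₐ[L] Qbar) →* RingAut C.FunctionField,
        (∀ σ : Qbar ≃ₐ[L] Qbar, C.IsLift (σ : Qbar ≃+* Qbar) (θ σ)) ∧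
        ∀ x, ∃ s : Finset Qbar, ∀ σ : Qbar ≃ₐ[L] Qbar, (∀ a ∈ s, σ a = a) → θ σ x = x := by
  obtain ⟨S, θ, h1, h2, ⟨s, hs⟩, h4⟩ :=
    C.toBranchedCover.exists_lift_action (k := ℚ) C.isGaloisCover
  have hF : C.mereFieldOfModuli = IntermediateField.fixedField S := by
    ext x
    rw [IntermediateField.mem_fixedField_iff]
    refine forall_congr' fun σ => imp_congr_left ?_
    rw [h1]
    exact C.toBranchedCover.isIsomorphic_twist_iff _
  have hS : IsOpen (S : Set (Qbar ≃ₐ[ℚ] Qbar)) := isOpen_of_finset S s hs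
  refine ⟨hF ▸ finiteDimensional_fixedField_of_isOpen S hS, fun L hL => ?_⟩
  -- The liftable automorphisms form an open subgroup `S`, so every automorphism that fixes the
  -- field of moduli pointwise lies in `S`; for a general subgroup only its closure would be
  -- recovered.
  have hL' : ∀ σ : Qbar ≃ₐ[L] Qbar, σ.restrictScalars ℚ ∈ S := fun σ => by
    rw [← fixingSubgroup_fixedField_of_isOpen S hS, ← hF, IntermediateField.mem_fixingSubgroup_iff]
    exact fun x hx => σ.commutes ⟨x, hL hx⟩
  let r : (Qbar ≃ₐ[L] Qbar) →* S := MonoidHom.mk' (fun σ => ⟨σ.restrictScalars ℚ, hL' σ⟩)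
    fun σ τ => rfl
  refine ⟨θ.comp r, fun σ => h2 (r σ), fun x => ?_⟩
  obtain ⟨t, ht⟩ := h4 x
  exact ⟨t, fun σ h => ht (r σ) h⟩

/-- A model over `L` makes every automorphism over `L` preserve the isomorphism class, so elements
of the field of moduli are fixed by `Gal(ℚ̄/L)`. Conversely the compatible lifts give descent data
over `L`. Finiteness of `L` over `ℚ` plays no role. -/
theorem isMereFieldOfDefinition_iff (L : IntermediateField ℚ Qbar) :
    C.IsMereFieldOfDefinition L ↔ C.mereFieldOfModuli ≤ L := by
  constructor
  · rintro ⟨D, hD⟩ x hx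
    rw [← InfiniteGalois.fixedField_fixingSubgroup L, IntermediateField.mem_fixedField_iff]
    intro σ hσ
    exact hx σ (hD.isIsomorphic_twist (IntermediateField.fixingSubgroupEquiv L ⟨σ, hσ⟩))
  · intro h
    obtain ⟨θ, h1, h2⟩ := C.exists_galois_action.2 L h
    obtain ⟨D, hD, -⟩ := C.toBranchedCover.exists_isModel (k := L) (fun σ => θ σ)
      (fun σ τ x => by rw [map_mul, RingAut.mul_apply]) h1 h2
    exact ⟨D, hD⟩

theorem mereFieldOfModuli_le_fieldOfModuli : C.mereFieldOfModuli ≤ C.fieldOfModuli := by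
  intro x hx σ hσ
  obtain ⟨η, h1, -⟩ := hσ
  exact hx σ ⟨η, h1⟩

/-- An automorphism fixes the isomorphism class of a `G`-Galois branched cover if and only if it
acts on `G` by an inner automorphism. -/
theorem isIsomorphic_twist_iff_mem_range_conj (σ : Qbar ≃ₐ[ℚ] Qbar) (θ : RingAut C.FunctionField) (h : C.IsLift (σ : Qbar ≃+* Qbar) θ)
    (c : MulAut G) (hc : ∀ g, C.galAction (c g) = θ * C.galAction g * θ⁻¹) :
    (C.twist σ).IsIsomorphic C ↔ c ∈ (MulAut.conj (G := G)).range := by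
  rw [isIsomorphic_twist_iff]
  constructor
  · rintro ⟨η, h1, h2⟩
    have h3 : ∀ g, η * C.galAction g * η⁻¹ = C.galAction g := fun g => by
      rw [mul_inv_eq_iff_eq_mul]
      exact RingEquiv.ext fun z => h2 g z
    -- Two lifts of the same `σ` differ by an element `b` of `G`. If one of them commutes with `G`,
    -- conjugation by the other is conjugation by `b`; in the other direction, dividing by `b`
    -- yields a commuting lift.
    obtain ⟨b, hb⟩ := C.mem_range_galAction (η := θ * η⁻¹) fun z => by
      have h4 : η⁻¹ (algebraMap (P1 Qbar).functionField C.FunctionField z) =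
          algebraMap (P1 Qbar).functionField C.FunctionField
            ((BranchedCover.baseEquiv (σ : Qbar ≃+* Qbar)).symm z) := by
        change η.symm _ = _
        rw [RingEquiv.symm_apply_eq, h1, RingEquiv.apply_symm_apply]
      rw [RingAut.mul_apply, h4, h, RingEquiv.apply_symm_apply]
    refine ⟨b, MulEquiv.ext fun g => C.galAction_injective ?_⟩
    rw [MulAut.conj_apply, map_mul, map_mul, map_inv, hb, hc]
    conv_lhs => rw [← h3 g]
    group
  · rintro ⟨b, rfl⟩
    refine ⟨(C.galAction b)⁻¹ * θ, fun z => ?_, fun g z => ?_⟩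
    · rw [← map_inv, RingAut.mul_apply, h, galAction_algebraMap]
    · have h3 : (C.galAction b)⁻¹ * θ * C.galAction g = C.galAction g * ((C.galAction b)⁻¹ * θ) := by
        have h4 := hc g
        rw [MulAut.conj_apply, map_mul, map_mul, map_inv, eq_mul_inv_iff_mul_eq] at h4
        rw [mul_assoc, ← h4]
        group
      exact congrArg (fun f => f z) h3

/-- Let `c` be the conjugation action of the Galois group over the mere field of moduli. The larger
field of moduli is the fixed field of the preimage under `c` of the inner automorphisms, so the
relative Galois group is the range of `c` modulo its inner automorphisms. -/
theorem exists_isGalois_fieldOfModuli [Finite G] :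
    FiniteDimensional ℚ C.fieldOfModuli ∧
    ∃ h : C.mereFieldOfModuli ≤ C.fieldOfModuli,
      IsGalois C.mereFieldOfModuli (IntermediateField.extendScalars h) ∧
        ∃ (H : Subgroup (MulAut G)) (N : Subgroup H) (_ : N.Normal),
          Nonempty ((IntermediateField.extendScalars h ≃ₐ[C.mereFieldOfModuli]
            IntermediateField.extendScalars h) ≃* H ⧸ N) := by
  obtain ⟨hfin, hact⟩ := C.exists_galois_action
  obtain ⟨θ, hlift, hsmooth⟩ := hact _ le_rfl
  obtain ⟨c, hc, s, hs⟩ := C.exists_conj_hom θ hlift hsmooth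
  let I : Subgroup (MulAut G) := (MulAut.conj (G := G)).range
  have hI : I.Normal := ⟨by
    rintro _ ⟨b, rfl⟩ f
    refine ⟨f b, MulEquiv.ext fun g => ?_⟩
    simp [MulAut.conj_apply]⟩
  let N : Subgroup c.range := I.comap c.range.subtype
  have hN : ∀ σ, σ ∈ N.comap c.rangeRestrict ↔ c σ ∈ I := fun σ => Iff.rfl
  have hopen : IsOpen ((N.comap c.rangeRestrict : Subgroup _) :
      Set (Qbar ≃ₐ[C.mereFieldOfModuli] Qbar)) :=
    isOpen_of_finset _ s fun σ hσ => by
      rw [hN, hs σ hσ]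
      exact one_mem I
  let h := C.mereFieldOfModuli_le_fieldOfModuli
  have hM : IntermediateField.extendScalars h =
      IntermediateField.fixedField (N.comap c.rangeRestrict) := by
    ext x
    rw [IntermediateField.mem_extendScalars, IntermediateField.mem_fixedField_iff]
    have key : ∀ σ : Qbar ≃ₐ[C.mereFieldOfModuli] Qbar,
        (C.twist (σ.restrictScalars ℚ)).IsIsomorphic C ↔ c σ ∈ I := fun σ =>
      C.isIsomorphic_twist_iff_mem_range_conj (σ.restrictScalars ℚ)
        (θ σ) (hlift σ) (c σ) (hc σ)
    constructor
    · intro hx σ hσ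
      exact hx (σ.restrictScalars ℚ) ((key σ).mpr hσ)
    · intro hx σ hσ
      -- The field of moduli is defined by automorphisms over `ℚ`. Those preserving the `G`-cover
      -- preserve the mere cover, so they already fix the mere field of moduli and `c` is defined on
      -- them.
      have hσ' : σ ∈ C.mereFieldOfModuli.fixingSubgroup := by
        obtain ⟨η, h1, -⟩ := hσ
        exact (IntermediateField.mem_fixingSubgroup_iff _ _).mpr fun y hy => hy σ ⟨η, h1⟩
      exact hx (IntermediateField.fixingSubgroupEquiv _ ⟨σ, hσ'⟩) ((key _).mp hσ)
  obtain ⟨h1, h2⟩ := exists_algEquiv_mulEquiv_of_surjective c.rangeRestrict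
    c.rangeRestrict_surjective N hopen
  have h3 := finiteDimensional_fixedField_of_isOpen _ hopen
  rw [← hM] at h1 h2 h3
  refine ⟨?_, h, h1, c.range, N, inferInstance, h2⟩
  exact FiniteDimensional.trans ℚ C.mereFieldOfModuli (IntermediateField.extendScalars h)

end GaloisCover

theorem corollary4p5 {G : Type*} [Group G] [Finite G] (C : GaloisCover G) :
    -- small fields of definition over `L`, and over the field of moduli
    ((∀ L : IntermediateField ℚ Qbar, FiniteDimensional ℚ L →
        (C.IsMereFieldOfDefinition L ↔ C.mereFieldOfModuli ≤ L) ∧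
        (C.IsMereFieldOfDefinition L →
          ∃ E : IntermediateField L Qbar, FiniteDimensional L E ∧ IsGalois L E ∧
            C.IsFieldOfDefinition E ∧
            ∃ H : Subgroup (MulAut G), Nonempty ((E ≃ₐ[L] E) ≃* H))) ∧
      FiniteDimensional ℚ C.fieldOfModuli ∧
      C.IsMereFieldOfDefinition C.fieldOfModuli ∧
      ∃ E : IntermediateField C.fieldOfModuli Qbar,
        FiniteDimensional C.fieldOfModuli E ∧ IsGalois C.fieldOfModuli E ∧
          C.IsFieldOfDefinition E ∧
          ∃ H : Subgroup (MulAut G), Nonempty ((E ≃ₐ[C.fieldOfModuli] E) ≃* H)) ∧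
    -- realization of a semidirect product as a Galois group over `L`
    (∀ L : IntermediateField ℚ Qbar, FiniteDimensional ℚ L → C.IsMereFieldOfDefinition L →
      ∃ (H : Subgroup (MulAut G)) (N : IntermediateField L Qbar),
        FiniteDimensional L N ∧ IsGalois L N ∧
          Nonempty ((N ≃ₐ[L] N) ≃* G ⋊[H.subtype] H)) ∧
    -- the extension of the two fields of moduli
    (∃ h : C.mereFieldOfModuli ≤ C.fieldOfModuli,
      IsGalois C.mereFieldOfModuli (IntermediateField.extendScalars h) ∧
        ∃ (H : Subgroup (MulAut G)) (N : Subgroup H) (_ : N.Normal),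
          Nonempty ((IntermediateField.extendScalars h ≃ₐ[C.mereFieldOfModuli]
            IntermediateField.extendScalars h) ≃* H ⧸ N)) := by
  have hnum : ∀ L : IntermediateField ℚ Qbar, FiniteDimensional ℚ L → NumberField L :=
    fun L h => ⟨⟩
  have hdef : ∀ L : IntermediateField ℚ Qbar, C.IsMereFieldOfDefinition L →
      ∃ E : IntermediateField L Qbar, FiniteDimensional L E ∧ IsGalois L E ∧
        C.IsFieldOfDefinition E ∧ ∃ H : Subgroup (MulAut G), Nonempty ((E ≃ₐ[L] E) ≃* H) := by
    intro L hL
    obtain ⟨θ, h1, h2⟩ := C.exists_galois_action.2 L ((C.isMereFieldOfDefinition_iff L).mp hL)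
    exact C.exists_isFieldOfDefinition θ h1 h2
  obtain ⟨hfin, hgal⟩ := C.exists_isGalois_fieldOfModuli
  have hM := (C.isMereFieldOfDefinition_iff _).mpr C.mereFieldOfModuli_le_fieldOfModuli
  refine ⟨⟨fun L _ => ⟨C.isMereFieldOfDefinition_iff L, hdef L⟩, hfin, hM, hdef _ hM⟩,
    fun L h hL => ?_, hgal⟩
  have := hnum L h
  obtain ⟨θ, h1, h2⟩ := C.exists_galois_action.2 L ((C.isMereFieldOfDefinition_iff L).mp hL)
  exact C.exists_isGalois_semidirectProduct θ h1 h2
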